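/- Let $F$ be a free group of finite rank $n>1$ with free basis $\mathcal B$, let $T$ be the Cayley tree of $F$ with respect to $\mathcal B$, and let $\partial T$ be its boundary at infinity. For $h,g\in F$ with $g\neq 1$ write $hg^{\pm\infty}=\lim_{i\to\infty}hg^{\pm i}\in\partial T$. Let $\underline w$ be a multiword, that is, a finite set of nontrivial elements of $F$. Its line pattern $\mathcal L$ is the set of geodesics of $T$ with endpoints $hw^{-\infty},hw^{\infty}$ for $h\in F$, $w\in\underline w$. The decomposition space $\mathcal D$ is the quotient of $\partial T$ obtained by identifying the two endpoints of each line of $\mathcal L$, and $\delta\colon\partial T\to\mathcal D$ is the quotient map; $F$ acts on both spaces. For a connected subset $X$ of $\overline T=T\cup\partial T$, the Whitehead graph $\mathrm{Wh}(X)$ has one vertex for each connected component of $\overline T\setminus X$ and, for each line of $\mathcal L$ with endpoints in two different components, one edge joining the corresponding vertices. If $Y$ is a set of vertices of $T$, then $\mathrm{Wh}(X)\setminus Y$ is obtained by deleting the vertices of $\mathrm{Wh}(X)$ that correspond to edges of $T$ leading from $X$ to a point of $Y$, keeping the incident edges as loose ends. Assume that $\mathcal D$ is connected and that the basis $\mathcal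 B$ is chosen so that the Whitehead graph $\mathrm{Wh}(*)$ at a vertex $*$ of $T$ is connected and has no cut vertex. A cut set in $\mathcal D$ is a set whose complement is not connected; a cut pair is a two-point cut set neither point of which is itself a cut point. A cut pair $\{x_0,x_1\}$ is uncrossed if there is no cut pair $\{y_0,y_1\}$ such that $y_0$ and $y_1$ lie in different connected components of $\mathcal D\setminus\{x_0,x_1\}$. For distinct $\xi_0,\xi_1\in\partial T$, $g,h\in F$ with $g\ne1$, and $a\in\mathcal B\cup\mathcal B^{-1}$, say that $(g,h,a)$ approximates $[\xi_0,\xi_1]$ if 1. the oriented edges $[h,ha]$ and $[hg,hga]$ belong to $[\xi_0,\xi_1]\cap[hg^{-\infty},hg^{\infty}]$ (as geodesics oriented from the first to the second endpoint); 2. components of $\mathrm{Wh}([ha,hg])\setminus\{h,hga\}$ that are in different components of $\mathrm{Wh}([\xi_0,\xi_1])$ are in different components of $\mathrm{Wh}([hg^{-\infty},hg^{\infty}])$; 3. for each line $l\in\mathcal L$ crossing the edge $[h,ha]$, the lines $l$ and $hgh^{-1}l$ belong to the same component of $\mathrm{Wh}([\xi_0,\xi_1])$. **Proposition.** There is a number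 $N$, depending only on $F$, $\mathcal B$ and $\underline w$, such that for every uncrossed cut pair $\{x_0,x_1\}$ in $\mathcal D$ the following hold. * Each of $x_0,x_1$ has exactly one preimage: there are $\xi_0,\xi_1\in\partial T$ with $\delta^{-1}(x_0)=\{\xi_0\}$ and $\delta^{-1}(x_1)=\{\xi_1\}$. * There is a triple $(g,h,a)$ that approximates $[\xi_0,\xi_1]$ and for which some conjugate of $g$ has word length at most $N$ with respect to $\mathcal B$. * For every triple $(g,h,a)$ that approximates $[\xi_0,\xi_1]$ we have $\delta(hg^{-\infty})=x_0$ and $\delta(hg^{\infty})=x_1$, and $\delta^{-1}(\{x_0,x_1\})=\{hg^{-\infty},hg^{\infty}\}$ is the pair of endpoints of the axis of $hgh^{-1}$; in particular $hgh^{-1}$ fixes $x_0$ and $x_1$. * The pair is rational: the setwise stabilizer of $\{x_0,x_1\}$ in $F$ is an infinite cyclic group $\langle k\rangle$ with $\xi_0=k^{-\infty}$ and $\xi_1=k^{\infty}$. -/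

import Mathlib

open Filter Topology Pointwise

namespace LinePattern

/-! ### The boundary of the Cayley tree of a free group

The Cayley tree `T` of `FreeGroup ι` with respect to its standard basis has vertex set
`FreeGroup ι`; the oriented edge with label `a` starting at `u` ends at `u * letter a`, where `a`
is a basis element or the inverse of one. -/

/-- The basis elements `(i, true)` and their inverses `(i, false)`. -/
abbrev Letter (ι : Type*) := ι × Bool

/-- The inverse of a letter. -/
def Letter.bar {ι : Type*} (a : Letter ι) : Letter ι := (a.1, !a.2)

/-- The element of the free group represented by a letter. -/
def letter {ι : Type*} (a : Letter ι) : FreeGroup ι := FreeGroup.mk [a]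

/-- The boundary at infinity of the Cayley tree: the infinite reduced words, that is, the geodesic
rays issuing from the vertex `1`. -/
def Boundary (ι : Type*) := {ξ : ℕ → Letter ι // ∀ n, ξ (n + 1) ≠ (ξ n).bar}

namespace Boundary

variable {ι : Type*}

/-- The topology of the boundary: the one induced by the product of the discrete topologies. -/
instance : TopologicalSpace (Boundary ι) :=
  TopologicalSpace.induced (fun ξ : Boundary ι => ξ.1)
    (@Pi.topologicalSpace ℕ (fun _ => Letter ι) (fun _ => ⊥))

theorem bar_bar (a : Letter ι) : a.bar.bar = a := by
  simp [Letter.bar]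

theorem bar_ne (a : Letter ι) : a ≠ a.bar := by
  intro h
  have := congrArg Prod.snd h
  simp [Letter.bar] at this

@[ext] theorem ext {ξ η : Boundary ι} (h : ∀ n, ξ.1 n = η.1 n) : ξ = η :=
  Subtype.ext (funext h)

/-- Delete the first letter of an infinite reduced word. -/
def tail (ξ : Boundary ι) : Boundary ι := ⟨fun n => ξ.1 (n + 1), fun n => ξ.2 (n + 1)⟩

/-- Write a letter, which must not cancel, in front of an infinite reduced word. -/
def cons (a : Letter ι) (ξ : Boundary ι) (h : ξ.1 0 ≠ a.bar) : Boundary ι :=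
  ⟨fun n => Nat.casesOn n a ξ.1, fun n => by cases n with
    | zero => exact h
    | succ k => exact ξ.2 k⟩

open Classical in
/-- Left multiplication of an infinite reduced word by a letter, followed by reduction. -/
noncomputable def letterMul (a : Letter ι) (ξ : Boundary ι) : Boundary ι :=
  if h : ξ.1 0 = a.bar then ξ.tail else ξ.cons a h

theorem letterMul_bar (a : Letter ι) (ξ : Boundary ι) :
    letterMul a.bar (letterMul a ξ) = ξ := by
  by_cases h : ξ.1 0 = a.bar
  · have h1 : letterMul a ξ = ξ.tail := by simp [letterMul, h]
    have h2 : ξ.tail.1 0 ≠ a.bar.bar := by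
      rw [← h]; exact ξ.2 0
    rw [h1, letterMul, dif_neg h2]
    ext1 n
    cases n with
    | zero => exact h.symm
    | succ k => rfl
  · have h1 : letterMul a ξ = ξ.cons a h := by simp [letterMul, h]
    have h2 : (ξ.cons a h).1 0 = a.bar.bar := (bar_bar a).symm
    rw [h1, letterMul, dif_pos h2]
    rfl

/-- Left multiplication by a letter as a permutation of the boundary. -/
noncomputable def letterPerm (a : Letter ι) : Equiv.Perm (Boundary ι) where
  toFun := letterMul a
  invFun := letterMul a.bar
  left_inv := letterMul_bar a
  right_inv ξ := by simpa [bar_bar] using letterMul_bar a.bar ξ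

/-- The action of the free group on the boundary of its Cayley tree that extends left
multiplication. -/
noncomputable instance : MulAction (FreeGroup ι) (Boundary ι) :=
  MulAction.compHom (Boundary ι)
    (FreeGroup.lift (fun i : ι => letterPerm (i, true)))

theorem of_smul (i : ι) (ξ : Boundary ι) :
    FreeGroup.of i • ξ = letterMul (i, true) ξ := by
  change (FreeGroup.lift (fun i : ι => letterPerm (i, true)) (FreeGroup.of i)) ξ = _
  simp [letterPerm]

theorem inv_of_smul (i : ι) (ξ : Boundary ι) :
    (FreeGroup.of i)⁻¹ • ξ = letterMul (i, false) ξ := by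
  rw [inv_smul_eq_iff, of_smul]
  exact (letterMul_bar (i, false) ξ).symm

end Boundary

section

variable {ι : Type*} [DecidableEq ι]

/-- The sequence `u` of vertices of the Cayley tree converges to the boundary point `ξ`: every
initial segment of `ξ` is eventually an initial segment of the reduced word `u i`. -/
def ConvergesTo (u : ℕ → FreeGroup ι) (ξ : Boundary ι) : Prop :=
  ∀ k : ℕ, ∀ᶠ i in atTop, ∀ j < k, (u i).toWord[j]? = some (ξ.1 j)

theorem toWord_letter_mul (a : Letter ι) (x : FreeGroup ι) :
    (letter a * x).toWord =
      if x.toWord[0]? = some a.bar then x.toWord.tail else a :: x.toWord := by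
  have h : letter a * x = FreeGroup.mk (a :: x.toWord) := by
    conv_lhs => rw [← FreeGroup.mk_toWord (x := x)]
    rfl
  rw [h, FreeGroup.toWord_mk, FreeGroup.reduce.cons, FreeGroup.reduce_toWord]
  cases hx : x.toWord with
  | nil => simp
  | cons b L =>
    obtain ⟨i, s⟩ := a
    obtain ⟨j, t⟩ := b
    by_cases hc : i = j ∧ s = !t
    · obtain ⟨rfl, rfl⟩ := hc
      simp [Letter.bar]
    · have : ¬ (j = i ∧ t = !s) := by
        rintro ⟨rfl, rfl⟩; simp at hc
      simp [Letter.bar, hc, this]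

theorem ConvergesTo.letterMul {u : ℕ → FreeGroup ι} {ξ : Boundary ι} (h : ConvergesTo u ξ)
    (a : Letter ι) : ConvergesTo (fun i => letter a * u i) (ξ.letterMul a) := by
  intro k
  filter_upwards [h (k + 1)] with i hi j hj
  have h0 := hi 0 (Nat.succ_pos k)
  rw [toWord_letter_mul, h0]
  by_cases hc : ξ.1 0 = a.bar
  · have h1 : ξ.letterMul a = ξ.tail := by simp [Boundary.letterMul, hc]
    rw [h1, if_pos (by rw [hc])]
    simpa [Boundary.tail] using hi (j + 1) (by omega)
  · have h1 : ξ.letterMul a = ξ.cons a hc := by simp [Boundary.letterMul, hc]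
    rw [h1, if_neg (by simpa using hc)]
    cases j with
    | zero => simp [Boundary.cons]
    | succ j => simpa [Boundary.cons] using hi j (by omega)

theorem ConvergesTo.smul {u : ℕ → FreeGroup ι} {ξ : Boundary ι} (h : ConvergesTo u ξ)
    (g : FreeGroup ι) : ConvergesTo (fun i => g * u i) (g • ξ) := by
  have key : ∀ g : FreeGroup ι, ∀ (u : ℕ → FreeGroup ι) (ξ : Boundary ι), ConvergesTo u ξ →
      ConvergesTo (fun i => g * u i) (g • ξ) := by
    intro g
    refine FreeGroup.induction_on g ?_ ?_ ?_ ?_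
    · intro u ξ h
      simpa using h
    · intro i u ξ h
      have := h.letterMul (i, true)
      rwa [← Boundary.of_smul] at this
    · intro i _ u ξ h
      have := h.letterMul (i, false)
      rwa [← Boundary.inv_of_smul] at this
    · intro x y hx hy u ξ h
      simpa [mul_assoc, mul_smul] using hx _ _ (hy _ _ h)
  exact key g u ξ h

/-! ### Line patterns and decomposition spaces -/

/-- `ξ = h g^{-∞}` and `η = h g^{∞}`: the ends of the `g`-line through `h`.  (If `h = 1`, these are
the ends of the axis of `g`; in general, those of the axis of `h g h⁻¹`.)  There are such points
only if `g ≠ 1`. -/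
def IsLineEnds (h g : FreeGroup ι) (ξ η : Boundary ι) : Prop :=
  ConvergesTo (fun i : ℕ => h * g⁻¹ ^ i) ξ ∧ ConvergesTo (fun i : ℕ => h * g ^ i) η

/-- The line pattern generated by the multiword `W`.  A line is recorded by the unordered pair of
its ends: the ends `h w^{-∞}`, `h w^∞` of the `w`-lines through `h`, for `w ∈ W`. -/
def lines (W : Finset (FreeGroup ι)) : Set (Sym2 (Boundary ι)) :=
  {l | ∃ h : FreeGroup ι, ∃ w ∈ W, ∃ ξ η, IsLineEnds h w ξ η ∧ l = s(ξ, η)}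

theorem map_smul_mem_lines {W : Finset (FreeGroup ι)} {l : Sym2 (Boundary ι)} (hl : l ∈ lines W)
    (g : FreeGroup ι) : l.map (g • ·) ∈ lines W := by
  obtain ⟨h, w, hw, ξ, η, ⟨h1, h2⟩, rfl⟩ := hl
  refine ⟨g * h, w, hw, g • ξ, g • η, ⟨?_, ?_⟩, rfl⟩
  · simpa [mul_assoc] using h1.smul g
  · simpa [mul_assoc] using h2.smul g

/-- The decomposition space: the topological quotient of the boundary by the equivalence relation
generated by identifying the two ends of each line of the pattern. -/
def DecompositionSpace (W : Finset (FreeGroup ι)) : Type _ :=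
  Quot (fun ξ η : Boundary ι => s(ξ, η) ∈ lines W)

instance (W : Finset (FreeGroup ι)) : TopologicalSpace (DecompositionSpace W) :=
  inferInstanceAs (TopologicalSpace (Quot _))

/-- The quotient map `δ` from the boundary to the decomposition space. -/
def δ (W : Finset (FreeGroup ι)) (ξ : Boundary ι) : DecompositionSpace W := Quot.mk _ ξ

/-- The action of the free group on the decomposition space, induced by that on the boundary. -/
noncomputable instance (W : Finset (FreeGroup ι)) :
    MulAction (FreeGroup ι) (DecompositionSpace W) where
  smul g := Quot.map (g • ·) (fun _ _ h => map_smul_mem_lines h g)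
  one_smul x := by
    induction x using Quot.ind with
    | mk ξ => exact congrArg (δ W) (one_smul _ ξ)
  mul_smul g h x := by
    induction x using Quot.ind with
    | mk ξ => exact congrArg (δ W) (mul_smul g h ξ)

theorem smul_δ (W : Finset (FreeGroup ι)) (g : FreeGroup ι) (ξ : Boundary ι) :
    g • δ W ξ = δ W (g • ξ) := rfl

end

/-! ### Cut points and cut pairs -/

section

variable {X : Type*} [TopologicalSpace X]

/-- A cut set: a set whose complement is not connected. -/
def IsCutSet (S : Set X) : Prop := ¬ IsConnected Sᶜ

/-- A cut point. -/
def IsCutPoint (x : X) : Prop := IsCutSet {x}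

/-- A cut pair: a two point cut set neither point of which is a cut point. -/
def IsCutPair (x₀ x₁ : X) : Prop :=
  x₀ ≠ x₁ ∧ IsCutSet {x₀, x₁} ∧ ¬ IsCutPoint x₀ ∧ ¬ IsCutPoint x₁

/-- `{x₀, x₁}` crosses `{y₀, y₁}`: `x₀` and `x₁` are in different connected components of the
complement of `{y₀, y₁}`. -/
def Crosses (x₀ x₁ y₀ y₁ : X) : Prop :=
  x₀ ∈ ({y₀, y₁} : Set X)ᶜ ∧ x₁ ∈ ({y₀, y₁} : Set X)ᶜ ∧
    connectedComponentIn ({y₀, y₁} : Set X)ᶜ x₀ ≠ connectedComponentIn ({y₀, y₁} : Set X)ᶜ x₁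

/-- An uncrossed cut pair: a cut pair that is not crossed by any cut pair. -/
def IsUncrossedCutPair (x₀ x₁ : X) : Prop :=
  IsCutPair x₀ x₁ ∧ ∀ y₀ y₁ : X, IsCutPair y₀ y₁ → ¬ Crosses y₀ y₁ x₀ x₁

end

/-! ### Geodesics and Whitehead graphs -/

section

variable {ι : Type*}

/-- The shadow of the oriented edge `(v, a)` from `v` to `v * letter a`: the boundary points `ξ` for
which the geodesic ray from `v` to `ξ` starts with this edge. -/
def shadow (v : FreeGroup ι) (a : Letter ι) : Set (Boundary ι) := {ξ | (v⁻¹ • ξ).1 0 = a}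

/-- The vertices of the geodesic `[ξ, η]` of the tree joining two boundary points: those from which
the rays to `ξ` and to `η` start with different edges. -/
def geodesic (ξ η : Boundary ι) : Set (FreeGroup ι) := {v | (v⁻¹ • ξ).1 0 ≠ (v⁻¹ • η).1 0}

/-- The oriented edge `(v, a)` belongs to the geodesic `[ξ, η]` oriented from `ξ` to `η`: it points
towards `η` and not towards `ξ`. -/
def EdgeOn (ξ η : Boundary ι) (v : FreeGroup ι) (a : Letter ι) : Prop :=
  η ∈ shadow v a ∧ ξ ∉ shadow v a

/-- The line `l` crosses the edge `(v, a)`: the edge belongs to `l`, in one of its orientations. -/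
def LineCrosses (l : Sym2 (Boundary ι)) (v : FreeGroup ι) (a : Letter ι) : Prop :=
  ∃ ξ η, l = s(ξ, η) ∧ EdgeOn ξ η v a

/-- The vertices of the segment `[u, v]` of the tree joining two vertices. -/
def segment [DecidableEq ι] (u v : FreeGroup ι) : Set (FreeGroup ι) :=
  {x | (u⁻¹ * x).norm + (x⁻¹ * v).norm = (u⁻¹ * v).norm}

/-- A vertex of the Whitehead graph over the subtree with vertex set `X`: a connected component of
the complement of the (closed) subtree in the compactified tree.  It is recorded by the oriented
edge `(v, a)` that leads into it, with `v` in `X` and `v * letter a` not in `X`; its boundary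
points are the shadow of that edge. -/
def IsWhVertex (X : Set (FreeGroup ι)) (p : FreeGroup ι × Letter ι) : Prop :=
  p.1 ∈ X ∧ p.1 * letter p.2 ∉ X

/-- An edge of the Whitehead graph over `X`: a line of the pattern whose ends lie in two different
components of the complement. -/
def IsWhEdge [DecidableEq ι] (W : Finset (FreeGroup ι)) (X : Set (FreeGroup ι))
    (l : Sym2 (Boundary ι)) : Prop :=
  l ∈ lines W ∧ ∃ ξ η p q, l = s(ξ, η) ∧ IsWhVertex X p ∧ IsWhVertex X q ∧ p ≠ q ∧
    ξ ∈ shadow p.1 p.2 ∧ η ∈ shadow q.1 q.2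

/-- The vertices and edges that make up `Wh(X) ∖ Y`, the Whitehead graph over `X` with the vertices
that correspond to an edge leading from `X` to a vertex in `Y` deleted, the edges incident to a
deleted vertex being retained as loose ends. -/
def whElements [DecidableEq ι] (W : Finset (FreeGroup ι)) (X Y : Set (FreeGroup ι)) :
    Set ((FreeGroup ι × Letter ι) ⊕ Sym2 (Boundary ι)) :=
  {e | (∃ p, e = .inl p ∧ IsWhVertex X p ∧ p.1 * letter p.2 ∉ Y) ∨
    (∃ l, e = .inr l ∧ IsWhEdge W X l)}

/-- The incidence graph of `Wh(X) ∖ Y`: a vertex `p` and an edge `l` of `Wh(X) ∖ Y` are joined if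
`l` is incident to `p`. -/
def whIncidence [DecidableEq ι] (W : Finset (FreeGroup ι)) (X Y : Set (FreeGroup ι)) :
    SimpleGraph ((FreeGroup ι × Letter ι) ⊕ Sym2 (Boundary ι)) :=
  SimpleGraph.fromRel (fun e f => e ∈ whElements W X Y ∧ f ∈ whElements W X Y ∧
    ∃ p l, e = .inl p ∧ f = .inr l ∧ ∃ ξ ∈ l, ξ ∈ shadow p.1 p.2)

/-- `e` and `f` (vertices or edges) lie in the same connected component of `Wh(X) ∖ Y`. -/
def SameWhComponent [DecidableEq ι] (W : Finset (FreeGroup ι)) (X Y : Set (FreeGroup ι))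
    (e f : (FreeGroup ι × Letter ι) ⊕ Sym2 (Boundary ι)) : Prop :=
  e ∈ whElements W X Y ∧ f ∈ whElements W X Y ∧ (whIncidence W X Y).Reachable e f

/-- `Wh(X) ∖ Y` is connected. -/
def WhConnected [DecidableEq ι] (W : Finset (FreeGroup ι)) (X Y : Set (FreeGroup ι)) : Prop :=
  ∀ e ∈ whElements W X Y, ∀ f ∈ whElements W X Y, SameWhComponent W X Y e f

/-- The classical Whitehead graph `Wh(*)`, which is the one over the vertex `1`, is connected and
has no cut vertex. -/
def WhConnectedWithoutCutVertices [DecidableEq ι] (W : Finset (FreeGroup ι)) : Prop :=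
  WhConnected W {1} ∅ ∧ ∀ a : Letter ι, WhConnected W {1} {letter a}

/-- The line with ends `h g^{-∞}` and `h g^∞`, that is, the axis of `h g h⁻¹`, approximates the
geodesic `[ξ₀, ξ₁]`:
* it overlaps `[ξ₀, ξ₁]` in the oriented edges `[h, ha]` and `[hg, hga]`;
* components of `Wh([ha, hg]) ∖ {h, hga}` that are in different components of `Wh([ξ₀, ξ₁])` are in
  different components of `Wh([h g^{-∞}, h g^∞])` (components are compared through the vertices
  and edges they contain);
* for each line `l` of the pattern crossing `[h, ha]`, the lines `l` and `h g h⁻¹ l` belong to the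
  same component of `Wh([ξ₀, ξ₁])`. -/
def Approximates [DecidableEq ι] (W : Finset (FreeGroup ι)) (ξ₀ ξ₁ : Boundary ι)
    (g h : FreeGroup ι) (a : Letter ι) : Prop :=
  ∃ ζ₀ ζ₁ : Boundary ι, IsLineEnds h g ζ₀ ζ₁ ∧
    (EdgeOn ξ₀ ξ₁ h a ∧ EdgeOn ξ₀ ξ₁ (h * g) a ∧ EdgeOn ζ₀ ζ₁ h a ∧ EdgeOn ζ₀ ζ₁ (h * g) a) ∧
    (∀ e ∈ whElements W (segment (h * letter a) (h * g)) {h, h * g * letter a},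
      ∀ f ∈ whElements W (segment (h * letter a) (h * g)) {h, h * g * letter a},
        ¬ SameWhComponent W (geodesic ξ₀ ξ₁) ∅ e f →
          ¬ SameWhComponent W (geodesic ζ₀ ζ₁) ∅ e f) ∧
    (∀ l ∈ lines W, LineCrosses l h a →
      SameWhComponent W (geodesic ξ₀ ξ₁) ∅ (.inr l) (.inr (l.map ((h * g * h⁻¹) • ·))))

end

end LinePattern

/-!
The proof replaces connected components, both of subsets of the decomposition space and of Whitehead
graphs, by colourings (`IsColoring`): locally constant functions on the boundary away from a closed
set `Z` that take the same value at the two ends of each line.  A finite set of the decomposition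
space is a cut set if and only if the complement of its preimage has a nonconstant colouring
(`IsCutSet.exists_isColoring`, `IsColoring.isCutSet`).  The hypothesis on the Whitehead graph enters
through `exists_line_of_cut` and makes a colouring constant on each shadow that avoids `Z`
(`IsColoring.eq_of_mem_shadow`), so that near a geodesic a colouring is a combinatorial object.

A point of the decomposition space has at most two preimages, because axes with a common end
coincide.  Suppose that a point `x₀` of an uncrossed cut pair has two: the ends of the axis of some
`t`.  A limit of the translates of a colouring under powers of `t` is a colouring of the complement
of `x₀`, which is not a cut point; so the colouring is constant near each end of the axis, and with
different values, as `x₁` is not a cut point.  Then `{t^{-k} x₁, t^k x₁}` is a cut pair that crosses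
`{x₀, x₁}` for large `k` (`IsUncrossedCutPair.not_line`).

Let an axis, of `t` say, approximate `[ξ₀, ξ₁]`.  Since the lines crossing the first common edge keep
their colour under `t`, the colours between this edge and its translate extend `t`-periodically to a
colouring for the axis (`IsColoring.exists_periodic`).  If the repelling end of `t` were not `ξ₀`,
comparing the two colourings at the vertex where the geodesics branch off would show that
`{t⁻¹ x₀, t x₀}` is a cut pair that crosses `{x₀, x₁}` (`IsUncrossedCutPair.left_eq`); the other end
is treated by reversing the geodesics.

For the existence of an approximation, colour the boundary by the components of the Whitehead graph
over `[ξ₀, ξ₁]`.  Every colour occurs among the finitely many lines that cross a given edge, so there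
are boundedly many patterns of colours on the lines crossing an edge, and two edges at bounded
distance have the same label and the same pattern (`IsGeodesicParam.exists_repetition`).  The axis
through these edges approximates `[ξ₀, ξ₁]`; the condition on the components over the segment follows
from the periodic extension of the colouring.

Finally, an element that stabilizes `{x₀, x₁}` shifts the geodesic `[ξ₀, ξ₁]`, as no element of a free
group exchanges the ends of a geodesic, and the shifts form an infinite cyclic group
(`exists_stabilizer_eq_zpowers`).
-/

namespace LinePattern

/-! ### Shadows -/

section

variable {ι : Type*}

theorem letter_bar (a : Letter ι) : letter a.bar = (letter a)⁻¹ := by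
  simp [letter, Letter.bar, FreeGroup.inv_mk, FreeGroup.invRev]

theorem bar_bar (a : Letter ι) : a.bar.bar = a := Boundary.bar_bar a

theorem bar_ne (a : Letter ι) : a ≠ a.bar := Boundary.bar_ne a

theorem bar_injective : Function.Injective (Letter.bar : Letter ι → Letter ι) :=
  Function.LeftInverse.injective bar_bar

theorem letter_smul (a : Letter ι) (ξ : Boundary ι) : letter a • ξ = ξ.letterMul a := by
  obtain ⟨i, _ | _⟩ := a
  · rw [← Boundary.inv_of_smul]
    rfl
  · rw [← Boundary.of_smul]
    rfl

theorem mem_shadow {v : FreeGroup ι} {a : Letter ι} {ξ : Boundary ι} :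
    ξ ∈ shadow v a ↔ (v⁻¹ • ξ).1 0 = a := Iff.rfl

theorem mem_shadow_self (v : FreeGroup ι) (ξ : Boundary ι) : ξ ∈ shadow v ((v⁻¹ • ξ).1 0) := rfl

/-- Moving the base point of a ray one step along the ray deletes its first letter. -/
theorem inv_smul_of_mem_shadow {v : FreeGroup ι} {a : Letter ι} {ξ : Boundary ι}
    (h : ξ ∈ shadow v a) : (v * letter a)⁻¹ • ξ = (v⁻¹ • ξ).tail := by
  rw [mul_inv_rev, mul_smul, ← letter_bar, letter_smul, Boundary.letterMul, dif_pos]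
  rw [bar_bar]; exact h

theorem mem_shadow_bar {v : FreeGroup ι} {a : Letter ι} {ξ : Boundary ι} :
    ξ ∈ shadow (v * letter a) a.bar ↔ ξ ∉ shadow v a := by
  constructor
  · intro h h'
    rw [mem_shadow, inv_smul_of_mem_shadow h'] at h
    refine (v⁻¹ • ξ).2 0 ?_
    rw [mem_shadow.1 h']
    exact h
  · intro h
    rw [mem_shadow, mul_inv_rev, mul_smul, ← letter_bar, letter_smul, Boundary.letterMul, dif_neg]
    · rfl
    · rw [bar_bar]; exact h

theorem shadow_mul_letter_bar (v : FreeGroup ι) (a : Letter ι) :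
    shadow (v * letter a) a.bar = (shadow v a)ᶜ :=
  Set.ext fun _ => mem_shadow_bar

theorem smul_mem_shadow {g v : FreeGroup ι} {a : Letter ι} {ξ : Boundary ι} :
    g • ξ ∈ shadow (g * v) a ↔ ξ ∈ shadow v a := by
  rw [mem_shadow, mem_shadow, mul_inv_rev, smul_smul, mul_assoc, inv_mul_cancel, mul_one]

theorem mem_shadow_mul {g v : FreeGroup ι} {a : Letter ι} {ξ : Boundary ι} :
    ξ ∈ shadow (g * v) a ↔ g⁻¹ • ξ ∈ shadow v a := by
  rw [← smul_mem_shadow (g := g) (v := v), smul_inv_smul]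

theorem shadow_subset_shadow {v : FreeGroup ι} {a b : Letter ι} (h : b ≠ a.bar) :
    shadow (v * letter a) b ⊆ shadow v a := by
  intro ξ hξ
  by_contra hc
  exact h ((mem_shadow.1 hξ).symm.trans (mem_shadow.1 (mem_shadow_bar.2 hc)))

theorem eq_of_mem_shadow {v : FreeGroup ι} {a b : Letter ι} {ξ : Boundary ι}
    (ha : ξ ∈ shadow v a) (hb : ξ ∈ shadow v b) : a = b :=
  (mem_shadow.1 ha).symm.trans hb

theorem shadow_nonempty (v : FreeGroup ι) (a : Letter ι) : (shadow v a).Nonempty :=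
  ⟨v • (show Boundary ι from ⟨fun _ => a, fun _ => bar_ne a⟩), by rw [mem_shadow, inv_smul_smul]⟩

/-- The vertex reached after `n` steps along the ray from `v` to `ξ`. -/
noncomputable def rayVertex (v : FreeGroup ι) (ξ : Boundary ι) : ℕ → FreeGroup ι
  | 0 => v
  | n + 1 => rayVertex v ξ n * letter ((v⁻¹ • ξ).1 n)

theorem inv_rayVertex_smul (v : FreeGroup ι) (ξ η : Boundary ι) (n : ℕ)
    (h : ∀ j < n, (v⁻¹ • η).1 j = (v⁻¹ • ξ).1 j) (k : ℕ) :
    ((rayVertex v ξ n)⁻¹ • η).1 k = (v⁻¹ • η).1 (n + k) := by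
  induction n generalizing k with
  | zero => simp [rayVertex]
  | succ n ih =>
    have ih := ih fun j hj => h j (by omega)
    have : η ∈ shadow (rayVertex v ξ n) ((v⁻¹ • ξ).1 n) := by
      rw [mem_shadow, ih 0]; exact h n (by omega)
    rw [rayVertex, inv_smul_of_mem_shadow this]
    change ((rayVertex v ξ n)⁻¹ • η).1 (k + 1) = _
    rw [ih, add_right_comm, add_assoc]

theorem mem_shadow_rayVertex (v : FreeGroup ι) (ξ : Boundary ι) (n : ℕ) :
    ξ ∈ shadow (rayVertex v ξ n) ((v⁻¹ • ξ).1 n) := by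
  rw [mem_shadow, inv_rayVertex_smul v ξ ξ n (fun _ _ => rfl)]; rfl

theorem shadow_rayVertex_succ_subset (v : FreeGroup ι) (ξ : Boundary ι) (n : ℕ) :
    shadow (rayVertex v ξ (n + 1)) ((v⁻¹ • ξ).1 (n + 1)) ⊆
      shadow (rayVertex v ξ n) ((v⁻¹ • ξ).1 n) :=
  shadow_subset_shadow ((v⁻¹ • ξ).2 n)

theorem shadow_rayVertex_antitone (v : FreeGroup ι) (ξ : Boundary ι) :
    Antitone fun n => shadow (rayVertex v ξ n) ((v⁻¹ • ξ).1 n) :=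
  antitone_nat_of_succ_le fun n => shadow_rayVertex_succ_subset v ξ n

theorem agree_of_mem_shadow_rayVertex {v : FreeGroup ι} {ξ η : Boundary ι} {n : ℕ}
    (h : η ∈ shadow (rayVertex v ξ n) ((v⁻¹ • ξ).1 n)) :
    ∀ j ≤ n, (v⁻¹ • η).1 j = (v⁻¹ • ξ).1 j := by
  intro j
  induction j using Nat.strong_induction_on with
  | _ j ih =>
    intro hj
    have := shadow_rayVertex_antitone v ξ hj h
    rw [mem_shadow, inv_rayVertex_smul v ξ η j (fun i hi => ih i hi (by omega))] at this
    exact this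

/-! ### The topology of the boundary -/

namespace Boundary

theorem mem_nhds_iff {ξ : Boundary ι} {U : Set (Boundary ι)} :
    U ∈ 𝓝 ξ ↔ ∃ k, ∀ η : Boundary ι, (∀ j < k, η.1 j = ξ.1 j) → η ∈ U := by
  let _ : TopologicalSpace (Letter ι) := ⊥
  have : DiscreteTopology (Letter ι) := ⟨rfl⟩
  rw [nhds_induced, Filter.mem_comap]
  constructor
  · rintro ⟨V, hV, hVU⟩
    rw [nhds_pi, Filter.mem_pi'] at hV
    obtain ⟨I, t, ht, htV⟩ := hV
    refine ⟨I.sup id + 1, fun η hη => hVU (htV ?_)⟩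
    intro i hi
    change η.1 i ∈ t i
    rw [hη i (Nat.lt_succ_of_le (Finset.le_sup (f := id) hi))]
    exact mem_of_mem_nhds (ht i)
  · rintro ⟨k, hk⟩
    refine ⟨(Set.Iio k).pi fun j => {ξ.1 j}, ?_, fun η hη => hk η hη⟩
    exact set_pi_mem_nhds (Set.finite_Iio k) fun j _ => by simp [nhds_discrete]

theorem continuous_of_agree {f : Boundary ι → Boundary ι}
    (h : ∀ ξ n, ∃ k, ∀ η : Boundary ι, (∀ j < k, η.1 j = ξ.1 j) → (f η).1 n = (f ξ).1 n) :
    Continuous f := by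
  rw [continuous_iff_continuousAt]
  intro ξ U hU
  obtain ⟨m, hm⟩ := mem_nhds_iff.1 hU
  choose k hk using h ξ
  refine mem_nhds_iff.2 ⟨(Finset.range m).sup k, fun η hη => hm _ fun j hj => ?_⟩
  exact hk j η fun i hi => hη i (hi.trans_le (Finset.le_sup (f := k) (Finset.mem_range.2 hj)))

theorem continuous_letterMul (a : Letter ι) : Continuous (letterMul a) := by
  refine continuous_of_agree fun ξ n => ⟨n + 2, fun η hη => ?_⟩
  by_cases h : ξ.1 0 = a.bar
  · have h' : η.1 0 = a.bar := by rw [hη 0 (by omega), h]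
    rw [letterMul, letterMul, dif_pos h, dif_pos h']
    exact hη (n + 1) (by omega)
  · have h' : η.1 0 ≠ a.bar := by rwa [hη 0 (by omega)]
    rw [letterMul, letterMul, dif_neg h, dif_neg h']
    cases n with
    | zero => rfl
    | succ n => exact hη n (by omega)

instance : ContinuousConstSMul (FreeGroup ι) (Boundary ι) where
  continuous_const_smul g := by
    refine FreeGroup.induction_on g ?_ ?_ ?_ ?_
    · simp only [one_smul]
      exact continuous_id
    · intro i
      simpa only [of_smul] using continuous_letterMul _
    · intro i _
      simpa only [inv_of_smul] using continuous_letterMul _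
    · intro x y hx hy
      simp only [mul_smul]
      exact hx.comp hy

instance : T1Space (Boundary ι) where
  t1 ξ := by
    rw [← isOpen_compl_iff, isOpen_iff_mem_nhds]
    intro η hη
    have : ∃ n, η.1 n ≠ ξ.1 n := by
      by_contra! hc
      exact hη (Boundary.ext hc)
    obtain ⟨n, hn⟩ := this
    refine mem_nhds_iff.2 ⟨n + 1, fun ζ hζ h => hn ?_⟩
    rw [← hζ n (by omega), Set.mem_singleton_iff.1 h]

end Boundary

theorem isOpen_shadow (v : FreeGroup ι) (a : Letter ι) : IsOpen (shadow v a) := by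
  have : IsOpen {ξ : Boundary ι | ξ.1 0 = a} := by
    rw [isOpen_iff_mem_nhds]
    intro ξ hξ
    exact Boundary.mem_nhds_iff.2 ⟨1, fun η hη => (hη 0 one_pos).trans hξ⟩
  exact this.preimage (continuous_const_smul v⁻¹)

theorem isClosed_shadow (v : FreeGroup ι) (a : Letter ι) : IsClosed (shadow v a) := by
  rw [← isOpen_compl_iff, ← shadow_mul_letter_bar]
  exact isOpen_shadow _ _

/-- The shadows of the edges of a ray form a neighbourhood basis at the end of the ray. -/
theorem exists_shadow_rayVertex_subset (v : FreeGroup ι) {ξ : Boundary ι} {U : Set (Boundary ι)}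
    (hU : U ∈ 𝓝 ξ) : ∃ n, shadow (rayVertex v ξ n) ((v⁻¹ • ξ).1 n) ⊆ U := by
  have : (fun η => v • η) ⁻¹' U ∈ 𝓝 (v⁻¹ • ξ) :=
    (continuous_const_smul v).continuousAt.preimage_mem_nhds (by simpa using hU)
  obtain ⟨k, hk⟩ := Boundary.mem_nhds_iff.1 this
  refine ⟨k, fun η hη => ?_⟩
  have := hk (v⁻¹ • η) fun j hj => agree_of_mem_shadow_rayVertex hη j hj.le
  simpa using this

/-! ### Parametrized geodesics -/

/-- `y` lists the vertices of the geodesic from `ξ₀` to `ξ₁` in their order, and `s` the labels of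
its edges: the `n`-th edge leads from `y n` to `y (n + 1)`. -/
structure IsGeodesicParam (ξ₀ ξ₁ : Boundary ι) (y : ℤ → FreeGroup ι) (s : ℤ → Letter ι) :
    Prop where
  step : ∀ n, y (n + 1) = y n * letter (s n)
  edge : ∀ n, EdgeOn ξ₀ ξ₁ (y n) (s n)

theorem EdgeOn.reverse {ξ₀ ξ₁ : Boundary ι} {v : FreeGroup ι} {a : Letter ι}
    (h : EdgeOn ξ₀ ξ₁ v a) : EdgeOn ξ₁ ξ₀ (v * letter a) a.bar :=
  ⟨mem_shadow_bar.2 h.2, fun h' => mem_shadow_bar.1 h' h.1⟩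

theorem EdgeOn.smul {ξ₀ ξ₁ : Boundary ι} {v : FreeGroup ι} {a : Letter ι}
    (h : EdgeOn ξ₀ ξ₁ v a) (g : FreeGroup ι) : EdgeOn (g • ξ₀) (g • ξ₁) (g * v) a :=
  ⟨smul_mem_shadow.2 h.1, fun h' => h.2 (smul_mem_shadow.1 h')⟩

theorem EdgeOn.next {ξ₀ ξ₁ : Boundary ι} {v : FreeGroup ι} {a : Letter ι}
    (h : EdgeOn ξ₀ ξ₁ v a) :
    EdgeOn ξ₀ ξ₁ (v * letter a) (((v * letter a)⁻¹ • ξ₁).1 0) := by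
  refine ⟨rfl, fun h' => ?_⟩
  have h1 := eq_of_mem_shadow h' (mem_shadow_bar.2 h.2)
  have h2 : ξ₁ ∈ shadow (v * letter a) a.bar := h1 ▸ mem_shadow_self _ _
  exact mem_shadow_bar.1 h2 h.1

/-- Through every edge of a geodesic there is a parametrization starting with this edge. -/
theorem EdgeOn.exists_param {ξ₀ ξ₁ : Boundary ι} {v : FreeGroup ι} {a : Letter ι}
    (h : EdgeOn ξ₀ ξ₁ v a) :
    ∃ y s, IsGeodesicParam ξ₀ ξ₁ y s ∧ y 0 = v ∧ s 0 = a := by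
  have fwd : ∀ {ξ₀ ξ₁ : Boundary ι} {v : FreeGroup ι} {a : Letter ι}, EdgeOn ξ₀ ξ₁ v a →
      ∀ n, EdgeOn ξ₀ ξ₁ (rayVertex v ξ₁ n) ((v⁻¹ • ξ₁).1 n) := by
    intro ξ₀ ξ₁ v a h n
    refine ⟨mem_shadow_rayVertex v ξ₁ n, fun h' => h.2 ?_⟩
    have h0 : (v⁻¹ • ξ₁).1 0 = a := h.1
    have := shadow_rayVertex_antitone v ξ₁ (Nat.zero_le n) h'
    rw [← h0]
    exact this
  have hr := h.reverse
  let y : ℤ → FreeGroup ι := fun n => match n with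
    | Int.ofNat n => rayVertex v ξ₁ n
    | Int.negSucc n => rayVertex (v * letter a) ξ₀ (n + 2)
  let s : ℤ → Letter ι := fun n => match n with
    | Int.ofNat n => (v⁻¹ • ξ₁).1 n
    | Int.negSucc n => (((v * letter a)⁻¹ • ξ₀).1 (n + 1)).bar
  have h0 : ((v * letter a)⁻¹ • ξ₀).1 0 = a.bar := hr.1
  have h1 : rayVertex (v * letter a) ξ₀ 1 = v := by
    rw [rayVertex, rayVertex, h0, letter_bar, mul_inv_cancel_right]
  refine ⟨y, s, ⟨?_, ?_⟩, rfl, h.1⟩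
  · rintro (n | n)
    · rfl
    · cases n with
      | zero =>
        change v = rayVertex (v * letter a) ξ₀ (0 + 2) *
          letter (((v * letter a)⁻¹ • ξ₀).1 (0 + 1)).bar
        rw [rayVertex, letter_bar, mul_inv_cancel_right, h1]
      | succ n =>
        change rayVertex (v * letter a) ξ₀ (n + 2) = rayVertex (v * letter a) ξ₀ (n + 1 + 2) *
          letter (((v * letter a)⁻¹ • ξ₀).1 (n + 1 + 1)).bar
        rw [rayVertex.eq_2 _ _ (n + 1 + 1), letter_bar, mul_inv_cancel_right]
  · rintro (n | n)
    · exact fwd h n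
    · exact (fwd hr (n + 1)).reverse

theorem exists_edgeOn {ξ₀ ξ₁ : Boundary ι} (h : ξ₀ ≠ ξ₁) : ∃ v a, EdgeOn ξ₀ ξ₁ v a := by
  have : ∃ n, ξ₀.1 n ≠ ξ₁.1 n := by
    by_contra! hc
    exact h (Boundary.ext hc)
  obtain ⟨n, hn⟩ := this
  refine ⟨rayVertex 1 ξ₁ n, (((1 : FreeGroup ι)⁻¹ • ξ₁).1 n), mem_shadow_rayVertex _ _ _,
    fun h' => hn ?_⟩
  simpa using agree_of_mem_shadow_rayVertex h' n le_rfl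

theorem exists_param {ξ₀ ξ₁ : Boundary ι} (h : ξ₀ ≠ ξ₁) : ∃ y s, IsGeodesicParam ξ₀ ξ₁ y s := by
  obtain ⟨v, a, he⟩ := exists_edgeOn h
  obtain ⟨y, s, hy, -⟩ := he.exists_param
  exact ⟨y, s, hy⟩

namespace IsGeodesicParam

variable {ξ₀ ξ₁ : Boundary ι} {y : ℤ → FreeGroup ι} {s : ℤ → Letter ι}

theorem step_pred (H : IsGeodesicParam ξ₀ ξ₁ y s) (n : ℤ) :
    y n = y (n - 1) * letter (s (n - 1)) := by
  have := H.step (n - 1)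
  rwa [sub_add_cancel] at this

theorem shift (H : IsGeodesicParam ξ₀ ξ₁ y s) (k : ℤ) :
    IsGeodesicParam ξ₀ ξ₁ (fun n => y (n + k)) (fun n => s (n + k)) :=
  ⟨fun n => by rw [← H.step]; congr 1; ring, fun n => H.edge _⟩

theorem smul (H : IsGeodesicParam ξ₀ ξ₁ y s) (g : FreeGroup ι) :
    IsGeodesicParam (g • ξ₀) (g • ξ₁) (fun n => g * y n) s :=
  ⟨fun n => by rw [H.step, mul_assoc], fun n => (H.edge n).smul g⟩

theorem reverse (H : IsGeodesicParam ξ₀ ξ₁ y s) :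
    IsGeodesicParam ξ₁ ξ₀ (fun n => y (-n)) (fun n => (s (-n - 1)).bar) := by
  refine ⟨fun n => ?_, fun n => ?_⟩
  · have := H.step_pred (-n)
    rw [letter_bar, this, mul_inv_cancel_right]
    congr 1
    ring
  · have := (H.edge (-n - 1)).reverse
    rwa [← H.step, sub_add_cancel] at this

theorem left_mem (H : IsGeodesicParam ξ₀ ξ₁ y s) (n : ℤ) :
    ξ₀ ∈ shadow (y n) (s (n - 1)).bar := by
  rw [H.step_pred n]
  exact mem_shadow_bar.2 (H.edge _).2

theorem compl_shadow (H : IsGeodesicParam ξ₀ ξ₁ y s) (n : ℤ) :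
    (shadow (y n) (s n))ᶜ = shadow (y (n + 1)) (s n).bar := by
  rw [H.step, shadow_mul_letter_bar]

theorem mem_shadow_back (H : IsGeodesicParam ξ₀ ξ₁ y s) {n : ℤ} {η : Boundary ι} :
    η ∈ shadow (y n) (s (n - 1)).bar ↔ η ∉ shadow (y (n - 1)) (s (n - 1)) := by
  rw [H.step_pred n, mem_shadow_bar]

theorem ne_bar (H : IsGeodesicParam ξ₀ ξ₁ y s) (n : ℤ) : s n ≠ (s (n - 1)).bar := fun h =>
  (H.edge n).2 (h ▸ H.left_mem n)

theorem antitone (H : IsGeodesicParam ξ₀ ξ₁ y s) : Antitone fun n => shadow (y n) (s n) := by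
  refine antitone_int_of_succ_le fun n => ?_
  change shadow (y (n + 1)) (s (n + 1)) ⊆ _
  rw [H.step]
  refine shadow_subset_shadow ?_
  have := H.ne_bar (n + 1)
  rwa [add_sub_cancel_right] at this

theorem eq_rayVertex (H : IsGeodesicParam ξ₀ ξ₁ y s) (m : ℤ) (n : ℕ) :
    y (m + n) = rayVertex (y m) ξ₁ n ∧ s (m + n) = ((y m)⁻¹ • ξ₁).1 n := by
  induction n with
  | zero => exact ⟨by simp [rayVertex], by simpa using (H.edge m).1.symm⟩
  | succ n ih =>
    have h1 : y (m + (n + 1 : ℕ)) = rayVertex (y m) ξ₁ (n + 1) := by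
      rw [rayVertex, ← ih.1, ← ih.2, ← H.step]; congr 1; push_cast; ring
    refine ⟨h1, ?_⟩
    have := (H.edge (m + (n + 1 : ℕ))).1
    rw [h1] at this
    exact eq_of_mem_shadow this (mem_shadow_rayVertex _ _ _)

/-- The shadows of the edges of a geodesic shrink to its second end. -/
theorem exists_shadow_subset (H : IsGeodesicParam ξ₀ ξ₁ y s) {U : Set (Boundary ι)}
    (hU : U ∈ 𝓝 ξ₁) : ∃ n, 0 ≤ n ∧ ∀ m ≥ n, shadow (y m) (s m) ⊆ U := by
  obtain ⟨n, hn⟩ := exists_shadow_rayVertex_subset (y 0) hU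
  refine ⟨n, by positivity, fun m hm => (H.antitone hm).trans ?_⟩
  have := H.eq_rayVertex 0 n
  rw [zero_add] at this
  rwa [← this.1, ← this.2] at hn

theorem exists_compl_shadow_subset (H : IsGeodesicParam ξ₀ ξ₁ y s) {U : Set (Boundary ι)}
    (hU : U ∈ 𝓝 ξ₀) : ∃ n, n ≤ 0 ∧ ∀ m ≤ n, (shadow (y m) (s m))ᶜ ⊆ U := by
  obtain ⟨n, hn0, hn⟩ := H.reverse.exists_shadow_subset hU
  refine ⟨-n - 1, by omega, fun m hm => ?_⟩
  have := hn (-m - 1) (by omega)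
  rw [H.compl_shadow]
  convert! this using 2
  · congr 1; ring
  · simp

theorem exists_notMem (H : IsGeodesicParam ξ₀ ξ₁ y s) {η : Boundary ι} (h : η ≠ ξ₁) :
    ∃ n, 0 ≤ n ∧ ∀ m ≥ n, η ∉ shadow (y m) (s m) := by
  obtain ⟨n, h0, hn⟩ := H.exists_shadow_subset (U := {η}ᶜ) (isOpen_compl_singleton.mem_nhds h.symm)
  exact ⟨n, h0, fun m hm h => hn m hm h rfl⟩

theorem exists_mem (H : IsGeodesicParam ξ₀ ξ₁ y s) {η : Boundary ι} (h : η ≠ ξ₀) :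
    ∃ n, n ≤ 0 ∧ ∀ m ≤ n, η ∈ shadow (y m) (s m) := by
  obtain ⟨n, h0, hn⟩ :=
    H.exists_compl_shadow_subset (U := {η}ᶜ) (isOpen_compl_singleton.mem_nhds h.symm)
  refine ⟨n, h0, fun m hm => ?_⟩
  by_contra hc
  exact hn m hm hc rfl

/-- Every boundary point other than the ends leaves a geodesic at some vertex. -/
theorem exists_exit (H : IsGeodesicParam ξ₀ ξ₁ y s) {η : Boundary ι} (h₀ : η ≠ ξ₀)
    (h₁ : η ≠ ξ₁) : ∃ n, η ∈ shadow (y (n - 1)) (s (n - 1)) ∧ η ∉ shadow (y n) (s n) := by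
  obtain ⟨m, -, hm⟩ := H.exists_notMem h₁
  obtain ⟨k, -, hk⟩ := H.exists_mem h₀
  obtain ⟨n, hn, hmax⟩ := Int.exists_greatest_of_bdd (P := fun n => η ∈ shadow (y n) (s n))
    ⟨m, fun z hz => by by_contra hc; exact hm z (by omega) hz⟩ ⟨k, hk k le_rfl⟩
  refine ⟨n + 1, by simpa using hn, fun h => ?_⟩
  have := hmax _ h
  omega

theorem exit_unique (H : IsGeodesicParam ξ₀ ξ₁ y s) {η : Boundary ι} {m n : ℤ}
    (hm : η ∈ shadow (y (m - 1)) (s (m - 1)) ∧ η ∉ shadow (y m) (s m))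
    (hn : η ∈ shadow (y (n - 1)) (s (n - 1)) ∧ η ∉ shadow (y n) (s n)) : m = n := by
  rcases lt_trichotomy m n with h | h | h
  · exact absurd (H.antitone (by omega : m ≤ n - 1) hn.1) hm.2
  · exact h
  · exact absurd (H.antitone (by omega : n ≤ m - 1) hm.1) hn.2

theorem exit_iff (H : IsGeodesicParam ξ₀ ξ₁ y s) {η : Boundary ι} {n : ℤ} :
    (η ∈ shadow (y (n - 1)) (s (n - 1)) ∧ η ∉ shadow (y n) (s n)) ↔
      ∃ d, d ≠ (s (n - 1)).bar ∧ d ≠ s n ∧ η ∈ shadow (y n) d := by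
  have h : η ∈ shadow (y (n - 1)) (s (n - 1)) ↔ η ∉ shadow (y n) (s (n - 1)).bar := by
    rw [H.mem_shadow_back, not_not]
  rw [h]
  constructor
  · rintro ⟨h1, h2⟩
    exact ⟨_, fun h => h1 h, fun h => h2 h, mem_shadow_self _ _⟩
  · rintro ⟨d, h1, h2, h3⟩
    exact ⟨fun h => h1 (eq_of_mem_shadow h3 h), fun h => h2 (eq_of_mem_shadow h3 h)⟩

end IsGeodesicParam

end

/-! ### Reduced words along geodesics -/

section

variable {ι : Type*}

theorem isReduced_iff_isChain {L : List (Letter ι)} :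
    FreeGroup.IsReduced L ↔ L.IsChain fun a b => b ≠ a.bar := by
  have : ∀ a b : Letter ι, (a.1 = b.1 → a.2 = b.2) ↔ b ≠ a.bar := by
    rintro ⟨i, b⟩ ⟨j, c⟩
    cases b <;> cases c <;> simp [Letter.bar, eq_comm]
  simp only [FreeGroup.IsReduced, this]

theorem rayVertex_eq (v : FreeGroup ι) (ξ : Boundary ι) (n : ℕ) :
    rayVertex v ξ n = v * FreeGroup.mk ((List.range n).map (v⁻¹ • ξ).1) := by
  induction n with
  | zero => simp [rayVertex, FreeGroup.one_eq_mk]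
  | succ n ih =>
    rw [rayVertex, ih, List.range_succ, List.map_append, ← FreeGroup.mul_mk, mul_assoc]
    rfl

theorem isReduced_map_range (ξ : Boundary ι) (n : ℕ) :
    FreeGroup.IsReduced ((List.range n).map ξ.1) := by
  rw [isReduced_iff_isChain, List.isChain_map, List.isChain_range]
  exact fun m _ => ξ.2 m

namespace IsGeodesicParam

variable {ξ₀ ξ₁ : Boundary ι} {y y' : ℤ → FreeGroup ι} {s s' : ℤ → Letter ι}

theorem eq_mk (H : IsGeodesicParam ξ₀ ξ₁ y s) (m : ℤ) (n : ℕ) :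
    y (m + n) = y m * FreeGroup.mk ((List.range n).map ((y m)⁻¹ • ξ₁).1) := by
  rw [(H.eq_rayVertex m n).1, rayVertex_eq]

/-- A parametrization is determined by the vertex with number `0`. -/
theorem unique (H : IsGeodesicParam ξ₀ ξ₁ y s) (H' : IsGeodesicParam ξ₀ ξ₁ y' s')
    (h : y 0 = y' 0) (n : ℤ) : y n = y' n ∧ s n = s' n := by
  have hy : ∀ n, y n = y' n := by
    intro n
    obtain ⟨n, rfl | rfl⟩ := n.eq_nat_or_neg
    · have h1 := (H.eq_rayVertex 0 n).1
      have h2 := (H'.eq_rayVertex 0 n).1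
      rw [zero_add] at h1 h2
      rw [h1, h2, h]
    · have h1 := (H.reverse.eq_rayVertex 0 n).1
      have h2 := (H'.reverse.eq_rayVertex 0 n).1
      simp only [zero_add, neg_zero] at h1 h2
      rw [h1, h2, h]
  refine ⟨hy n, eq_of_mem_shadow (H.edge n).1 ?_⟩
  rw [hy]
  exact (H'.edge n).1

/-- A reduced path issuing from a vertex of a geodesic that has left the geodesic keeps having both
ends behind it. -/
theorem mem_or_behind (H : IsGeodesicParam ξ₀ ξ₁ y s) (L : List (Letter ι))
    (hL : FreeGroup.IsReduced L) :
    (∃ n, y 0 * FreeGroup.mk L = y n) ∨ ∃ b, L.getLast? = some b ∧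
      ξ₀ ∈ shadow (y 0 * FreeGroup.mk L) b.bar ∧ ξ₁ ∈ shadow (y 0 * FreeGroup.mk L) b.bar := by
  induction L using List.reverseRecOn with
  | nil => exact Or.inl ⟨0, by rw [← FreeGroup.one_eq_mk, mul_one]⟩
  | append_singleton L a ih =>
    have hstep : y 0 * FreeGroup.mk (L ++ [a]) = y 0 * FreeGroup.mk L * letter a := by
      rw [← FreeGroup.mul_mk, mul_assoc]; rfl
    rw [hstep]
    have key : ξ₀ ∉ shadow (y 0 * FreeGroup.mk L) a → ξ₁ ∉ shadow (y 0 * FreeGroup.mk L) a →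
        (∃ n, y 0 * FreeGroup.mk L * letter a = y n) ∨ ∃ b, (L ++ [a]).getLast? = some b ∧
          ξ₀ ∈ shadow (y 0 * FreeGroup.mk L * letter a) b.bar ∧
          ξ₁ ∈ shadow (y 0 * FreeGroup.mk L * letter a) b.bar := fun h0 h1 =>
      Or.inr ⟨a, by simp, mem_shadow_bar.2 h0, mem_shadow_bar.2 h1⟩
    rw [isReduced_iff_isChain, List.isChain_append] at hL
    rcases ih (isReduced_iff_isChain.2 hL.1) with ⟨n, hn⟩ | ⟨b, hb, h0, h1⟩
    · rw [hn] at key ⊢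
      by_cases ha : a = s n
      · exact Or.inl ⟨n + 1, by rw [H.step, ha]⟩
      by_cases ha' : a = (s (n - 1)).bar
      · exact Or.inl ⟨n - 1, by rw [H.step_pred n, ha', letter_bar, mul_inv_cancel_right]⟩
      exact key (fun h => ha' (eq_of_mem_shadow h (H.left_mem n)))
        fun h => ha (eq_of_mem_shadow h (H.edge n).1)
    · have hab : a ≠ b.bar := hL.2.2 b hb a (by simp)
      exact key (fun h => hab (eq_of_mem_shadow h h0)) fun h => hab (eq_of_mem_shadow h h1)

theorem mem_geodesic (H : IsGeodesicParam ξ₀ ξ₁ y s) (n : ℤ) : y n ∈ geodesic ξ₀ ξ₁ := by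
  intro h
  have : ξ₀ ∈ shadow (y n) (s n) := h.trans (H.edge n).1
  exact (H.edge n).2 this

end IsGeodesicParam

end

section

variable {ι : Type*} [DecidableEq ι]

namespace IsGeodesicParam

variable {ξ₀ ξ₁ : Boundary ι} {y y' : ℤ → FreeGroup ι} {s s' : ℤ → Letter ι}

theorem mem_geodesic_iff (H : IsGeodesicParam ξ₀ ξ₁ y s) {v : FreeGroup ι} :
    v ∈ geodesic ξ₀ ξ₁ ↔ ∃ n, v = y n := by
  constructor
  · intro hv
    have hv' : y 0 * FreeGroup.mk ((y 0)⁻¹ * v).toWord = v := by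
      rw [FreeGroup.mk_toWord, mul_inv_cancel_left]
    rcases H.mem_or_behind _ (FreeGroup.isReduced_toWord (x := (y 0)⁻¹ * v)) with
      ⟨n, hn⟩ | ⟨b, -, h0, h1⟩
    · exact ⟨n, by rw [← hn, hv']⟩
    · rw [hv'] at h0 h1
      exact absurd ((mem_shadow.1 h0).trans (mem_shadow.1 h1).symm) hv
  · rintro ⟨n, rfl⟩
    exact H.mem_geodesic n

theorem exists_eq_of_edgeOn (H : IsGeodesicParam ξ₀ ξ₁ y s) {v : FreeGroup ι} {a : Letter ι}
    (h : EdgeOn ξ₀ ξ₁ v a) : ∃ n, v = y n ∧ a = s n := by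
  obtain ⟨n, rfl⟩ := H.mem_geodesic_iff.1
    (fun h' => h.2 (h'.trans (mem_shadow.1 h.1)) : v ∈ geodesic ξ₀ ξ₁)
  exact ⟨n, rfl, eq_of_mem_shadow h.1 (H.edge n).1⟩

theorem toWord_inv_mul (H : IsGeodesicParam ξ₀ ξ₁ y s) (m : ℤ) (n : ℕ) :
    ((y m)⁻¹ * y (m + n)).toWord = (List.range n).map ((y m)⁻¹ • ξ₁).1 := by
  rw [H.eq_mk, inv_mul_cancel_left, FreeGroup.toWord_mk, (isReduced_map_range _ _).reduce_eq]

theorem norm_inv_mul (H : IsGeodesicParam ξ₀ ξ₁ y s) {m n : ℤ} (h : m ≤ n) :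
    (((y m)⁻¹ * y n).norm : ℤ) = n - m := by
  obtain ⟨k, rfl⟩ := Int.le.dest h
  rw [FreeGroup.norm, H.toWord_inv_mul]
  simp

theorem injective (H : IsGeodesicParam ξ₀ ξ₁ y s) : Function.Injective y := by
  have : ∀ m n : ℤ, m ≤ n → y m = y n → m = n := by
    intro m n hmn h
    have := H.norm_inv_mul hmn
    rw [h, inv_mul_cancel, FreeGroup.norm_one] at this
    simp at this
    omega
  intro m n h
  rcases le_total m n with hmn | hmn
  · exact this m n hmn h
  · exact (this n m hmn h.symm).symm

theorem head_forward (H : IsGeodesicParam ξ₀ ξ₁ y s) {m n : ℤ} (h : m < n) :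
    ((y m)⁻¹ * y n).toWord[0]? = some (s m) := by
  obtain ⟨k, rfl⟩ := Int.le.dest h.le
  rw [H.toWord_inv_mul]
  have : 0 < k := by omega
  have h1 : ((y m)⁻¹ • ξ₁).1 0 = s m := (H.edge m).1
  simp [this, h1]

theorem head_backward (H : IsGeodesicParam ξ₀ ξ₁ y s) {m n : ℤ} (h : n < m) :
    ((y m)⁻¹ * y n).toWord[0]? = some (s (m - 1)).bar := by
  have := H.reverse.head_forward (m := -m) (n := -n) (by omega)
  simpa using this

end IsGeodesicParam

/-! ### Convergence to boundary points -/

theorem ConvergesTo.unique {u : ℕ → FreeGroup ι} {ξ η : Boundary ι} (h : ConvergesTo u ξ)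
    (h' : ConvergesTo u η) : ξ = η := by
  ext1 n
  obtain ⟨i, h1, h2⟩ := ((h (n + 1)).and (h' (n + 1))).exists
  exact Option.some.inj ((h1 n (by omega)).symm.trans (h2 n (by omega)))

theorem ConvergesTo.comp {u : ℕ → FreeGroup ι} {ξ : Boundary ι} (h : ConvergesTo u ξ)
    {φ : ℕ → ℕ} (hφ : Tendsto φ atTop atTop) : ConvergesTo (fun i => u (φ i)) ξ :=
  fun k => hφ.eventually (h k)

theorem ConvergesTo.head {u : ℕ → FreeGroup ι} {ξ : Boundary ι} (h : ConvergesTo u ξ)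
    {v : FreeGroup ι} {a : Letter ι} (ha : ξ ∈ shadow v a) :
    ∀ᶠ i in atTop, (v⁻¹ * u i).toWord[0]? = some a := by
  filter_upwards [h.smul v⁻¹ 1] with i hi
  rw [hi 0 one_pos]
  exact congrArg some ha

theorem getElem?_toWord_mul_letter (x : FreeGroup ι) (a : Letter ι) {j : ℕ}
    (hj : j + 1 < x.toWord.length) : (x * letter a).toWord[j]? = x.toWord[j]? := by
  have h : x * letter a = FreeGroup.mk (x.toWord ++ [a]) := by
    rw [← FreeGroup.mul_mk, FreeGroup.mk_toWord]; rfl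
  have hx := FreeGroup.isReduced_toWord (x := x)
  generalize hL : x.toWord = L at *
  induction L using List.reverseRecOn with
  | nil => simp at hj
  | append_singleton L b _ =>
    rw [isReduced_iff_isChain] at hx
    have hL' := (List.isChain_append.1 hx).1
    simp only [List.length_append, List.length_singleton] at hj
    by_cases hab : a = Letter.bar b
    · have : FreeGroup.mk (L ++ [b] ++ [a]) = FreeGroup.mk L := by
        rw [List.append_assoc, ← FreeGroup.mul_mk, ← FreeGroup.mul_mk]
        change _ * (letter b * letter a) = _
        rw [hab, letter_bar, mul_inv_cancel, mul_one]
      rw [h, this, FreeGroup.toWord_mk, (isReduced_iff_isChain.2 hL').reduce_eq,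
        List.getElem?_append_left (by omega)]
    · have : (L ++ [b] ++ [a]).IsChain fun a b : Letter ι => b ≠ a.bar := by
        refine List.isChain_append.2 ⟨hx, by simp, ?_⟩
        intro c hc d hd
        simp at hc hd
        subst hc hd
        exact hab
      rw [h, FreeGroup.toWord_mk, (isReduced_iff_isChain.2 this).reduce_eq,
        List.getElem?_append_left (by simp; omega)]

theorem ConvergesTo.mul_right {u : ℕ → FreeGroup ι} {ξ : Boundary ι} (h : ConvergesTo u ξ)
    (d : FreeGroup ι) : ConvergesTo (fun i => u i * d) ξ := by
  have key : ∀ (L : List (Letter ι)) (u : ℕ → FreeGroup ι), ConvergesTo u ξ →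
      ConvergesTo (fun i => u i * FreeGroup.mk L) ξ := by
    intro L
    induction L with
    | nil => intro u h; simpa [← FreeGroup.one_eq_mk] using h
    | cons a L ih =>
      intro u h
      have h' : ConvergesTo (fun i => u i * letter a) ξ := by
        intro k
        filter_upwards [h (k + 1)] with i hi j hj
        have hk : k < (u i).toWord.length := by
          by_contra hc
          have := hi k (by omega)
          rw [List.getElem?_eq_none (by omega)] at this
          simp at this
        rw [getElem?_toWord_mul_letter _ _ (by omega)]
        exact hi j (by omega)
      have := ih _ h'
      simp only [mul_assoc] at this
      exact this
  have := key d.toWord u h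
  rwa [FreeGroup.mk_toWord] at this

theorem convergesTo_rayVertex (v : FreeGroup ι) (ξ : Boundary ι) :
    ConvergesTo (rayVertex v ξ) ξ := by
  have h1 : ConvergesTo (fun n => FreeGroup.mk ((List.range n).map (v⁻¹ • ξ).1)) (v⁻¹ • ξ) := by
    intro k
    filter_upwards [eventually_ge_atTop k] with n hn j hj
    rw [FreeGroup.toWord_mk, (isReduced_map_range _ _).reduce_eq]
    have : j < n := by omega
    simp [this]
  have h2 := h1.smul v
  simp only [smul_inv_smul, ← rayVertex_eq] at h2
  exact h2

theorem IsGeodesicParam.convergesTo {ξ₀ ξ₁ : Boundary ι} {y : ℤ → FreeGroup ι}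
    {s : ℤ → Letter ι} (H : IsGeodesicParam ξ₀ ξ₁ y s) : ConvergesTo (fun n : ℕ => y n) ξ₁ := by
  have := convergesTo_rayVertex (y 0) ξ₁
  convert! this using 2 with n
  have := (H.eq_rayVertex 0 n).1
  rwa [zero_add] at this

/-! ### Translations along axes -/

theorem isLineEnds_iff_conj {h g : FreeGroup ι} {ζ₀ ζ₁ : Boundary ι} :
    IsLineEnds h g ζ₀ ζ₁ ↔ IsLineEnds 1 (h * g * h⁻¹) ζ₀ ζ₁ := by
  have e1 : ∀ i : ℕ, 1 * (h * g * h⁻¹) ^ i = h * g ^ i * h⁻¹ := fun i => by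
    rw [one_mul, conj_pow]
  have e2 : ∀ i : ℕ, 1 * (h * g * h⁻¹)⁻¹ ^ i = h * g⁻¹ ^ i * h⁻¹ := fun i => by
    rw [one_mul, conj_inv, conj_pow]
  simp only [IsLineEnds, e1, e2]
  constructor
  · rintro ⟨h0, h1⟩
    exact ⟨h0.mul_right _, h1.mul_right _⟩
  · rintro ⟨h0, h1⟩
    have h0 := h0.mul_right h
    have h1 := h1.mul_right h
    simp only [inv_mul_cancel_right] at h0 h1
    exact ⟨h0, h1⟩

theorem IsLineEnds.reverse {t : FreeGroup ι} {ζ₀ ζ₁ : Boundary ι} (h : IsLineEnds 1 t ζ₀ ζ₁) :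
    IsLineEnds 1 t⁻¹ ζ₁ ζ₀ :=
  ⟨by simpa using h.2, by simpa using h.1⟩

theorem IsLineEnds.smul_right {t : FreeGroup ι} {ζ₀ ζ₁ : Boundary ι}
    (h : IsLineEnds 1 t ζ₀ ζ₁) : t • ζ₁ = ζ₁ := by
  have h1 := h.2.smul t
  have h2 := h.2.comp (tendsto_add_atTop_nat 1)
  refine h1.unique ?_
  convert! h2 using 2 with i
  rw [pow_succ', one_mul, one_mul]

theorem IsLineEnds.smul_left {t : FreeGroup ι} {ζ₀ ζ₁ : Boundary ι}
    (h : IsLineEnds 1 t ζ₀ ζ₁) : t • ζ₀ = ζ₀ := by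
  have := h.reverse.smul_right
  rwa [inv_smul_eq_iff, eq_comm] at this

/-- An element that fixes both ends of a geodesic shifts its parametrization. -/
theorem IsGeodesicParam.exists_shift {ζ₀ ζ₁ : Boundary ι} {y : ℤ → FreeGroup ι}
    {s : ℤ → Letter ι} (H : IsGeodesicParam ζ₀ ζ₁ y s) {t : FreeGroup ι}
    (h0 : t • ζ₀ = ζ₀) (h1 : t • ζ₁ = ζ₁) :
    ∃ τ : ℤ, ∀ n, t * y n = y (n + τ) ∧ s n = s (n + τ) := by
  have H' := H.smul t
  rw [h0, h1] at H'
  obtain ⟨τ, hτ, -⟩ := H.exists_eq_of_edgeOn (H'.edge 0)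
  exact ⟨τ, fun n => H'.unique (H.shift τ) (by simpa using hτ) n⟩

omit [DecidableEq ι] in
theorem IsGeodesicParam.pow_mul {ζ₀ ζ₁ : Boundary ι} {y : ℤ → FreeGroup ι}
    {s : ℤ → Letter ι} (_ : IsGeodesicParam ζ₀ ζ₁ y s) {t : FreeGroup ι} {τ : ℤ}
    (h : ∀ n, t * y n = y (n + τ)) (k : ℕ) (n : ℤ) : t ^ k * y n = y (n + k * τ) := by
  induction k with
  | zero => simp
  | succ k ih =>
    rw [pow_succ', mul_assoc, ih, h]
    congr 1
    push_cast
    ring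

/-- A hyperbolic element translates its axis towards its attracting end. -/
theorem IsGeodesicParam.exists_pos_shift {ζ₀ ζ₁ : Boundary ι} {y : ℤ → FreeGroup ι}
    {s : ℤ → Letter ι} (H : IsGeodesicParam ζ₀ ζ₁ y s) {t : FreeGroup ι}
    (ht : IsLineEnds 1 t ζ₀ ζ₁) :
    ∃ τ : ℤ, 0 < τ ∧ ∀ n, t * y n = y (n + τ) ∧ s n = s (n + τ) := by
  obtain ⟨τ, hτ⟩ := H.exists_shift ht.smul_left ht.smul_right
  refine ⟨τ, ?_, hτ⟩
  by_contra! hc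
  have h1 := (ht.2.mul_right (y 0)).head (H.edge 0).1
  obtain ⟨i, hi, hi0⟩ := (h1.and (eventually_gt_atTop 0)).exists
  rw [one_mul, H.pow_mul (fun n => (hτ n).1), zero_add] at hi
  rcases hc.lt_or_eq with hc | hc
  · rw [H.head_backward (mul_neg_of_pos_of_neg (by exact_mod_cast hi0) hc)] at hi
    exact H.ne_bar 0 (Option.some.inj hi).symm
  · rw [hc] at hi
    simp at hi

/-- Conversely, a positive shift converges to the second end. -/
theorem IsGeodesicParam.isLineEnds {ζ₀ ζ₁ : Boundary ι} {y : ℤ → FreeGroup ι}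
    {s : ℤ → Letter ι} (H : IsGeodesicParam ζ₀ ζ₁ y s) {t : FreeGroup ι} {τ : ℤ} (hτ : 0 < τ)
    (h : ∀ n, t * y n = y (n + τ)) : IsLineEnds 1 t ζ₀ ζ₁ := by
  have key : ∀ {ζ₀ ζ₁ : Boundary ι} {y : ℤ → FreeGroup ι} {s : ℤ → Letter ι}
      (_ : IsGeodesicParam ζ₀ ζ₁ y s) {t : FreeGroup ι} (_ : ∀ n, t * y n = y (n + τ)),
      ConvergesTo (fun i => 1 * t ^ i) ζ₁ := by
    intro ζ₀ ζ₁ y s H t h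
    lift τ to ℕ using hτ.le
    have h1 := (H.convergesTo.comp (φ := fun i => i * τ)
      (tendsto_id.atTop_mul_const' (by omega))).mul_right (y 0)⁻¹
    convert! h1 using 2 with i
    rw [one_mul, eq_mul_inv_iff_mul_eq, H.pow_mul h, zero_add]
    push_cast
    rfl
  refine ⟨key H.reverse fun n => ?_, key H h⟩
  rw [inv_mul_eq_iff_eq_mul, h]
  congr 1
  ring

/-! ### Lines with a common end -/

/-- The axes of two elements that have the same attracting end coincide. -/
theorem IsLineEnds.left_eq {t t' : FreeGroup ι} {ζ₀ ζ₀' ζ₁ : Boundary ι} (h : IsLineEnds 1 t ζ₀ ζ₁)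
    (h' : IsLineEnds 1 t' ζ₀' ζ₁) (hne : ζ₀ ≠ ζ₁) (hne' : ζ₀' ≠ ζ₁) : ζ₀ = ζ₀' := by
  obtain ⟨y, s, H⟩ := exists_param hne
  obtain ⟨y', s', H'⟩ := exists_param hne'
  obtain ⟨τ, hτ, ht⟩ := H.exists_pos_shift h
  obtain ⟨τ', hτ', ht'⟩ := H'.exists_pos_shift h'
  -- far along the second axis, its edges belong to the first axis
  obtain ⟨m, -, hm⟩ := H'.exists_notMem hne
  obtain ⟨n, hn, -⟩ := H.exists_eq_of_edgeOn (⟨(H'.edge m).1, hm m le_rfl⟩ : EdgeOn ζ₀ ζ₁ _ _)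
  -- both powers move the common vertex by `τ * τ'`, so they are equal
  lift τ to ℕ using hτ.le
  lift τ' to ℕ using hτ'.le
  have e1 : t ^ τ' * y n = y (n + (τ' * τ : ℕ)) := by
    rw [H.pow_mul fun n => (ht n).1]; push_cast; rfl
  have e2 : t' ^ τ * y' m = y' (m + (τ' * τ : ℕ)) := by
    rw [H'.pow_mul fun n => (ht' n).1]; push_cast; rw [mul_comm (τ : ℤ)]
  have e3 : t ^ τ' = t' ^ τ := by
    have : y (n + (τ' * τ : ℕ)) = y' (m + (τ' * τ : ℕ)) := by
      rw [(H.eq_rayVertex _ _).1, (H'.eq_rayVertex _ _).1, hn]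
    rw [← e1, ← e2, hn] at this
    exact mul_right_cancel this
  have c1 := h.1.comp (φ := fun i => τ' * i) (tendsto_id.const_mul_atTop' (by omega))
  have c2 := h'.1.comp (φ := fun i => τ * i) (tendsto_id.const_mul_atTop' (by omega))
  refine c1.unique ?_
  convert! c2 using 2 with i
  rw [pow_mul, pow_mul, inv_pow t, e3, inv_pow t']

theorem mem_lines_iff {W : Finset (FreeGroup ι)} {ξ η : Boundary ι} :
    s(ξ, η) ∈ lines W ↔ ∃ h : FreeGroup ι, ∃ w ∈ W,
      IsLineEnds 1 (h * w * h⁻¹) ξ η ∨ IsLineEnds 1 (h * w * h⁻¹) η ξ := by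
  constructor
  · rintro ⟨h, w, hw, ξ', η', hl, he⟩
    refine ⟨h, w, hw, ?_⟩
    rw [isLineEnds_iff_conj] at hl
    rcases Sym2.eq_iff.1 he with ⟨rfl, rfl⟩ | ⟨rfl, rfl⟩
    · exact Or.inl hl
    · exact Or.inr hl
  · rintro ⟨h, w, hw, hl | hl⟩
    · exact ⟨h, w, hw, ξ, η, isLineEnds_iff_conj.2 hl, rfl⟩
    · exact ⟨h, w, hw, η, ξ, isLineEnds_iff_conj.2 hl, Sym2.eq_swap⟩

theorem exists_isLineEnds_of_mem_lines {W : Finset (FreeGroup ι)} {ξ η : Boundary ι}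
    (h : s(ξ, η) ∈ lines W) : ∃ t, IsLineEnds 1 t ξ η := by
  obtain ⟨h, w, -, hl | hl⟩ := mem_lines_iff.1 h
  · exact ⟨_, hl⟩
  · exact ⟨_, hl.reverse⟩

/-- If a line of the pattern shares an end with the axis of `t`, then it is this axis. -/
theorem IsLineEnds.eq_of_mem_lines {W : Finset (FreeGroup ι)} {t : FreeGroup ι}
    {ζ₀ ζ₁ η : Boundary ι} (h : IsLineEnds 1 t ζ₀ ζ₁) (hne : ζ₀ ≠ ζ₁)
    (hl : s(ζ₁, η) ∈ lines W) (hη : η ≠ ζ₁) : η = ζ₀ := by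
  rw [Sym2.eq_swap] at hl
  obtain ⟨t', ht'⟩ := exists_isLineEnds_of_mem_lines hl
  exact ht'.left_eq h hη hne

theorem eq_of_mem_lines {W : Finset (FreeGroup ι)} {ξ η ζ : Boundary ι}
    (h : s(ξ, η) ∈ lines W) (h' : s(ξ, ζ) ∈ lines W) (hη : ξ ≠ η) (hζ : ξ ≠ ζ) : η = ζ := by
  rw [Sym2.eq_swap] at h
  obtain ⟨t, ht⟩ := exists_isLineEnds_of_mem_lines h
  exact (ht.eq_of_mem_lines hη.symm h' hζ.symm).symm

theorem δ_eq_iff {W : Finset (FreeGroup ι)} {ξ η : Boundary ι} :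
    δ W ξ = δ W η ↔ ξ = η ∨ s(ξ, η) ∈ lines W := by
  constructor
  · intro h
    replace h := Quot.eqvGen_exact h
    induction h with
    | rel _ _ h => exact Or.inr h
    | refl _ => exact Or.inl rfl
    | symm _ _ _ ih =>
      rcases ih with ih | ih
      · exact Or.inl ih.symm
      · exact Or.inr (Sym2.eq_swap ▸ ih)
    | trans x y z h1 h2 ih1 ih2 =>
      rcases ih1 with rfl | ih1
      · exact ih2
      rcases ih2 with rfl | ih2
      · exact Or.inr ih1
      rw [Sym2.eq_swap] at ih1
      by_cases hx : y = x
      · subst hx; exact Or.inr ih2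
      by_cases hz : y = z
      · subst hz; rw [Sym2.eq_swap] at ih1; exact Or.inr ih1
      exact Or.inl (eq_of_mem_lines ih1 ih2 hx hz)
  · rintro (rfl | h)
    · rfl
    · exact Quot.sound h

/-- A point of the decomposition space has at most two preimages. -/
theorem exists_preimage_subset (W : Finset (FreeGroup ι)) (x : DecompositionSpace W) :
    ∃ ξ η, δ W ⁻¹' {x} = {ξ, η} := by
  obtain ⟨ξ, rfl⟩ : ∃ ξ, δ W ξ = x := Quot.exists_rep x
  by_cases h : ∃ η, η ≠ ξ ∧ s(ξ, η) ∈ lines W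
  · obtain ⟨η, hη, hl⟩ := h
    refine ⟨ξ, η, Set.ext fun ζ => ?_⟩
    simp only [Set.mem_preimage, Set.mem_singleton_iff, Set.mem_insert_iff]
    rw [eq_comm, δ_eq_iff]
    constructor
    · rintro (rfl | h')
      · exact Or.inl rfl
      · by_cases hz : ξ = ζ
        · exact Or.inl hz.symm
        · exact Or.inr (eq_of_mem_lines h' hl hz hη.symm)
    · rintro (rfl | rfl)
      · exact Or.inl rfl
      · exact Or.inr hl
  · refine ⟨ξ, ξ, Set.ext fun ζ => ?_⟩
    simp only [Set.mem_preimage, Set.mem_singleton_iff, Set.mem_insert_iff, or_self]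
    rw [eq_comm, δ_eq_iff]
    constructor
    · rintro (rfl | h')
      · rfl
      · by_contra hz
        exact h ⟨ζ, hz, h'⟩
    · rintro rfl
      exact Or.inl rfl

theorem finite_preimage (W : Finset (FreeGroup ι)) (x : DecompositionSpace W) :
    (δ W ⁻¹' {x}).Finite := by
  obtain ⟨ξ, η, h⟩ := exists_preimage_subset W x
  rw [h]
  exact (Set.finite_singleton η).insert ξ

end

section

variable {ι : Type*} [DecidableEq ι]

/-! ### Local finiteness of the line pattern -/

theorem norm_inv_mul_of_head_ne {x y : FreeGroup ι} (h : x.toWord[0]? ≠ y.toWord[0]?) :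
    (x⁻¹ * y).norm = x.norm + y.norm := by
  have hr : FreeGroup.IsReduced (x⁻¹.toWord ++ y.toWord) := by
    rw [isReduced_iff_isChain, List.isChain_append]
    refine ⟨isReduced_iff_isChain.1 FreeGroup.isReduced_toWord,
      isReduced_iff_isChain.1 FreeGroup.isReduced_toWord, fun a ha b hb hab => h ?_⟩
    rw [FreeGroup.toWord_inv, FreeGroup.invRev, List.getLast?_reverse, List.head?_map] at ha
    obtain ⟨c, hc, hca⟩ := Option.map_eq_some_iff.1 ha
    rw [← List.head?_eq_getElem?, ← List.head?_eq_getElem?, hc, hb, hab, ← hca]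
    simp [Letter.bar]
  have hx : x⁻¹.toWord.length = x.toWord.length := FreeGroup.norm_inv_eq
  rw [FreeGroup.norm, FreeGroup.toWord_mul, hr.reduce_eq, List.length_append, hx]
  rfl

theorem finite_norm_le [Finite ι] (n : ℕ) : {x : FreeGroup ι | x.norm ≤ n}.Finite :=
  (List.finite_length_le (Letter ι) n).preimage FreeGroup.toWord_injective.injOn

/-- The axis of `h w h⁻¹` passes through the vertex `1` only if some `h w^j` is close to `1`. -/
theorem exists_norm_le_of_isLineEnds {h w : FreeGroup ι} {ξ η : Boundary ι}
    (hl : IsLineEnds h w ξ η) (hne : ξ.1 0 ≠ η.1 0) : ∃ j : ℤ, (h * w ^ j).norm ≤ w.norm := by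
  have : ∃ j : ℤ, (h * w ^ j).toWord[0]? ≠ (h * w ^ (j + 1)).toWord[0]? := by
    by_contra! hc
    have hconst : ∀ j : ℤ, (h * w ^ j).toWord[0]? = (h * w ^ (0 : ℤ)).toWord[0]? := by
      intro j
      induction j using Int.induction_on with
      | zero => rfl
      | succ j ih => rw [← hc, ih]
      | pred j ih => rw [hc, sub_add_cancel, ih]
    obtain ⟨i, hi, hi'⟩ := ((hl.1 1).and (hl.2 1)).exists
    have h1 := hi 0 one_pos
    have h2 := hi' 0 one_pos
    have e1 := hconst (-i : ℤ)
    have e2 := hconst (i : ℤ)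
    rw [zpow_neg, zpow_natCast, ← inv_pow, h1] at e1
    rw [zpow_natCast, h2, ← e1] at e2
    exact hne (Option.some.inj e2).symm
  obtain ⟨j, hj⟩ := this
  have := norm_inv_mul_of_head_ne hj
  have e : (h * w ^ j)⁻¹ * (h * w ^ (j + 1)) = w := by
    rw [zpow_add_one]; group
  rw [e] at this
  exact ⟨j, by omega⟩

/-- Only finitely many lines of the pattern pass through the vertex `1`. -/
theorem finite_lines_through_one [Finite ι] (W : Finset (FreeGroup ι)) :
    {l | l ∈ lines W ∧ ∃ a, LineCrosses l 1 a}.Finite := by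
  let A : FreeGroup ι → FreeGroup ι → Set (Sym2 (Boundary ι)) := fun h w =>
    {l | ∃ ξ η, IsLineEnds h w ξ η ∧ l = s(ξ, η)}
  have hA : ∀ h w, (A h w).Finite := fun h w => by
    refine Set.Subsingleton.finite ?_
    rintro _ ⟨ξ, η, h1, rfl⟩ _ ⟨ξ', η', h2, rfl⟩
    rw [h1.1.unique h2.1, h1.2.unique h2.2]
  refine (W.finite_toSet.biUnion fun w _ =>
    (finite_norm_le w.norm).biUnion fun h _ => hA h w).subset ?_
  rintro _ ⟨⟨h, w, hw, ξ, η, hl, rfl⟩, a, ξ', η', he, hc⟩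
  have hne : ξ.1 0 ≠ η.1 0 := by
    have h1 : η'.1 0 = a := by simpa [mem_shadow] using hc.1
    have h2 : ξ'.1 0 ≠ a := by simpa [mem_shadow] using hc.2
    rcases Sym2.eq_iff.1 he with ⟨rfl, rfl⟩ | ⟨rfl, rfl⟩
    · rwa [h1]
    · rw [h1]; exact h2.symm
  obtain ⟨j, hj⟩ := exists_norm_le_of_isLineEnds hl hne
  simp only [Set.mem_iUnion]
  refine ⟨w, hw, h * w ^ j, hj, ξ, η, ?_, rfl⟩
  rw [isLineEnds_iff_conj] at hl ⊢
  convert! hl using 1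
  group

theorem smul_mem_lines {W : Finset (FreeGroup ι)} {ξ η : Boundary ι} (h : s(ξ, η) ∈ lines W)
    (g : FreeGroup ι) : s(g • ξ, g • η) ∈ lines W :=
  map_smul_mem_lines h g

/-! ### Connectivity of Whitehead graphs -/

/-- If the vertex `f` is removed from the Whitehead graph over the vertex `y`, then some line joins
each nonempty proper set `B` of the remaining vertices to its complement. -/
theorem exists_line_of_cut {W : Finset (FreeGroup ι)} (hWh : WhConnectedWithoutCutVertices W)
    (y : FreeGroup ι) {f : Letter ι} {B : Set (Letter ι)} (hf : f ∉ B) {b b' : Letter ι}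
    (hb : b ∈ B) (hb' : b' ∉ B) (hbf : b' ≠ f) :
    ∃ η η' : Boundary ι, s(η, η') ∈ lines W ∧ (∃ d ∈ B, η ∈ shadow y d) ∧
      ∃ d, d ∉ B ∧ d ≠ f ∧ η' ∈ shadow y d := by
  suffices H : ∃ η η' : Boundary ι, s(η, η') ∈ lines W ∧ η.1 0 ∈ B ∧ η'.1 0 ∉ B ∧ η'.1 0 ≠ f by
    obtain ⟨η, η', hl, h1, h2, h3⟩ := H
    refine ⟨y • η, y • η', smul_mem_lines hl y, ⟨_, h1, ?_⟩, _, h2, h3, ?_⟩ <;>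
    rw [mem_shadow, inv_smul_smul]
  by_contra! hc
  have hmem : ∀ d, d ≠ f → (Sum.inl (1, d) : (FreeGroup ι × Letter ι) ⊕ Sym2 (Boundary ι)) ∈
      whElements W {1} {letter f} := by
    intro d hd
    refine Or.inl ⟨(1, d), rfl, ⟨rfl, ?_⟩, ?_⟩
    · simp [letter, FreeGroup.one_eq_mk, ← FreeGroup.toWord_inj, FreeGroup.toWord_mk]
    · simpa [letter, ← FreeGroup.toWord_inj, FreeGroup.toWord_mk,
        FreeGroup.reduce_singleton] using hd
  have hbf' : b ≠ f := fun h => hf (h ▸ hb)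
  obtain ⟨-, -, hr⟩ := hWh.2 f _ (hmem b hbf') _ (hmem b' hbf)
  let I : (FreeGroup ι × Letter ι) ⊕ Sym2 (Boundary ι) → Prop := fun e =>
    (∀ p, e = .inl p → p.2 ∈ B) ∧ ∀ l, e = .inr l → ∃ η ∈ l, η.1 0 ∈ B
  have hstep : ∀ e e', (whIncidence W {1} {letter f}).Adj e e' → I e → I e' := by
    rintro e e' ⟨-, ⟨h1, h2, p, l, rfl, rfl, ξ, hξ, hξp⟩ | ⟨h2, h1, p, l, rfl, rfl, ξ, hξ, hξp⟩⟩ hI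
    · refine ⟨fun _ h => by simp at h, fun l' h => ?_⟩
      obtain rfl : l = l' := Sum.inr.inj h
      refine ⟨ξ, hξ, ?_⟩
      have := hI.1 p rfl
      rcases h1 with ⟨q, hq, hq1, -⟩ | ⟨_, h, _⟩
      · obtain rfl : p = q := Sum.inl.inj hq
        have hp1 : p.1 = 1 := hq1.1
        rw [mem_shadow, hp1] at hξp
        simpa using hξp ▸ this
      · simp at h
    · refine ⟨fun p' h => ?_, fun _ h => by simp at h⟩
      obtain rfl : p = p' := Sum.inl.inj h
      obtain ⟨η, hη, hηB⟩ := hI.2 l rfl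
      rcases h2 with ⟨q, hq, hq1, hqf⟩ | ⟨_, h, _⟩
      · obtain rfl : p = q := Sum.inl.inj hq
        have hp1 : p.1 = 1 := hq1.1
        have hξ0 : ξ.1 0 = p.2 := by simpa [mem_shadow, hp1] using hξp
        have hpf : p.2 ≠ f := fun h => hqf (by simp [hp1, h])
        by_contra hpB
        have hne : η ≠ ξ := by
          rintro rfl
          exact hpB (hξ0 ▸ hηB)
        have hl : s(η, ξ) ∈ lines W := by
          rcases h1 with ⟨_, h, _⟩ | ⟨l', hl', hl1, -⟩
          · simp at h
          · obtain rfl : l = l' := Sum.inr.inj hl'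
            rwa [(Sym2.mem_and_mem_iff hne).1 ⟨hη, hξ⟩] at hl1
        exact hpf (hξ0 ▸ hc η ξ hl hηB (hξ0 ▸ hpB))
      · simp at h
  have hall : ∀ e e', (whIncidence W {1} {letter f}).Reachable e e' → I e → I e' := by
    rintro e e' ⟨w⟩
    induction w with
    | nil => exact id
    | cons h _ ih => exact fun hI => ih (hstep _ _ h hI)
  exact hb' ((hall _ _ hr ⟨fun p h => by
    obtain rfl := Sum.inl.inj h; exact hb, fun _ h => by simp at h⟩).1 _ rfl)

/-! ### Colourings -/

/-- A colouring of the boundary away from `Z` that descends to the decomposition space: it is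
locally constant on the complement of `Z`, which is open, and takes the same value at the two ends
of each line of the pattern. -/
structure IsColoring {K : Type*} (W : Finset (FreeGroup ι)) (Z : Set (Boundary ι))
    (χ : Boundary ι → K) : Prop where
  line : ∀ {η η' : Boundary ι}, s(η, η') ∈ lines W → η ∉ Z → η' ∉ Z → χ η = χ η'
  eventually_eq : ∀ {η : Boundary ι}, η ∉ Z → ∀ᶠ η' in 𝓝 η, η' ∉ Z ∧ χ η' = χ η

variable {K K' : Type*} {W : Finset (FreeGroup ι)} {Z Z' : Set (Boundary ι)}

theorem IsColoring.prodMk {χ : Boundary ι → K} {χ' : Boundary ι → K'} (h : IsColoring W Z χ)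
    (h' : IsColoring W Z' χ') : IsColoring W (Z ∪ Z') fun η => (χ η, χ' η) := by
  refine ⟨fun hl h1 h2 => ?_, fun {η} h1 => ?_⟩
  · rw [Set.mem_union, not_or] at h1 h2
    rw [h.line hl h1.1 h2.1, h'.line hl h1.2 h2.2]
  · rw [Set.mem_union, not_or] at h1
    filter_upwards [h.eventually_eq h1.1, h'.eventually_eq h1.2] with η' e1 e2
    rw [Set.mem_union, not_or, e1.2, e2.2]
    exact ⟨⟨e1.1, e2.1⟩, rfl⟩

theorem IsColoring.smul {χ : Boundary ι → K} (h : IsColoring W Z χ) (g : FreeGroup ι) :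
    IsColoring W ((g • ·) ⁻¹' Z) fun η => χ (g • η) :=
  ⟨fun hl h1 h2 => h.line (smul_mem_lines hl g) h1 h2, fun h1 =>
    (continuous_const_smul g).continuousAt.eventually (h.eventually_eq h1)⟩

/-- A colouring is constant on each shadow on which it is defined: otherwise, the Whitehead graphs
having no cut vertices, there is a descending sequence of shadows on which it is not constant, and
it is not locally constant at the point to which they converge. -/
theorem IsColoring.eq_of_mem_shadow {χ : Boundary ι → K} (h : IsColoring W Z χ)
    (hWh : WhConnectedWithoutCutVertices W) {v : FreeGroup ι} {a : Letter ι}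
    (hZ : ∀ η ∈ shadow v a, η ∉ Z) {η η' : Boundary ι} (hη : η ∈ shadow v a)
    (hη' : η' ∈ shadow v a) : χ η = χ η' := by
  let Mono : FreeGroup ι × Letter ι → Prop := fun p =>
    ∀ η ∈ shadow p.1 p.2, ∀ η' ∈ shadow p.1 p.2, χ η = χ η'
  let Bad : FreeGroup ι × Letter ι → Prop := fun p => ¬ Mono p ∧ ∀ η ∈ shadow p.1 p.2, η ∉ Z
  have hnext : ∀ p, Bad p → ∃ b, b ≠ p.2.bar ∧ Bad (p.1 * letter p.2, b) := by
    rintro ⟨v, a⟩ ⟨hp, hZ⟩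
    by_contra! hc
    dsimp only at hc hZ
    have hsub : ∀ b, b ≠ a.bar → shadow (v * letter a) b ⊆ shadow v a := fun b hb =>
      shadow_subset_shadow hb
    have hmono : ∀ b, b ≠ a.bar → Mono (v * letter a, b) := by
      intro b hb
      by_contra hm
      exact hc b hb ⟨hm, fun η hη => hZ η (hsub b hb hη)⟩
    refine hp fun η₁ h₁ η₂ h₂ => ?_
    have hd : ∀ η ∈ shadow v a, ∃ b, b ≠ a.bar ∧ η ∈ shadow (v * letter a) b := fun η hη =>
      ⟨_, fun h => mem_shadow_bar.1 h hη, mem_shadow_self _ _⟩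
    obtain ⟨b₁, hb₁, h₁'⟩ := hd η₁ h₁
    obtain ⟨b₂, hb₂, h₂'⟩ := hd η₂ h₂
    let B : Set (Letter ι) := {b | b ≠ a.bar ∧ ∀ η ∈ shadow (v * letter a) b, χ η = χ η₁}
    by_contra hne
    obtain ⟨ζ, ζ', hl, ⟨d, hdB, hζ⟩, d', hd'B, hd', hζ'⟩ :=
      exists_line_of_cut hWh (v * letter a) (f := a.bar) (B := B) (b := b₁) (b' := b₂)
        (fun hf => hf.1 rfl) ⟨hb₁, fun η hη => hmono b₁ hb₁ _ hη _ h₁'⟩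
        (fun hB => hne (hB.2 η₂ h₂').symm) hb₂
    refine hd'B ⟨hd', fun η hη => ?_⟩
    rw [hmono d' hd' _ hη _ hζ',
      ← h.line hl (hZ _ (hsub _ hdB.1 hζ)) (hZ _ (hsub _ hd' hζ')), hdB.2 ζ hζ]
  by_contra hne
  have : Nonempty (Letter ι) := ⟨a⟩
  choose! nb hnb using hnext
  let p : ℕ → FreeGroup ι × Letter ι := fun n =>
    Nat.rec (v, a) (fun _ p => (p.1 * letter p.2, nb p)) n
  have hp : ∀ n, Bad (p n) := by
    intro n
    induction n with
    | zero => exact ⟨fun hm => hne (hm η hη η' hη'), hZ⟩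
    | succ n ih => exact (hnb _ ih).2
  let r : Boundary ι := ⟨fun n => (p n).2, fun n => (hnb _ (hp n)).1⟩
  have hr : v⁻¹ • v • r = r := inv_smul_smul v r
  have hv : ∀ n, rayVertex v (v • r) n = (p n).1 := by
    intro n
    induction n with
    | zero => rfl
    | succ n ih => rw [rayVertex, ih, hr]
  have hmem : ∀ n, v • r ∈ shadow (p n).1 (p n).2 := by
    intro n
    have := mem_shadow_rayVertex v (v • r) n
    rwa [hv, hr] at this
  obtain ⟨n, hn⟩ := exists_shadow_rayVertex_subset v (h.eventually_eq ((hp 0).2 _ (hmem 0)))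
  rw [hv, hr] at hn
  exact (hp n).1 fun ζ hζ ζ' hζ' => (hn hζ).2.trans (hn hζ').2.symm

/-! ### Colourings and separation in the decomposition space -/

theorem isOpen_decompositionSpace {U : Set (DecompositionSpace W)} :
    IsOpen U ↔ IsOpen (δ W ⁻¹' U) := Iff.rfl

theorem continuous_δ (W : Finset (FreeGroup ι)) : Continuous (δ W) :=
  continuous_def.2 fun _ h => h

instance : ContinuousConstSMul (FreeGroup ι) (DecompositionSpace W) where
  continuous_const_smul g := continuous_def.2 fun _ hU =>
    (isOpen_decompositionSpace.1 hU).preimage (continuous_const_smul g)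

theorem isCutPoint_smul {x : DecompositionSpace W} (g : FreeGroup ι) :
    IsCutPoint (g • x) ↔ IsCutPoint x := by
  have : ({g • x} : Set (DecompositionSpace W))ᶜ = Homeomorph.smul g '' {x}ᶜ := by
    rw [Set.image_compl_eq (Homeomorph.smul g).bijective, Set.image_singleton]
    rfl
  rw [IsCutPoint, IsCutPoint, IsCutSet, IsCutSet, this, Homeomorph.isConnected_image]

theorem IsColoring.isOpen_image {χ : Boundary ι → K} {Y : Set (DecompositionSpace W)}
    (h : IsColoring W (δ W ⁻¹' Y) χ) (P : K → Prop) :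
    IsOpen (δ W '' {η | δ W η ∉ Y ∧ P (χ η)}) ∧
      ∀ η, δ W η ∈ δ W '' {η | δ W η ∉ Y ∧ P (χ η)} ↔ δ W η ∉ Y ∧ P (χ η) := by
  have hmem : ∀ η, δ W η ∈ δ W '' {η | δ W η ∉ Y ∧ P (χ η)} ↔ δ W η ∉ Y ∧ P (χ η) := by
    refine fun η => ⟨?_, fun h => ⟨η, h, rfl⟩⟩
    rintro ⟨η', ⟨h1, h2⟩, he⟩
    refine ⟨he ▸ h1, ?_⟩
    rcases δ_eq_iff.1 he with rfl | hl
    · exact h2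
    · rwa [← h.line hl h1 (he ▸ h1 : δ W η ∉ Y)]
  refine ⟨?_, hmem⟩
  rw [isOpen_decompositionSpace, isOpen_iff_mem_nhds]
  intro η hη
  obtain ⟨h1, h2⟩ := (hmem η).1 hη
  filter_upwards [h.eventually_eq h1] with η' e
  exact (hmem η').2 ⟨e.1, e.2 ▸ h2⟩

/-- Points in a connected subset of the complement of `Y` have the same colour. -/
theorem IsColoring.eq_of_isPreconnected {χ : Boundary ι → K} {Y : Set (DecompositionSpace W)}
    (h : IsColoring W (δ W ⁻¹' Y) χ) {T : Set (DecompositionSpace W)} (hT : IsPreconnected T)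
    (hTY : T ⊆ Yᶜ) {η η' : Boundary ι} (hη : δ W η ∈ T) (hη' : δ W η' ∈ T) : χ η = χ η' := by
  obtain ⟨o1, m1⟩ := h.isOpen_image (· = χ η)
  obtain ⟨o2, m2⟩ := h.isOpen_image (· ≠ χ η)
  have hcover : T ⊆ δ W '' {ζ | δ W ζ ∉ Y ∧ χ ζ = χ η} ∪ δ W '' {ζ | δ W ζ ∉ Y ∧ χ ζ ≠ χ η} := by
    intro x hx
    obtain ⟨ζ, rfl⟩ : ∃ ζ, δ W ζ = x := Quot.exists_rep x
    by_cases hc : χ ζ = χ η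
    · exact Or.inl ((m1 ζ).2 ⟨hTY hx, hc⟩)
    · exact Or.inr ((m2 ζ).2 ⟨hTY hx, hc⟩)
  have hdisj : Disjoint (δ W '' {ζ | δ W ζ ∉ Y ∧ χ ζ = χ η})
      (δ W '' {ζ | δ W ζ ∉ Y ∧ χ ζ ≠ χ η}) := by
    rw [Set.disjoint_left]
    rintro _ ⟨ζ, hζ, rfl⟩ h2
    exact ((m2 ζ).1 h2).2 hζ.2
  have := hT.subset_left_of_subset_union o1 o2 hdisj hcover ⟨_, hη, (m1 η).2 ⟨hTY hη, rfl⟩⟩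
  exact ((m1 η').1 (this hη')).2.symm

theorem IsColoring.isCutSet {χ : Boundary ι → K} {Y : Set (DecompositionSpace W)}
    (h : IsColoring W (δ W ⁻¹' Y) χ) {η η' : Boundary ι} (hη : δ W η ∉ Y) (hη' : δ W η' ∉ Y)
    (hne : χ η ≠ χ η') : IsCutSet Y := fun hc =>
  hne (h.eq_of_isPreconnected hc.isPreconnected subset_rfl hη hη')

theorem IsColoring.crosses {χ : Boundary ι → K} {x₀ x₁ : DecompositionSpace W}
    (h : IsColoring W (δ W ⁻¹' {x₀, x₁}) χ) {η η' : Boundary ι}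
    (hη : δ W η ∉ ({x₀, x₁} : Set (DecompositionSpace W)))
    (hη' : δ W η' ∉ ({x₀, x₁} : Set (DecompositionSpace W)))
    (hne : χ η ≠ χ η') : Crosses (δ W η) (δ W η') x₀ x₁ := by
  refine ⟨hη, hη', fun hc => hne ?_⟩
  refine h.eq_of_isPreconnected (isPreconnected_connectedComponentIn (x := δ W η))
    (connectedComponentIn_subset _ _) (mem_connectedComponentIn hη) ?_
  rw [hc]
  exact mem_connectedComponentIn hη'

theorem finite_preimage_pair (x₀ x₁ : DecompositionSpace W) : (δ W ⁻¹' {x₀, x₁}).Finite := by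
  rw [Set.insert_eq, Set.preimage_union]
  exact (finite_preimage W x₀).union (finite_preimage W x₁)

theorem exists_letter_ne [Fintype ι] (hι : 1 < Fintype.card ι) (b f : Letter ι) :
    ∃ d, d ≠ b ∧ d ≠ f := by
  by_contra! hc
  have : (Finset.univ : Finset (Letter ι)) ⊆ {b, f} := fun d _ => by
    rw [Finset.mem_insert, Finset.mem_singleton]
    by_cases h : d = b
    · exact Or.inl h
    · exact Or.inr (hc d h)
  have := (Finset.card_le_card this).trans Finset.card_le_two
  rw [Finset.card_univ, Fintype.card_prod, Fintype.card_bool] at this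
  omega

theorem IsGeodesicParam.exists_exit_at [Fintype ι] (hι : 1 < Fintype.card ι)
    {ξ₀ ξ₁ : Boundary ι} {y : ℤ → FreeGroup ι} {s : ℤ → Letter ι} (H : IsGeodesicParam ξ₀ ξ₁ y s) (n : ℤ) :
    ∃ η, η ∈ shadow (y (n - 1)) (s (n - 1)) ∧ η ∉ shadow (y n) (s n) := by
  obtain ⟨d, h1, h2⟩ := exists_letter_ne hι (s (n - 1)).bar (s n)
  obtain ⟨η, hη⟩ := shadow_nonempty (y n) d
  exact ⟨η, H.exit_iff.2 ⟨d, h1, h2, hη⟩⟩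

theorem infinite_boundary [Fintype ι] (hι : 1 < Fintype.card ι) : Infinite (Boundary ι) := by
  obtain ⟨i⟩ : Nonempty ι := Fintype.card_pos_iff.1 (by omega)
  obtain ⟨ξ₀, h₀⟩ := shadow_nonempty 1 (i, true)
  obtain ⟨ξ₁, h₁⟩ := shadow_nonempty 1 (i, false)
  have hne : ξ₀ ≠ ξ₁ := by
    rintro rfl
    simpa using eq_of_mem_shadow h₀ h₁
  obtain ⟨y, s, H⟩ := exists_param hne
  choose e he using H.exists_exit_at hι
  refine Infinite.of_injective e fun m n h => ?_
  refine H.exit_unique (he m) ?_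
  rw [h]
  exact he n

/-- A finite cut set gives a nonconstant colouring of its complement. -/
theorem IsCutSet.exists_isColoring [Fintype ι] (hι : 1 < Fintype.card ι)
    {Y : Set (DecompositionSpace W)} (h : IsCutSet Y) (hY : (δ W ⁻¹' Y).Finite) :
    ∃ χ : Boundary ι → Bool, IsColoring W (δ W ⁻¹' Y) χ ∧
      ∀ c, ∃ η, δ W η ∉ Y ∧ χ η = c := by
  have := infinite_boundary hι
  have hnonempty : Yᶜ.Nonempty := by
    obtain ⟨η, hη⟩ := hY.infinite_compl.nonempty
    exact ⟨δ W η, hη⟩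
  have hpre : ¬ IsPreconnected Yᶜ := fun hc => h ⟨hnonempty, hc⟩
  rw [IsPreconnected] at hpre
  push Not at hpre
  obtain ⟨U, V, hU, hV, hUV, ⟨x, hx, hxU⟩, ⟨x', hx', hxV⟩, hd⟩ := hpre
  have hd' : ∀ z, z ∉ Y → z ∈ U → z ∉ V := fun z h1 h2 h3 => by
    have : z ∈ Yᶜ ∩ (U ∩ V) := ⟨h1, h2, h3⟩
    rw [hd] at this
    exact this
  classical
  refine ⟨fun η => decide (δ W η ∈ U), ⟨?_, ?_⟩, ?_⟩
  · intro η η' hl _ _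
    rw [show δ W η = δ W η' from Quot.sound hl]
  · intro η hη
    refine (hY.isClosed.isOpen_compl.eventually_mem hη).and ?_
    rcases hUV hη with hu | hv
    · filter_upwards [(hU.preimage (continuous_δ W)).eventually_mem hu] with η' h'
      have h' : δ W η' ∈ U := h'
      simp [h', hu]
    · filter_upwards [(hV.preimage (continuous_δ W)).eventually_mem hv,
        hY.isClosed.isOpen_compl.eventually_mem hη] with η' h' hY'
      have h1 : δ W η ∉ U := fun hu => hd' _ hη hu hv
      have h2 : δ W η' ∉ U := fun hu => hd' _ hY' hu h'
      simp [h1, h2]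
  · obtain ⟨η, rfl⟩ : ∃ η, δ W η = x := Quot.exists_rep x
    obtain ⟨η', rfl⟩ : ∃ η, δ W η = x' := Quot.exists_rep x'
    rintro (_ | _)
    · exact ⟨η', hx', by simpa using fun hu => hd' _ hx' hu hxV⟩
    · exact ⟨η, hx, by simpa using hxU⟩

end

section

variable {ι : Type*} [DecidableEq ι]

/-! ### Fundamental domains for a translation -/

namespace IsGeodesicParam

variable {ζ₀ ζ₁ : Boundary ι} {y : ℤ → FreeGroup ι} {s : ℤ → Letter ι} {t : FreeGroup ι} {τ : ℤ}

omit [DecidableEq ι] in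
theorem zpow_shift (_ : IsGeodesicParam ζ₀ ζ₁ y s) (h : ∀ n, t * y n = y (n + τ) ∧ s n = s (n + τ))
    (k n : ℤ) : t ^ k * y n = y (n + k * τ) ∧ s n = s (n + k * τ) := by
  induction k using Int.induction_on generalizing n with
  | zero => simp
  | succ k ih =>
    have e : n + (k + 1) * τ = (n + k * τ) + τ := by ring
    rw [zpow_add_one, (Commute.refl t).zpow_left k |>.eq, mul_assoc, (ih n).1, (h _).1, e,
      ← (h (n + k * τ)).2]
    exact ⟨rfl, (ih n).2⟩
  | pred k ih =>
    have e : n + (-k - 1) * τ + τ = n + -k * τ := by ring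
    have h1 := h (n + (-k - 1) * τ)
    rw [e, ← (ih n).1, ← (ih n).2] at h1
    refine ⟨?_, h1.2.symm⟩
    rw [zpow_sub_one, (Commute.refl t).zpow_left _ |>.inv_right.eq, mul_assoc, ← h1.1,
      inv_mul_cancel_left]

omit [DecidableEq ι] in
theorem zpow_smul_mem (H : IsGeodesicParam ζ₀ ζ₁ y s)
    (h : ∀ n, t * y n = y (n + τ) ∧ s n = s (n + τ)) (k n : ℤ) {η : Boundary ι} :
    t ^ k • η ∈ shadow (y (n + k * τ)) (s (n + k * τ)) ↔ η ∈ shadow (y n) (s n) := by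
  rw [← (H.zpow_shift h k n).1, ← (H.zpow_shift h k n).2, smul_mem_shadow]

omit [DecidableEq ι] in
theorem zpow_smul_mem_iff (H : IsGeodesicParam ζ₀ ζ₁ y s)
    (h : ∀ n, t * y n = y (n + τ) ∧ s n = s (n + τ)) (k n : ℤ) {η : Boundary ι} :
    t ^ k • η ∈ shadow (y n) (s n) ↔ η ∈ shadow (y (n - k * τ)) (s (n - k * τ)) := by
  rw [← H.zpow_smul_mem h k (n - k * τ), sub_add_cancel]

omit [DecidableEq ι] in
/-- The differences `S (k τ) ∖ S ((k + 1) τ)` of the shadows `S n` along the axis of a translation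
cover the complement of its ends. -/
theorem exists_mem_domain (H : IsGeodesicParam ζ₀ ζ₁ y s) (hτ : 0 < τ) {η : Boundary ι}
    (h₀ : η ≠ ζ₀) (h₁ : η ≠ ζ₁) :
    ∃ k : ℤ, η ∈ shadow (y (k * τ)) (s (k * τ)) ∧
      η ∉ shadow (y ((k + 1) * τ)) (s ((k + 1) * τ)) := by
  obtain ⟨n, hn, hn'⟩ := H.exists_exit h₀ h₁
  have h1 := Int.emod_add_mul_ediv (n - 1) τ
  have h2 := Int.emod_nonneg (n - 1) hτ.ne'
  have h3 := Int.emod_lt_of_pos (n - 1) hτ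
  refine ⟨(n - 1) / τ, H.antitone ?_ hn, fun h => hn' (H.antitone ?_ h)⟩
  · nlinarith
  · nlinarith

end IsGeodesicParam

/-! ### Points with two preimages -/

variable {W : Finset (FreeGroup ι)}

theorem smul_eq_of_preimage {x : DecompositionSpace W} {t : FreeGroup ι} {ζ₀ ζ₁ : Boundary ι}
    (ht : IsLineEnds 1 t ζ₀ ζ₁) (hx : δ W ⁻¹' {x} = {ζ₀, ζ₁}) : t • x = x := by
  have h1 : ζ₁ ∈ δ W ⁻¹' {x} := by rw [hx]; exact Or.inr rfl
  have h1 : δ W ζ₁ = x := h1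
  rw [← h1, smul_δ, ht.smul_right]

/-- Let `x₀` be the image of the two ends of an axis, and not a cut point.  A colouring of the
complement of `{x₀, x₁}` is constant near each end of the axis: a limit of its translates is a
colouring of the complement of `x₀`, hence constant. -/
theorem IsColoring.exists_eq_near_end [Fintype ι] (hι : 1 < Fintype.card ι)
    (hWh : WhConnectedWithoutCutVertices W)
    {x₀ x₁ : DecompositionSpace W} (hne : x₀ ≠ x₁) (hcut : ¬ IsCutPoint x₀) {t : FreeGroup ι}
    {ζ₀ ζ₁ : Boundary ι} (hζ : ζ₀ ≠ ζ₁) (ht : IsLineEnds 1 t ζ₀ ζ₁)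
    (hx : δ W ⁻¹' {x₀} = {ζ₀, ζ₁}) {χ : Boundary ι → Bool}
    (h : IsColoring W (δ W ⁻¹' {x₀, x₁}) χ) :
    ∃ U ∈ 𝓝 ζ₁, ∃ c, ∀ η ∈ U, η ≠ ζ₁ → χ η = c := by
  obtain ⟨y, s, H⟩ := exists_param hζ
  obtain ⟨τ, hτ, hshift⟩ := H.exists_pos_shift ht
  have hmem := @IsGeodesicParam.zpow_smul_mem _ _ _ _ _ _ _ H hshift
  have hmem' := @IsGeodesicParam.zpow_smul_mem_iff _ _ _ _ _ _ _ H hshift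
  have hx' : ∀ η, δ W η = x₀ ↔ η = ζ₀ ∨ η = ζ₁ := fun η => by
    have : η ∈ δ W ⁻¹' {x₀} ↔ η ∈ ({ζ₀, ζ₁} : Set (Boundary ι)) := by rw [hx]
    exact this
  have htx : ∀ k : ℤ, t ^ k • x₀ = x₀ := fun k =>
    (MulAction.stabilizer (FreeGroup ι) x₀).zpow_mem (smul_eq_of_preimage ht hx) k
  have hfix : ∀ (k : ℤ) (η : Boundary ι), η ≠ ζ₀ → η ≠ ζ₁ → δ W (t ^ k • η) ≠ x₀ := by
    intro k η h0 h1 h2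
    rw [← smul_δ, smul_eq_iff_eq_inv_smul, ← zpow_neg, htx, hx'] at h2
    tauto
  obtain ⟨M, -, hM⟩ := H.exists_shadow_subset (U := (δ W ⁻¹' {x₁})ᶜ)
    ((finite_preimage W x₁).isClosed.isOpen_compl.mem_nhds
      fun h1 : δ W ζ₁ = x₁ => hne (((hx' ζ₁).2 (Or.inr rfl)).symm.trans h1))
  -- translates by high powers of points in a shadow of the axis avoid the preimage of `x₁`
  have havoid : ∀ (j k : ℤ) (η : Boundary ι), η ≠ ζ₀ → η ≠ ζ₁ → η ∈ shadow (y j) (s j) →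
      M ≤ j + k * τ → t ^ k • η ∉ δ W ⁻¹' {x₀, x₁} := by
    rintro j k η h0 h1 hj hk (h2 | h2)
    · exact hfix k η h0 h1 h2
    · exact hM _ hk ((hmem k j).2 hj) h2
  have hlarge : ∀ j : ℤ, ∀ᶠ k : ℕ in atTop, M ≤ j + (k : ℤ) * τ := by
    intro j
    filter_upwards [eventually_ge_atTop (M - j).toNat] with k hk
    have : M - j ≤ k := by omega
    nlinarith [Int.natCast_nonneg k]
  have hconst : ∀ (j : ℤ) (k : ℕ) (v : FreeGroup ι) (a : Letter ι),
      (∀ η ∈ shadow v a, η ≠ ζ₀ ∧ η ≠ ζ₁ ∧ η ∈ shadow (y j) (s j)) → M ≤ j + (k : ℤ) * τ →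
      ∀ η ∈ shadow v a, ∀ η' ∈ shadow v a, χ (t ^ (k : ℤ) • η) = χ (t ^ (k : ℤ) • η') := by
    intro j k v a hva hk η hη η' hη'
    exact (h.smul (t ^ (k : ℤ))).eq_of_mem_shadow hWh
      (fun ζ hζ => havoid j k ζ (hva ζ hζ).1 (hva ζ hζ).2.1 (hva ζ hζ).2.2 hk) hη hη'
  let Const : ℕ → Prop := fun k => ∃ c, ∀ η, η ∈ shadow (y 0) (s 0) →
    η ∉ shadow (y (2 * τ)) (s (2 * τ)) → χ (t ^ (k : ℤ) • η) = c
  have hev : ∀ᶠ k in atTop, Const k := by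
    refine mem_iff_ultrafilter.2 fun 𝓤 h𝓤 => ?_
    classical
    let χ' : Boundary ι → Bool := fun η => decide (∀ᶠ k : ℕ in 𝓤, χ (t ^ (k : ℤ) • η) = true)
    have hχ' : ∀ η, ∀ᶠ k : ℕ in 𝓤, χ (t ^ (k : ℤ) • η) = χ' η := by
      intro η
      by_cases hc : ∀ᶠ k : ℕ in 𝓤, χ (t ^ (k : ℤ) • η) = true
      · have : χ' η = true := decide_eq_true hc
        rwa [this]
      · have : χ' η = false := decide_eq_false hc
        rw [this]
        filter_upwards [Ultrafilter.eventually_not.2 hc] with k hk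
        simpa using hk
    have hχ'_eq : ∀ η η' : Boundary ι,
        (∀ᶠ k : ℕ in atTop, χ (t ^ (k : ℤ) • η) = χ (t ^ (k : ℤ) • η')) → χ' η = χ' η' := by
      intro η η' he
      obtain ⟨k, h1, h2, h3⟩ := ((hχ' η).and ((hχ' η').and (h𝓤 he))).exists
      rw [← h1, ← h2, h3]
    have hcol : IsColoring W (δ W ⁻¹' {x₀}) χ' := by
      rw [hx]
      refine ⟨fun {η η'} hl h1 h2 => hχ'_eq _ _ ?_, fun {η} h1 => ?_⟩
      · simp only [Set.mem_insert_iff, Set.mem_singleton_iff, not_or] at h1 h2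
        obtain ⟨j, -, hj⟩ := H.exists_mem h1.1
        obtain ⟨j', -, hj'⟩ := H.exists_mem h2.1
        filter_upwards [hlarge j, hlarge j'] with k hk hk'
        exact h.line (smul_mem_lines hl _) (havoid j k η h1.1 h1.2 (hj j le_rfl) hk)
          (havoid j' k η' h2.1 h2.2 (hj' j' le_rfl) hk')
      · have h1' := h1
        simp only [Set.mem_insert_iff, Set.mem_singleton_iff, not_or] at h1'
        obtain ⟨j, -, hj⟩ := H.exists_mem h1'.1
        obtain ⟨n, hn⟩ := exists_shadow_rayVertex_subset 1
          (U := shadow (y j) (s j) ∩ {ζ₀, ζ₁}ᶜ) (ξ := η)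
          (((isOpen_shadow _ _).inter (Set.toFinite _).isClosed.isOpen_compl).mem_nhds
            ⟨hj j le_rfl, h1⟩)
        filter_upwards [(isOpen_shadow _ _).eventually_mem (mem_shadow_rayVertex 1 η n)]
          with η' hη'
        refine ⟨(hn hη').2, hχ'_eq _ _ ?_⟩
        filter_upwards [hlarge j] with k hk
        refine hconst j k _ _ (fun ζ hζ => ?_) hk _ hη' _ (mem_shadow_rayVertex 1 η n)
        have := hn hζ
        simp only [Set.mem_inter_iff, Set.mem_compl_iff, Set.mem_insert_iff,
          Set.mem_singleton_iff, not_or] at this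
        exact ⟨this.2.1, this.2.2, this.1⟩
    have hconn : IsPreconnected ({x₀}ᶜ : Set (DecompositionSpace W)) :=
      (not_not.1 hcut).isPreconnected
    obtain ⟨η₀, hη₀⟩ := H.exists_exit_at hι 0
    have hfin : ∀ᶠ k : ℕ in 𝓤, ∀ i ∈ Set.Icc 1 (2 * τ), ∀ d, d ≠ (s (i - 1)).bar → d ≠ s i →
        ∀ η ∈ shadow (y i) d, χ (t ^ (k : ℤ) • η) = χ' η₀ := by
      rw [eventually_all_finite (Set.finite_Icc _ _)]
      intro i hi
      rw [eventually_all]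
      intro d
      by_cases hd : d ≠ (s (i - 1)).bar ∧ d ≠ s i
      · obtain ⟨θ, hθ⟩ := shadow_nonempty (y i) d
        have hsub : ∀ η ∈ shadow (y i) d, η ∈ shadow (y (i - 1)) (s (i - 1)) ∧
            η ∉ shadow (y i) (s i) := fun η hη => H.exit_iff.2 ⟨d, hd.1, hd.2, hη⟩
        have hne' : ∀ η, η ∈ shadow (y (i - 1)) (s (i - 1)) ∧ η ∉ shadow (y i) (s i) →
            η ≠ ζ₀ ∧ η ≠ ζ₁ := fun η hη =>
          ⟨fun e => (H.edge (i - 1)).2 (e ▸ hη.1), fun e => hη.2 (e ▸ (H.edge i).1)⟩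
        have hne0 : η₀ ≠ ζ₀ ∧ η₀ ≠ ζ₁ :=
          ⟨fun e => (H.edge _).2 (e ▸ hη₀.1), fun e => hη₀.2 (e ▸ (H.edge 0).1)⟩
        have hθ' := hne' θ (hsub θ hθ)
        have e1 : χ' θ = χ' η₀ := by
          refine hcol.eq_of_isPreconnected hconn subset_rfl ?_ ?_
          · exact fun e => by rcases (hx' θ).1 e with e | e <;> tauto
          · exact fun e => by rcases (hx' η₀).1 e with e | e <;> tauto
        filter_upwards [hχ' θ, h𝓤 (hlarge (i - 1))] with k hk hk' _ _ η hη
        rw [hconst (i - 1) k (y i) d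
          (fun ζ hζ => ⟨(hne' ζ (hsub ζ hζ)).1, (hne' ζ (hsub ζ hζ)).2, (hsub ζ hζ).1⟩) hk' η hη
          θ hθ, hk, e1]
      · refine Eventually.of_forall fun k h1 h2 => absurd ⟨h1, h2⟩ hd
    filter_upwards [hfin] with k hk
    refine ⟨χ' η₀, fun η h1 h2 => ?_⟩
    have hη0 : η ≠ ζ₀ := fun e => (H.edge 0).2 (e ▸ h1)
    have hη1 : η ≠ ζ₁ := fun e => h2 (e ▸ (H.edge _).1)
    obtain ⟨i, hi⟩ := H.exists_exit hη0 hη1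
    have hi1 : 1 ≤ i := by
      by_contra! hc
      exact hi.2 (H.antitone (by omega) h1)
    have hi2 : i ≤ 2 * τ := by
      by_contra! hc
      exact h2 (H.antitone (by omega) hi.1)
    obtain ⟨d, hd1, hd2, hd⟩ := H.exit_iff.1 hi
    exact hk i ⟨hi1, hi2⟩ d hd1 hd2 η hd
  obtain ⟨K, hK⟩ := eventually_atTop.1 hev
  choose! c hc using hK
  -- consecutive windows overlap, so the constants agree
  have hcc : ∀ k ≥ K, c k = c K := by
    intro k hk
    induction k, hk using Nat.le_induction with
    | base => rfl
    | succ k hk ih =>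
      obtain ⟨θ, hθ, hθ'⟩ := H.exists_exit_at hι 1
      rw [sub_self] at hθ
      have h1 := hc (k + 1) (by omega) θ hθ fun h' => hθ' (H.antitone (by omega) h')
      have e1 : t ^ (1 : ℤ) • θ ∈ shadow (y 0) (s 0) :=
        (hmem' 1 0).2 (H.antitone (by omega) hθ)
      have e2 : t ^ (1 : ℤ) • θ ∉ shadow (y (2 * τ)) (s (2 * τ)) := fun h' =>
        hθ' (H.antitone (by omega) ((hmem' 1 _).1 h'))
      have h2 := hc k hk _ e1 e2
      rw [smul_smul, ← zpow_add] at h2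
      rw [← ih, ← h1, ← h2]
      push_cast
      rfl
  refine ⟨shadow (y (K * τ)) (s (K * τ)), (isOpen_shadow _ _).mem_nhds (H.edge _).1, c K,
    fun η hη hη1 => ?_⟩
  have hη0 : η ≠ ζ₀ := fun e => (H.edge _).2 (e ▸ hη)
  obtain ⟨k, hk, hk'⟩ := H.exists_mem_domain hτ hη0 hη1
  have hKk : (K : ℤ) ≤ k := by
    by_contra! hlt
    exact hk' (H.antitone (by nlinarith) hη)
  obtain ⟨k, rfl⟩ := Int.eq_ofNat_of_zero_le (by omega : 0 ≤ k)
  have := hc k (by omega) (t ^ (-(k : ℤ)) • η)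
    ((hmem' _ _).2 (by convert! hk using 2 <;> · congr 1; ring))
    (fun h' => hk' (H.antitone (by nlinarith) ((hmem' _ _).1 h')))
  rw [smul_smul, ← zpow_add, add_neg_cancel, zpow_zero, one_smul] at this
  rw [this, hcc k (by omega)]

end

section

variable {ι : Type*} [DecidableEq ι] {W : Finset (FreeGroup ι)}

theorem IsCutPair.symm {X : Type*} [TopologicalSpace X] {x₀ x₁ : X} (h : IsCutPair x₀ x₁) :
    IsCutPair x₁ x₀ :=
  ⟨h.1.symm, by rw [Set.pair_comm]; exact h.2.1, h.2.2.2, h.2.2.1⟩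

theorem IsUncrossedCutPair.symm {X : Type*} [TopologicalSpace X] {x₀ x₁ : X}
    (h : IsUncrossedCutPair x₀ x₁) : IsUncrossedCutPair x₁ x₀ :=
  ⟨h.1.symm, fun y₀ y₁ hy hc => h.2 y₀ y₁ hy (by
    unfold Crosses at hc ⊢
    rwa [Set.pair_comm x₀ x₁])⟩

/-- A colouring of the complement of `{x₀, x₁}` that separates `y₀` from `y₁`, together with a
colouring of the complement of `{y₀, y₁}` that is not constant, shows that `{x₀, x₁}` is crossed by
`{y₀, y₁}`. -/
theorem IsUncrossedCutPair.false_of_isColoring {x₀ x₁ : DecompositionSpace W}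
    (hu : IsUncrossedCutPair x₀ x₁) {K K' : Type*} {χ : Boundary ι → K} {μ : Boundary ι → K'}
    (hχ : IsColoring W (δ W ⁻¹' {x₀, x₁}) χ) {η₀ η₁ : Boundary ι}
    (h₀ : δ W η₀ ∉ ({x₀, x₁} : Set (DecompositionSpace W)))
    (h₁ : δ W η₁ ∉ ({x₀, x₁} : Set (DecompositionSpace W))) (hχne : χ η₀ ≠ χ η₁)
    (hμ : IsColoring W (δ W ⁻¹' {δ W η₀, δ W η₁}) μ) {θ θ' : Boundary ι}
    (hθ : δ W θ ∉ ({δ W η₀, δ W η₁} : Set (DecompositionSpace W)))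
    (hθ' : δ W θ' ∉ ({δ W η₀, δ W η₁} : Set (DecompositionSpace W))) (hμne : μ θ ≠ μ θ')
    (hc₀ : ¬ IsCutPoint (δ W η₀)) (hc₁ : ¬ IsCutPoint (δ W η₁)) : False := by
  have hc := hχ.crosses h₀ h₁ hχne
  exact hu.2 _ _ ⟨fun e => hc.2.2 (by rw [e]), hμ.isCutSet hθ hθ' hμne, hc₀, hc₁⟩ hc

/-- A point of an uncrossed cut pair is not the image of a line: if `x₀` is the image of an axis
with translation `t`, then the complement of `x₀` is arranged along the axis, so that
`{t^{-k} x₁, t^k x₁}` crosses `{x₀, x₁}` for large `k`. -/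
theorem IsUncrossedCutPair.not_line [Fintype ι] (hι : 1 < Fintype.card ι)
    (hWh : WhConnectedWithoutCutVertices W) {x₀ x₁ : DecompositionSpace W}
    (hu : IsUncrossedCutPair x₀ x₁) {t : FreeGroup ι} {ζ₀ ζ₁ : Boundary ι} (hζ : ζ₀ ≠ ζ₁)
    (ht : IsLineEnds 1 t ζ₀ ζ₁) (hx : δ W ⁻¹' {x₀} = {ζ₀, ζ₁}) : False := by
  obtain ⟨hne, hcutset, hcut₀, hcut₁⟩ := hu.1
  have hx' : ∀ η, δ W η = x₀ ↔ η = ζ₀ ∨ η = ζ₁ := fun η => by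
    have : η ∈ δ W ⁻¹' {x₀} ↔ η ∈ ({ζ₀, ζ₁} : Set (Boundary ι)) := by rw [hx]
    exact this
  obtain ⟨χ, hχ, hsurj⟩ := hcutset.exists_isColoring hι (finite_preimage_pair x₀ x₁)
  obtain ⟨U₁, hU₁, c₁, hc₁⟩ := hχ.exists_eq_near_end hι hWh hne hcut₀ hζ ht hx
  obtain ⟨U₀, hU₀, c₀, hc₀⟩ := hχ.exists_eq_near_end hι hWh hne hcut₀ hζ.symm ht.reverse
    (by rw [hx, Set.pair_comm])
  have hopen : IsOpen (δ W ⁻¹' {x₁})ᶜ := (finite_preimage W x₁).isClosed.isOpen_compl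
  have hx₁ : ∀ η, δ W η = x₁ → η ≠ ζ₀ ∧ η ≠ ζ₁ := fun η h =>
    ⟨fun e => hne (((hx' η).2 (Or.inl e)).symm.trans h),
      fun e => hne (((hx' η).2 (Or.inr e)).symm.trans h)⟩
  have hV₁ : U₁ ∩ (δ W ⁻¹' {x₁})ᶜ ∈ 𝓝 ζ₁ :=
    inter_mem hU₁ (hopen.mem_nhds fun h => (hx₁ _ h).2 rfl)
  have hV₀ : U₀ ∩ (δ W ⁻¹' {x₁})ᶜ ∈ 𝓝 ζ₀ :=
    inter_mem hU₀ (hopen.mem_nhds fun h => (hx₁ _ h).1 rfl)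
  rcases eq_or_ne c₀ c₁ with rfl | hcc
  · -- the colouring extends over `x₀`, so `x₁` is a cut point
    classical
    let χ' : Boundary ι → Bool := fun η => if δ W η = x₀ then c₀ else χ η
    have hχ'_pos : ∀ η, δ W η = x₀ → χ' η = c₀ := fun η h => if_pos h
    have hχ'_neg : ∀ η, δ W η ≠ x₀ → χ' η = χ η := fun η h => if_neg h
    have hχ' : IsColoring W (δ W ⁻¹' {x₁}) χ' := by
      refine ⟨fun {η η'} hl h1 h2 => ?_, fun {η} h1 => ?_⟩
      · have e : δ W η = δ W η' := Quot.sound hl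
        by_cases h : δ W η = x₀
        · rw [hχ'_pos η h, hχ'_pos η' (e ▸ h)]
        · rw [hχ'_neg η h, hχ'_neg η' (e ▸ h)]
          exact hχ.line hl (by rintro (h' | h'); exacts [h h', h1 h'])
            (by rintro (h' | h'); exacts [h (e.trans h'), h2 h'])
      · by_cases h : δ W η = x₀
        · have hnear : ∀ᶠ η' in 𝓝 η, η' ∉ δ W ⁻¹' {x₁} ∧ (δ W η' ≠ x₀ → χ η' = c₀) := by
            rcases (hx' η).1 h with rfl | rfl
            · filter_upwards [hV₀] with η' hη'
              exact ⟨hη'.2, fun h' => hc₀ η' hη'.1 fun e => h' ((hx' _).2 (Or.inl e))⟩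
            · filter_upwards [hV₁] with η' hη'
              exact ⟨hη'.2, fun h' => hc₁ η' hη'.1 fun e => h' ((hx' _).2 (Or.inr e))⟩
          filter_upwards [hnear] with η' hη'
          refine ⟨hη'.1, ?_⟩
          rw [hχ'_pos η h]
          by_cases h' : δ W η' = x₀
          · exact hχ'_pos η' h'
          · rw [hχ'_neg η' h', hη'.2 h']
        · have hη : η ∉ δ W ⁻¹' {x₀, x₁} := by rintro (h' | h'); exacts [h h', h1 h']
          filter_upwards [hχ.eventually_eq hη] with η' hη'
          have h2 : δ W η' ≠ x₀ := fun e => hη'.1 (Or.inl e)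
          refine ⟨fun e => hη'.1 (Or.inr e), ?_⟩
          rw [hχ'_neg η h, hχ'_neg η' h2, hη'.2]
    obtain ⟨η, hη, hηc⟩ := hsurj true
    obtain ⟨η', hη', hηc'⟩ := hsurj false
    refine hcut₁ (hχ'.isCutSet (η := η) (η' := η') (fun e => hη (Or.inr e))
      (fun e => hη' (Or.inr e)) ?_)
    rw [hχ'_neg η fun e => hη (Or.inl e), hχ'_neg η' fun e => hη' (Or.inl e), hηc, hηc']
    simp
  · obtain ⟨y, s, H⟩ := exists_param hζ
    obtain ⟨τ, hτ, hshift⟩ := H.exists_pos_shift ht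
    have hmem' := @IsGeodesicParam.zpow_smul_mem_iff _ _ _ _ _ _ _ H hshift
    obtain ⟨m, hm0, hm⟩ := H.exists_shadow_subset hV₁
    obtain ⟨n, hn0, hn⟩ := H.exists_compl_shadow_subset hV₀
    obtain ⟨η₁, hη₁⟩ : ∃ η, δ W η = x₁ := Quot.exists_rep x₁
    let k : ℤ := m - n
    have hk : k ≤ k * τ := by nlinarith [show 0 ≤ k by omega]
    have htx : ∀ k : ℤ, t ^ k • x₀ = x₀ := fun k =>
      (MulAction.stabilizer (FreeGroup ι) x₀).zpow_mem (smul_eq_of_preimage ht hx) k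
    have hfix : ∀ (k : ℤ) (η : Boundary ι), δ W (t ^ k • η) = x₀ ↔ δ W η = x₀ := by
      intro k η
      rw [← smul_δ, smul_eq_iff_eq_inv_smul, ← zpow_neg, htx]
    have hin : η₁ ∉ shadow (y m) (s m) := fun h => (hm m le_rfl h).2 hη₁
    have hin' : η₁ ∈ shadow (y n) (s n) := by
      by_contra h
      exact (hn n le_rfl h).2 hη₁
    -- translation by `k` moves the preimages of `x₁` into the neighbourhood of `ζ₁`,
    -- and translation by `-k` into that of `ζ₀`
    have hp : t ^ k • η₁ ∈ U₁ ∩ (δ W ⁻¹' {x₁})ᶜ :=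
      hm m le_rfl ((hmem' _ _).2 (H.antitone (by omega) hin'))
    have hq : t ^ (-k) • η₁ ∈ U₀ ∩ (δ W ⁻¹' {x₁})ᶜ :=
      hn n le_rfl fun h => hin (H.antitone (by rw [neg_mul]; omega) ((hmem' _ _).1 h))
    have hη₁0 : δ W η₁ ≠ x₀ := fun e => hne (e.symm.trans hη₁)
    have hp0 : δ W (t ^ k • η₁) ≠ x₀ := fun e => hη₁0 ((hfix _ _).1 e)
    have hq0 : δ W (t ^ (-k) • η₁) ≠ x₀ := fun e => hη₁0 ((hfix _ _).1 e)
    have hpc : χ (t ^ k • η₁) = c₁ := hc₁ _ hp.1 fun e => hp0 ((hx' _).2 (Or.inr e))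
    have hqc : χ (t ^ (-k) • η₁) = c₀ := hc₀ _ hq.1 fun e => hq0 ((hx' _).2 (Or.inl e))
    classical
    let μ : Boundary ι → Bool := fun η =>
      decide (δ W η ≠ x₀ ∧ χ (t ^ k • η) = c₁ ∧ χ (t ^ (-k) • η) = c₀)
    -- in terms of `η`, what it means not to be in the preimage of the translated pair
    have hZ : ∀ η, δ W η ∉ ({δ W (t ^ (-k) • η₁), δ W (t ^ k • η₁)} :
        Set (DecompositionSpace W)) → δ W η ≠ x₀ → t ^ k • η ∉ δ W ⁻¹' {x₀, x₁} ∧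
        t ^ (-k) • η ∉ δ W ⁻¹' {x₀, x₁} := by
      intro η h1 h2
      rw [Set.mem_insert_iff, Set.mem_singleton_iff, not_or] at h1
      constructor
      · rintro (h3 | h3)
        · exact h2 ((hfix _ _).1 h3)
        · refine h1.1 ?_
          rw [Set.mem_singleton_iff, ← hη₁, ← smul_δ, smul_eq_iff_eq_inv_smul, ← zpow_neg] at h3
          exact h3
      · rintro (h3 | h3)
        · exact h2 ((hfix _ _).1 h3)
        · refine h1.2 ?_
          rw [Set.mem_singleton_iff, ← hη₁, ← smul_δ, smul_eq_iff_eq_inv_smul, ← zpow_neg,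
            neg_neg] at h3
          exact h3
    have hμ : IsColoring W (δ W ⁻¹' {δ W (t ^ (-k) • η₁), δ W (t ^ k • η₁)}) μ := by
      refine ⟨fun {η η'} hl h1 h2 => ?_, fun {η} h1 => ?_⟩
      · have e : δ W η = δ W η' := Quot.sound hl
        by_cases h : δ W η = x₀
        · simp [μ, h, e ▸ h]
        · have h' : δ W η' ≠ x₀ := e ▸ h
          have e1 := hχ.line (smul_mem_lines hl (t ^ k)) (hZ η h1 h).1 (hZ η' h2 h').1
          have e2 := hχ.line (smul_mem_lines hl (t ^ (-k))) (hZ η h1 h).2 (hZ η' h2 h').2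
          simp only [μ, e1, e2, e]
      · refine ((finite_preimage_pair _ _).isClosed.isOpen_compl.eventually_mem h1).and ?_
        by_cases h : δ W η = x₀
        · have hμη : μ η = false := by simp [μ, h]
          rw [hμη]
          rcases (hx' η).1 h with rfl | rfl
          · filter_upwards [(isClosed_shadow (y (n - k * τ)) (s (n - k * τ))).isOpen_compl.eventually_mem
              (H.edge _).2] with η' hη'
            refine decide_eq_false fun hc => hcc ?_
            rw [← hc.2.1]
            exact (hc₀ _ (hn n le_rfl fun h => hη' ((hmem' _ _).1 h)).1
              fun e => hc.1 ((hfix k η').1 ((hx' _).2 (Or.inl e)))).symm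
          · filter_upwards [(isOpen_shadow (y (m - -k * τ)) (s (m - -k * τ))).eventually_mem
              (H.edge _).1] with η' hη'
            refine decide_eq_false fun hc => hcc ?_
            rw [← hc.2.2]
            exact (hc₁ _ (hm m le_rfl ((hmem' _ _).2 hη')).1
              fun e => hc.1 ((hfix (-k) η').1 ((hx' _).2 (Or.inr e))))
        · have hη : η ∉ δ W ⁻¹' {x₀} := h
          filter_upwards [(hχ.smul (t ^ k)).eventually_eq (hZ η h1 h).1,
            (hχ.smul (t ^ (-k))).eventually_eq (hZ η h1 h).2,
            (finite_preimage W x₀).isClosed.isOpen_compl.eventually_mem hη] with η' e1 e2 e3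
          have e3 : δ W η' ≠ x₀ := e3
          simp only [μ, e1.2, e2.2, ne_eq, h, e3, not_false_eq_true]
    refine hu.false_of_isColoring hχ (η₀ := t ^ (-k) • η₁) (η₁ := t ^ k • η₁) ?_ ?_
      (by rwa [hpc, hqc]) hμ (θ := η₁) (θ' := ζ₁) ?_ ?_ ?_ ?_ ?_
    · rintro (h | h); exacts [hq0 h, hq.2 h]
    · rintro (h | h); exacts [hp0 h, hp.2 h]
    · rw [hη₁]
      rintro (h | h); exacts [hq.2 h.symm, hp.2 (Set.mem_singleton_iff.1 h).symm]
    · rw [(hx' ζ₁).2 (Or.inr rfl)]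
      rintro (h | h); exacts [hq0 h.symm, hp0 (Set.mem_singleton_iff.1 h).symm]
    · have h1 : μ η₁ = true := decide_eq_true ⟨hη₁0, hpc, hqc⟩
      have h2 : μ ζ₁ = false := decide_eq_false fun h => h.1 ((hx' _).2 (Or.inr rfl))
      rw [h1, h2]
      simp
    · rw [← smul_δ, isCutPoint_smul, hη₁]
      exact hcut₁
    · rw [← smul_δ, isCutPoint_smul, hη₁]
      exact hcut₁

theorem IsUncrossedCutPair.exists_preimage_eq [Fintype ι] (hι : 1 < Fintype.card ι)
    (hWh : WhConnectedWithoutCutVertices W) {x₀ x₁ : DecompositionSpace W}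
    (hu : IsUncrossedCutPair x₀ x₁) : ∃ ξ, δ W ⁻¹' {x₀} = {ξ} := by
  obtain ⟨ξ, η, h⟩ := exists_preimage_subset W x₀
  by_cases hne : ξ = η
  · subst hne
    exact ⟨ξ, by rw [h, Set.pair_eq_singleton]⟩
  · have h1 : ξ ∈ δ W ⁻¹' {x₀} := by rw [h]; exact Or.inl rfl
    have h2 : η ∈ δ W ⁻¹' {x₀} := by rw [h]; exact Or.inr rfl
    have hl : s(ξ, η) ∈ lines W :=
      (δ_eq_iff.1 (Eq.trans h1 (Eq.symm h2) : δ W ξ = δ W η)).resolve_left hne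
    obtain ⟨t, ht⟩ := exists_isLineEnds_of_mem_lines hl
    exact (hu.not_line hι hWh hne ht h).elim

/-! ### Colours of the lines crossing a geodesic -/

/-- At a vertex `y` let two directions `b ≠ f` be given, such that the colouring is defined on all
other shadows.  A colour that occurs in one of these is the colour of a line joining one of
them to the shadow in the direction `b`. -/
theorem IsColoring.exists_line_of_exit {K : Type*} {Z : Set (Boundary ι)} {χ : Boundary ι → K}
    (hχ : IsColoring W Z χ) (hWh : WhConnectedWithoutCutVertices W) {v : FreeGroup ι}
    {b f d : Letter ι} (hbf : b ≠ f) (hZ : ∀ d, d ≠ b → d ≠ f → ∀ η ∈ shadow v d, η ∉ Z)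
    (hdb : d ≠ b) (hdf : d ≠ f) {θ : Boundary ι} (hθ : θ ∈ shadow v d) :
    ∃ ζ ζ', s(ζ, ζ') ∈ lines W ∧ ζ ∈ shadow v b ∧
      (∃ d', d' ≠ b ∧ d' ≠ f ∧ ζ' ∈ shadow v d') ∧ χ ζ' = χ θ := by
  let B : Set (Letter ι) := {d' | d' ≠ b ∧ d' ≠ f ∧ ∀ η ∈ shadow v d', χ η = χ θ}
  obtain ⟨η, η', hl, ⟨d₁, hd₁, hη⟩, d₂, hd₂, hd₂f, hη'⟩ := exists_line_of_cut hWh v (f := f)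
    (B := B) (b := d) (b' := b) (fun h => h.2.1 rfl)
    ⟨hdb, hdf, fun η hη => hχ.eq_of_mem_shadow hWh (hZ d hdb hdf) hη hθ⟩ (fun h => h.1 rfl) hbf
  by_cases hd₂b : d₂ = b
  · subst hd₂b
    exact ⟨η', η, Sym2.eq_swap ▸ hl, hη', ⟨d₁, hd₁.1, hd₁.2.1, hη⟩, hd₁.2.2 η hη⟩
  · refine absurd ⟨hd₂b, hd₂f, fun ζ hζ => ?_⟩ hd₂
    rw [hχ.eq_of_mem_shadow hWh (hZ d₂ hd₂b hd₂f) hζ hη',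
      ← hχ.line hl (hZ _ hd₁.1 hd₁.2.1 _ hη) (hZ _ hd₂b hd₂f _ hη'), hd₁.2.2 η hη]

omit [DecidableEq ι] in
theorem IsGeodesicParam.notMem_of_exit {ξ₀ ξ₁ : Boundary ι} {x : ℤ → FreeGroup ι}
    {r : ℤ → Letter ι} (H : IsGeodesicParam ξ₀ ξ₁ x r) {n : ℤ} {η : Boundary ι}
    (h : η ∈ shadow (x (n - 1)) (r (n - 1)) ∧ η ∉ shadow (x n) (r n)) :
    η ∉ ({ξ₀, ξ₁} : Set (Boundary ι)) := by
  rintro (rfl | h')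
  · exact (H.edge _).2 h.1
  · rw [Set.mem_singleton_iff.1 h'] at h
    exact h.2 (H.edge _).1

omit [DecidableEq ι] in
theorem IsGeodesicParam.notMem_of_mem_shadow {ξ₀ ξ₁ : Boundary ι} {x : ℤ → FreeGroup ι}
    {r : ℤ → Letter ι} (H : IsGeodesicParam ξ₀ ξ₁ x r) {n : ℤ} {d : Letter ι}
    (h1 : d ≠ (r (n - 1)).bar) (h2 : d ≠ r n) :
    ∀ η ∈ shadow (x n) d, η ∉ ({ξ₀, ξ₁} : Set (Boundary ι)) :=
  fun _ hη => H.notMem_of_exit (H.exit_iff.2 ⟨d, h1, h2, hη⟩)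

section

variable {K : Type*} {ξ₀ ξ₁ : Boundary ι} {x : ℤ → FreeGroup ι} {r : ℤ → Letter ι}
  {χ : Boundary ι → K}

theorem IsColoring.exists_line_back (hχ : IsColoring W {ξ₀, ξ₁} χ)
    (hWh : WhConnectedWithoutCutVertices W) (H : IsGeodesicParam ξ₀ ξ₁ x r) {n : ℤ}
    {θ : Boundary ι} (hθ : θ ∈ shadow (x n) (r n)) (hθ' : θ ∉ shadow (x (n + 1)) (r (n + 1))) :
    ∃ ζ ζ', s(ζ, ζ') ∈ lines W ∧ ζ ∈ shadow (x n) (r n) ∧ ζ' ∉ shadow (x n) (r n) ∧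
      χ ζ = χ θ := by
  obtain ⟨d, h1, h2, hd⟩ := H.exit_iff.1
    (⟨by simpa using hθ, hθ'⟩ : θ ∈ shadow (x (n + 1 - 1)) (r (n + 1 - 1)) ∧ _)
  obtain ⟨ζ, ζ', hl, hζ, ⟨d', h1', h2', hζ'⟩, hc⟩ := hχ.exists_line_of_exit hWh
    (H.ne_bar (n + 1)).symm (fun d h1 h2 => H.notMem_of_mem_shadow h1 h2) h1 h2 hd
  rw [H.mem_shadow_back, add_sub_cancel_right] at hζ
  have := (H.exit_iff.2 ⟨d', h1', h2', hζ'⟩).1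
  rw [add_sub_cancel_right] at this
  exact ⟨ζ', ζ, Sym2.eq_swap ▸ hl, this, hζ, hc⟩

/-- Each colour of a colouring of the complement of `{ξ₀, ξ₁}` occurs among the lines that cross any
given edge of the geodesic. -/
theorem IsColoring.exists_line_crossing (hχ : IsColoring W {ξ₀, ξ₁} χ)
    (hline : ∀ {η η'}, s(η, η') ∈ lines W → χ η = χ η')
    (hWh : WhConnectedWithoutCutVertices W) (H : IsGeodesicParam ξ₀ ξ₁ x r) {θ : Boundary ι}
    (hθ : θ ∉ ({ξ₀, ξ₁} : Set (Boundary ι))) (n : ℤ) :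
    ∃ ζ ζ', s(ζ, ζ') ∈ lines W ∧ ζ ∈ shadow (x n) (r n) ∧ ζ' ∉ shadow (x n) (r n) ∧
      χ ζ = χ θ := by
  rw [Set.mem_insert_iff, Set.mem_singleton_iff, not_or] at hθ
  obtain ⟨m, hm, hm'⟩ := H.exists_exit hθ.1 hθ.2
  have h0 := hχ.exists_line_back hWh H hm (by simpa using hm')
  generalize m - 1 = m at h0
  have hup : ∀ n ≥ m, ∃ ζ ζ', s(ζ, ζ') ∈ lines W ∧ ζ ∈ shadow (x n) (r n) ∧
      ζ' ∉ shadow (x n) (r n) ∧ χ ζ = χ θ := by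
    intro n hn
    induction n, hn using Int.leInduction with
    | base => exact h0
    | succ n _ ih =>
      obtain ⟨ζ, ζ', hl, hζ, hζ', hc⟩ := ih
      by_cases h : ζ ∈ shadow (x (n + 1)) (r (n + 1))
      · exact ⟨ζ, ζ', hl, h, fun h' => hζ' (H.antitone (by omega) h'), hc⟩
      · obtain ⟨d, h1, h2, hd⟩ := H.exit_iff.1
          (⟨by simpa using hζ, h⟩ : ζ ∈ shadow (x (n + 1 - 1)) (r (n + 1 - 1)) ∧ _)
        obtain ⟨η, η', hl', hη, ⟨d', h1', h2', hη'⟩, hc'⟩ := hχ.exists_line_of_exit hWh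
          (H.ne_bar (n + 1)) (fun d h1 h2 => H.notMem_of_mem_shadow h2 h1) h2 h1 hd
        exact ⟨η, η', hl', hη, (H.exit_iff.2 ⟨d', h2', h1', hη'⟩).2,
          (hline hl').trans (hc'.trans hc)⟩
  have hdown : ∀ n ≤ m, ∃ ζ ζ', s(ζ, ζ') ∈ lines W ∧ ζ ∈ shadow (x n) (r n) ∧
      ζ' ∉ shadow (x n) (r n) ∧ χ ζ = χ θ := by
    intro n hn
    induction n, hn using Int.leInductionDown with
    | base => exact h0
    | pred n _ ih =>
      obtain ⟨ζ, ζ', hl, hζ, hζ', hc⟩ := ih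
      by_cases h : ζ' ∈ shadow (x (n - 1)) (r (n - 1))
      · obtain ⟨η, η', hl', hη, hη', hc'⟩ := hχ.exists_line_back hWh H h (by simpa using hζ')
        exact ⟨η, η', hl', hη, hη', hc'.trans ((hline hl).symm.trans hc)⟩
      · exact ⟨ζ, ζ', hl, H.antitone (by omega) hζ, h, hc⟩
  rcases le_total m n with h | h
  · exact hup n h
  · exact hdown n h

end

/-! ### Periodic colourings -/

/-- Let `y` parametrize the axis of `t`, which shifts it by `τ`, and let a colouring of the
complement of `{ξ₀, ξ₁}` be such that the lines crossing the edge with number `0` keep their colour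
under `t`.  The colours in the fundamental domain between the edges `0` and `τ` then extend
`t`-periodically to a colouring of the complement of the ends of the axis. -/
theorem IsColoring.exists_periodic {K : Type*} {ξ₀ ξ₁ ζ₀ ζ₁ : Boundary ι} {χ : Boundary ι → K}
    (hχ : IsColoring W {ξ₀, ξ₁} χ) (hline : ∀ {η η'}, s(η, η') ∈ lines W → χ η = χ η')
    {y : ℤ → FreeGroup ι} {s : ℤ → Letter ι} (H : IsGeodesicParam ζ₀ ζ₁ y s) {t : FreeGroup ι}
    {τ : ℤ} (hτ : 0 < τ) (hshift : ∀ n, t * y n = y (n + τ) ∧ s n = s (n + τ))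
    (ht₀ : t • ζ₀ = ζ₀) (ht₁ : t • ζ₁ = ζ₁)
    (h₀ : ξ₀ ∉ shadow (y 0) (s 0)) (h₁ : ξ₁ ∈ shadow (y τ) (s τ))
    (hstar : ∀ {η η'}, s(η, η') ∈ lines W → η ∈ shadow (y 0) (s 0) → η' ∉ shadow (y 0) (s 0) →
      χ (t • η) = χ η) :
    ∃ α : Boundary ι → K, IsColoring W {ζ₀, ζ₁} α ∧ (∀ η, α (t • η) = α η) ∧
      (∀ η, η ∈ shadow (y 0) (s 0) → η ∉ shadow (y τ) (s τ) → α η = χ η) ∧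
      ∀ {η η'}, s(η, η') ∈ lines W → η ≠ ζ₁ → η' ≠ ζ₀ → η ∈ shadow (y 0) (s 0) →
        η' ∉ shadow (y τ) (s τ) → α η = χ η := by
  classical
  have hmem := @IsGeodesicParam.zpow_smul_mem_iff _ _ _ _ _ _ _ H hshift
  let D : ℤ → Boundary ι → Prop := fun k η => η ∈ shadow (y (k * τ)) (s (k * τ)) ∧
    η ∉ shadow (y ((k + 1) * τ)) (s ((k + 1) * τ))
  have hDle : ∀ {k j : ℤ} {η : Boundary ι}, D k η → j ≤ k → η ∈ shadow (y (j * τ)) (s (j * τ)) :=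
    fun h hjk => H.antitone (by nlinarith) h.1
  have hDlt : ∀ {k j : ℤ} {η : Boundary ι}, D k η → k < j → η ∉ shadow (y (j * τ)) (s (j * τ)) :=
    fun h hjk h' => h.2 (H.antitone (by nlinarith) h')
  have hDuniq : ∀ {k j : ℤ} {η : Boundary ι}, D k η → D j η → k = j := by
    intro k j η hk hj
    rcases lt_trichotomy k j with h | h | h
    · exact absurd hj.1 (hDlt hk h)
    · exact h
    · exact absurd hk.1 (hDlt hj h)
  have hDmap : ∀ {k : ℤ} {η : Boundary ι} (j : ℤ), D k η → D (k + j) (t ^ j • η) := by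
    intro k η j h
    constructor
    · rw [hmem]; convert! h.1 using 2 <;> · congr 1; ring
    · rw [hmem]; convert! h.2 using 3 <;> · congr 1; ring
  have hDex : ∀ η, η ∉ ({ζ₀, ζ₁} : Set (Boundary ι)) → ∃ k, D k η := by
    intro η h
    rw [Set.mem_insert_iff, Set.mem_singleton_iff, not_or] at h
    exact H.exists_mem_domain hτ h.1 h.2
  have hDends : ∀ {k η}, D k η → η ∉ ({ζ₀, ζ₁} : Set (Boundary ι)) := by
    rintro k η h (rfl | h')
    · exact (H.edge _).2 h.1
    · rw [Set.mem_singleton_iff.1 h'] at h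
      exact h.2 (H.edge _).1
  let α : Boundary ι → K := fun η =>
    if h : ∃ k, D k η then χ (t ^ (-h.choose) • η) else χ η
  have hα : ∀ {k η}, D k η → α η = χ (t ^ (-k) • η) := by
    intro k η h
    have hex : ∃ k, D k η := ⟨k, h⟩
    simp only [α, dif_pos hex]
    rw [hDuniq hex.choose_spec h]
  -- along the fundamental domains that a line meets, its translates have the same colour
  have hmove : ∀ {η η' : Boundary ι} {j k : ℤ}, s(η, η') ∈ lines W → D j η' → D k η → j ≤ k →
      ∀ i, j ≤ i → i ≤ k → χ (t ^ (-i) • η) = χ (t ^ (-j) • η) := by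
    intro η η' j k hl hj hk hjk i hji
    induction i, hji using Int.leInduction with
    | base => exact fun _ => rfl
    | succ i hji ih =>
      intro hik
      rw [← ih (by omega)]
      have h1 : t ^ (-(i + 1)) • η ∈ shadow (y 0) (s 0) := by
        rw [hmem, zero_sub, neg_mul, neg_neg]
        exact hDle hk hik
      have h2 : t ^ (-(i + 1)) • η' ∉ shadow (y 0) (s 0) := by
        rw [hmem, zero_sub, neg_mul, neg_neg]
        exact hDlt hj (by omega)
      have := hstar (smul_mem_lines hl (t ^ (-(i + 1)))) h1 h2
      rw [← this, smul_smul, ← zpow_one_add]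
      congr 3
      ring
  have hαline : ∀ {η η' : Boundary ι} {j k : ℤ}, s(η, η') ∈ lines W → D j η' → D k η → j ≤ k →
      α η = α η' := by
    intro η η' j k hl hj hk hjk
    rw [hα hj, hα hk, hmove hl hj hk hjk k hjk le_rfl]
    exact hline (smul_mem_lines hl _)
  refine ⟨α, ⟨fun {η η'} hl h1 h2 => ?_, fun {η} h => ?_⟩, fun η => ?_, fun η h1 h2 => ?_,
    fun {η η'} hl h1 h2 h3 h4 => ?_⟩
  · obtain ⟨k, hk⟩ := hDex η h1
    obtain ⟨j, hj⟩ := hDex η' h2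
    rcases le_total j k with hjk | hjk
    · exact hαline hl hj hk hjk
    · exact (hαline (Sym2.eq_swap ▸ hl) hk hj hjk).symm
  · obtain ⟨k, hk⟩ := hDex η h
    have hk0 := hDmap (-k) hk
    rw [add_neg_cancel] at hk0
    have hξ : η ∉ (t ^ (-k) • ·) ⁻¹' ({ξ₀, ξ₁} : Set (Boundary ι)) := by
      rintro (e | e)
      · refine h₀ ?_
        have h1 := hk0.1
        rw [zero_mul] at h1
        rwa [← (show t ^ (-k) • η = ξ₀ from e)]
      · refine hk0.2 ?_
        rw [zero_add, one_mul]
        rwa [show t ^ (-k) • η = ξ₁ from e]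
    filter_upwards [(hχ.smul (t ^ (-k))).eventually_eq hξ,
      (isOpen_shadow _ _).eventually_mem hk.1,
      (isClosed_shadow _ _).isOpen_compl.eventually_mem hk.2] with η' e1 e2 e3
    have hk' : D k η' := ⟨e2, e3⟩
    exact ⟨hDends hk', by rw [hα hk', hα hk, e1.2]⟩
  · by_cases h : η ∈ ({ζ₀, ζ₁} : Set (Boundary ι))
    · rcases h with rfl | h
      · rw [ht₀]
      · rw [Set.mem_singleton_iff.1 h, ht₁]
    · obtain ⟨k, hk⟩ := hDex η h
      have hk1 := hDmap 1 hk
      rw [zpow_one] at hk1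
      rw [hα hk, hα hk1, smul_smul, ← zpow_add_one]
      congr 3
      ring
  · have hD : D 0 η := ⟨by rwa [zero_mul], by rwa [zero_add, one_mul]⟩
    rw [hα hD, neg_zero, zpow_zero, one_smul]
  · have hη0 : η ≠ ζ₀ := fun e => (H.edge 0).2 (e ▸ h3)
    have hη1 : η' ≠ ζ₁ := fun e => h4 (e ▸ (H.edge τ).1)
    obtain ⟨k, hk⟩ := hDex η (by simp [h1, hη0])
    obtain ⟨j, hj⟩ := hDex η' (by simp [h2, hη1])
    have hk0 : 0 ≤ k := by
      by_contra! hc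
      exact hDlt hk hc (by rwa [zero_mul])
    have hj0 : j ≤ 0 := by
      by_contra! hc
      exact h4 (by simpa using hDle hj (by omega : 1 ≤ j))
    rw [hα hk, hmove hl hj hk (by omega) k (by omega) le_rfl,
      ← hmove hl hj hk (by omega) 0 hj0 hk0, neg_zero, zpow_zero, one_smul]

/-! ### Axes that approximate an uncrossed cut pair -/

theorem eq_of_mem_lines_of_preimage {x : DecompositionSpace W} {ξ η : Boundary ι}
    (hx : δ W ⁻¹' {x} = {ξ}) (hl : s(ξ, η) ∈ lines W) : η = ξ := by
  have h1 : ξ ∈ δ W ⁻¹' {x} := by rw [hx]; rfl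
  have h2 : δ W ξ = δ W η := Quot.sound hl
  have h3 : η ∈ δ W ⁻¹' {x} := h2.symm.trans h1
  rw [hx] at h3
  exact h3

theorem preimage_pair {x₀ x₁ : DecompositionSpace W} {ξ₀ ξ₁ : Boundary ι}
    (h₀ : δ W ⁻¹' {x₀} = {ξ₀}) (h₁ : δ W ⁻¹' {x₁} = {ξ₁}) :
    δ W ⁻¹' {x₀, x₁} = {ξ₀, ξ₁} := by
  rw [Set.insert_eq, Set.preimage_union, h₀, h₁, Set.insert_eq]

theorem IsColoring.line_of_preimage {K : Type*} {x₀ x₁ : DecompositionSpace W}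
    {ξ₀ ξ₁ : Boundary ι} {χ : Boundary ι → K} (hχ : IsColoring W {ξ₀, ξ₁} χ)
    (h₀ : δ W ⁻¹' {x₀} = {ξ₀}) (h₁ : δ W ⁻¹' {x₁} = {ξ₁}) {η η' : Boundary ι}
    (hl : s(η, η') ∈ lines W) : χ η = χ η' := by
  have key : ∀ {ζ ζ' : Boundary ι}, s(ζ, ζ') ∈ lines W → ζ ∈ ({ξ₀, ξ₁} : Set (Boundary ι)) →
      ζ' = ζ := by
    rintro ζ ζ' hl (rfl | h)
    · exact eq_of_mem_lines_of_preimage h₀ hl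
    · rw [Set.mem_singleton_iff] at h
      subst h
      exact eq_of_mem_lines_of_preimage h₁ hl
  by_cases h : η ∈ ({ξ₀, ξ₁} : Set (Boundary ι))
  · rw [key hl h]
  by_cases h' : η' ∈ ({ξ₀, ξ₁} : Set (Boundary ι))
  · exact congrArg χ (key (show s(η', η) ∈ lines W from Sym2.eq_swap ▸ hl) h')
  exact hχ.line hl h h'

/-- The last edge, going backwards from the edge with number `0`, that two geodesics have in
common. -/
theorem IsGeodesicParam.exists_branch {ξ₀ ξ₁ ζ₀ ζ₁ : Boundary ι} {x y : ℤ → FreeGroup ι}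
    {r s : ℤ → Letter ι} (Hx : IsGeodesicParam ξ₀ ξ₁ x r) (Hy : IsGeodesicParam ζ₀ ζ₁ y s)
    (h0 : x 0 = y 0) (h0' : r 0 = s 0) (hne : ξ₀ ≠ ζ₀) :
    ∃ R : ℕ, (∀ i ≤ R, x (-i : ℤ) = y (-i : ℤ) ∧ r (-i : ℤ) = s (-i : ℤ)) ∧
      r (-R - 1 : ℤ) ≠ s (-R - 1 : ℤ) := by
  have hstep : ∀ n : ℕ, (∀ i < n, r (-i - 1 : ℤ) = s (-i - 1 : ℤ)) →
      ∀ i ≤ n, x (-i : ℤ) = y (-i : ℤ) ∧ r (-i : ℤ) = s (-i : ℤ) := by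
    intro n hn i
    induction i with
    | zero => exact fun _ => by simp [h0, h0']
    | succ i ih =>
      intro hi
      have h1 := hn i (by omega)
      have h2 := Hx.step_pred (-i)
      rw [(ih (by omega)).1, Hy.step_pred (-i), h1] at h2
      have h3 : (-(i + 1 : ℕ) : ℤ) = -i - 1 := by push_cast; ring
      rw [h3]
      exact ⟨(mul_right_cancel h2).symm, h1⟩
  have hex : ∃ n : ℕ, r (-n - 1 : ℤ) ≠ s (-n - 1 : ℤ) := by
    by_contra! hc
    obtain ⟨m, hm0, hm⟩ := Hy.exists_mem hne
    obtain ⟨n, rfl⟩ : ∃ n : ℕ, m = -n := ⟨m.natAbs, by omega⟩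
    have h1 := hm _ le_rfl
    rw [← (hstep n (fun i _ => hc i) n le_rfl).1, ← (hstep n (fun i _ => hc i) n le_rfl).2] at h1
    exact (Hx.edge _).2 h1
  classical
  refine ⟨Nat.find hex, hstep _ fun i hi => ?_, Nat.find_spec hex⟩
  exact not_not.1 (Nat.find_min hex hi)

/-- If an axis and the geodesic `[ξ₀, ξ₁]` of an uncrossed cut pair have two edges in common that
correspond under the translation `t`, and `t` preserves the colours of the lines crossing the first
one, then the repelling end of `t` is `ξ₀`.  Otherwise the geodesics branch off from each other at
a vertex `u` before these edges.  The connectivity of the Whitehead graph over `u` with a vertex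
removed forces the colour of `ξ₀` in the periodic colouring along the axis to differ from the colour
of the repelling end in the colouring along `[ξ₀, ξ₁]`; and then `{t⁻¹ x₀, t x₀}` crosses
`{x₀, x₁}`. -/
theorem IsUncrossedCutPair.left_eq [Fintype ι] (hι : 1 < Fintype.card ι)
    (hWh : WhConnectedWithoutCutVertices W) {x₀ x₁ : DecompositionSpace W}
    (hu : IsUncrossedCutPair x₀ x₁) {ξ₀ ξ₁ : Boundary ι}
    (hx₀ : δ W ⁻¹' {x₀} = {ξ₀}) (hx₁ : δ W ⁻¹' {x₁} = {ξ₁}) {t h : FreeGroup ι} {a : Letter ι}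
    {ζ₀ ζ₁ : Boundary ι} (ht : IsLineEnds 1 t ζ₀ ζ₁) (hξ : EdgeOn ξ₀ ξ₁ h a)
    (hζ : EdgeOn ζ₀ ζ₁ h a) (hξ₁ : ξ₁ ∈ shadow (t * h) a)
    (hstar : ∀ χ : Boundary ι → Bool, IsColoring W {ξ₀, ξ₁} χ → ∀ {η η'}, s(η, η') ∈ lines W →
      η ∈ shadow h a → η' ∉ shadow h a → χ (t • η) = χ η) : ζ₀ = ξ₀ := by
  by_contra hne
  obtain ⟨y, s, Hy, hy0, hs0⟩ := hζ.exists_param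
  obtain ⟨x, r, Hx, hx0, hr0⟩ := hξ.exists_param
  obtain ⟨τ, hτ, hshift⟩ := Hy.exists_pos_shift ht
  obtain ⟨χ, hχ, hsurj⟩ := hu.1.2.1.exists_isColoring hι (finite_preimage_pair x₀ x₁)
  have hpre := preimage_pair hx₀ hx₁
  rw [hpre] at hχ
  have hline : ∀ {η η'}, s(η, η') ∈ lines W → χ η = χ η' := fun hl =>
    hχ.line_of_preimage hx₀ hx₁ hl
  have hmem : ∀ n {η : Boundary ι}, t • η ∈ shadow (y n) (s n) ↔
      η ∈ shadow (y (n - τ)) (s (n - τ)) := by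
    intro n η
    have := Hy.zpow_smul_mem_iff hshift 1 n (η := η)
    rwa [zpow_one, one_mul] at this
  have hmem' : ∀ n {η : Boundary ι}, t⁻¹ • η ∈ shadow (y n) (s n) ↔
      η ∈ shadow (y (n + τ)) (s (n + τ)) := by
    intro n η
    have := Hy.zpow_smul_mem_iff hshift (-1) n (η := η)
    rwa [zpow_neg_one, neg_one_mul, sub_neg_eq_add] at this
  have hξ₀S : ξ₀ ∉ shadow (y 0) (s 0) := by rw [hy0, hs0]; exact hξ.2
  have hξ₁S : ξ₁ ∈ shadow (y τ) (s τ) := by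
    have h1 := hshift 0
    rw [zero_add] at h1
    rwa [← h1.1, ← h1.2, hy0, hs0]
  obtain ⟨α, hα, hαt, hα0, hαline0⟩ := hχ.exists_periodic hline Hy hτ hshift ht.smul_left
    ht.smul_right hξ₀S hξ₁S (by rw [hy0, hs0]; exact hstar χ hχ)
  obtain ⟨R, hR, hRne⟩ := Hx.exists_branch Hy (hx0.trans hy0.symm) (hr0.trans hs0.symm)
    (Ne.symm hne)
  have hζne : ζ₀ ≠ ζ₁ := fun e => hζ.2 (e ▸ hζ.1)
  -- a line with one end of the axis is the axis
  have hax₁ : ∀ {η η'}, s(η, η') ∈ lines W → η = ζ₁ → η' ≠ ζ₁ → η' = ζ₀ := by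
    rintro η η' hl rfl h2
    exact ht.eq_of_mem_lines hζne hl h2
  have hax₀ : ∀ {η η'}, s(η, η') ∈ lines W → η' = ζ₀ → η ≠ ζ₀ → η = ζ₁ := by
    rintro η η' hl rfl h2
    exact ht.reverse.eq_of_mem_lines hζne.symm (Sym2.eq_swap ▸ hl) h2
  -- the two colourings agree on lines that cross an edge in front of which they agree
  have hXof : ∀ i : ℕ, (∀ η, η ∈ shadow (y (-i : ℤ)) (s (-i : ℤ)) → η ∉ shadow (y τ) (s τ) →
      α η = χ η) → ∀ {η η'}, s(η, η') ∈ lines W → η ∈ shadow (y (-i : ℤ)) (s (-i : ℤ)) →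
      η' ∉ shadow (y (-i : ℤ)) (s (-i : ℤ)) → η ≠ ζ₁ → α η = χ η := by
    intro i hA η η' hl h1 h2 h3
    by_cases h4 : η ∈ shadow (y τ) (s τ)
    · refine hαline0 hl h3 (fun e => ?_) (Hy.antitone (by omega) h4)
        (fun h5 => h2 (Hy.antitone (by omega) h5))
      exact h3 (hax₀ hl e fun e' => (Hy.edge _).2 (e' ▸ h1))
    · exact hA η h1 h4
  have hA : ∀ i : ℕ, i ≤ R → ∀ η, η ∈ shadow (y (-i : ℤ)) (s (-i : ℤ)) →
      η ∉ shadow (y τ) (s τ) → α η = χ η := by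
    intro i
    induction i with
    | zero =>
      intro _ η h1 h2
      exact hα0 η (by simpa using h1) h2
    | succ i ih =>
      intro hi η h1 h2
      have ih := ih (by omega)
      by_cases h3 : η ∈ shadow (y (-i : ℤ)) (s (-i : ℤ))
      · exact ih η h3 h2
      have e : (-(i + 1 : ℕ) : ℤ) = -i - 1 := by push_cast; ring
      rw [e] at h1
      obtain ⟨d, hd1, hd2, hd⟩ := Hy.exit_iff.1 ⟨h1, h3⟩
      have hri := hR i (by omega)
      have hri' := hR (i + 1) hi
      rw [e] at hri'
      obtain ⟨ζ, ζ', hl, hζm, ⟨d', h1', h2', hζ'⟩, hc⟩ :=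
        (hχ.prodMk hα).exists_line_of_exit hWh (v := y (-i : ℤ)) (Hy.ne_bar (-i : ℤ))
          (fun d h1 h2 η hη => by
            rw [Set.mem_union, not_or]
            refine ⟨?_, Hy.notMem_of_mem_shadow h2 h1 η hη⟩
            rw [← hri.1] at hη
            exact Hx.notMem_of_mem_shadow (by rwa [hri'.2]) (by rwa [hri.2]) η hη) hd2 hd1 hd
      rw [Prod.mk.injEq] at hc
      have hζ'Z := Hy.notMem_of_mem_shadow h2' h1' _ hζ'
      have hζ'S := (Hy.exit_iff.2 ⟨d', h2', h1', hζ'⟩).2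
      rw [Set.mem_insert_iff, Set.mem_singleton_iff, not_or] at hζ'Z
      have hζ1 : ζ ≠ ζ₁ := fun e => hζ'Z.1 (hax₁ hl e hζ'Z.2)
      have hζ0 : ζ ≠ ζ₀ := fun e => (Hy.edge _).2 (e ▸ hζm)
      rw [← hc.2, ← hc.1, ← hline hl, ← hXof i ih hl hζm hζ'S hζ1]
      exact (hα.line hl (by simp [hζ0, hζ1]) (by simp [hζ'Z])).symm
  have hX : ∀ {η η'}, s(η, η') ∈ lines W → η ∈ shadow (y (-R : ℤ)) (s (-R : ℤ)) →
      η' ∉ shadow (y (-R : ℤ)) (s (-R : ℤ)) → η ≠ ζ₁ → α η = χ η' := by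
    intro η η' hl h1 h2 h3
    rw [hXof R (hA R le_rfl) hl h1 h2 h3, hline hl]
  obtain ⟨hRx, hRr⟩ := hR R le_rfl
  -- the edges at the branch vertex: `f` leads forward, `c` to `ζ₀` and `c'` to `ξ₀`
  set u := y (-R : ℤ) with hu_def
  set f := s (-R : ℤ) with hf_def
  set c := (s (-R - 1 : ℤ)).bar with hc_def
  set c' := (r (-R - 1 : ℤ)).bar with hc'_def
  have hcc' : c ≠ c' := fun e => hRne (bar_injective e).symm
  have hcf : c ≠ f := (Hy.ne_bar _).symm
  have hc'f : c' ≠ f := by rw [← hRr]; exact (Hx.ne_bar _).symm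
  have hζ₀c : ζ₀ ∈ shadow u c := Hy.left_mem _
  have hξ₀c : ξ₀ ∈ shadow u c' := by rw [← hRx]; exact Hx.left_mem _
  have hZx : ∀ d, d ≠ c' → d ≠ f → ∀ η ∈ shadow u d, η ∉ ({ξ₀, ξ₁} : Set (Boundary ι)) := by
    intro d h1 h2
    rw [← hRx]
    exact Hx.notMem_of_mem_shadow h1 (by rwa [hRr])
  have hZy : ∀ d, d ≠ c → d ≠ f → ∀ η ∈ shadow u d, η ∉ ({ζ₀, ζ₁} : Set (Boundary ι)) :=
    fun d h1 h2 => Hy.notMem_of_mem_shadow h1 h2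
  have hχc : ∀ η ∈ shadow u c, χ η = χ ζ₀ := fun η hη =>
    hχ.eq_of_mem_shadow hWh (hZx c hcc' hcf) hη hζ₀c
  have hαc' : ∀ η ∈ shadow u c', α η = α ξ₀ := fun η hη =>
    hα.eq_of_mem_shadow hWh (hZy c' hcc'.symm hc'f) hη hξ₀c
  obtain ⟨C, hC⟩ : ∃ C : Bool, χ ζ₀ = !C := ⟨!χ ζ₀, by simp⟩
  have hCne : C ≠ χ ζ₀ := by rw [hC]; simp
  have hαξ₀ : α ξ₀ = C := by
    obtain ⟨θ, hθ, hθc⟩ := hsurj C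
    have hθ : θ ∉ ({ξ₀, ξ₁} : Set (Boundary ι)) := hpre ▸ hθ
    obtain ⟨ζ, ζ', hl, h1, h2, h3⟩ := hχ.exists_line_crossing hline hWh Hx hθ (-R : ℤ)
    rw [hRx, hRr] at h1 h2
    rw [hθc] at h3
    have h3' : χ ζ' = C := (hline hl).symm.trans h3
    have hζ'0 : ζ' ≠ ζ₀ := fun e => hCne (by rw [← h3', e])
    have hζ'1 : ζ' ≠ ζ₁ := fun e => h2 (e ▸ (Hy.edge _).1)
    have hζ1 : ζ ≠ ζ₁ := fun e => hζ'0 (hax₁ hl e hζ'1)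
    have hζ0 : ζ ≠ ζ₀ := fun e => (Hy.edge _).2 (e ▸ h1)
    have h4 : α ζ' = C := by
      rw [← hα.line hl (by simp [hζ0, hζ1]) (by simp [hζ'0, hζ'1]), hX hl h1 h2 hζ1, h3']
    let d := (u⁻¹ • ζ').1 0
    have hd : ζ' ∈ shadow u d := mem_shadow_self _ _
    have hdf : d ≠ f := fun e => h2 (e ▸ hd)
    have hdc : d ≠ c := fun e => hCne (by rw [← h3', hχc ζ' (e ▸ hd)])
    by_cases hdc' : d = c'
    · rw [← hαc' ζ' (hdc' ▸ hd), h4]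
    let B : Set (Letter ι) :=
      {d | d ≠ f ∧ d ≠ c ∧ d ≠ c' ∧ ∀ η ∈ shadow u d, χ η = C ∧ α η = C}
    obtain ⟨η, η', hl', ⟨d₁, hd₁, hη⟩, d₂, hd₂, hd₂f, hη'⟩ := exists_line_of_cut hWh u (f := f)
      (B := B) (b := d) (b' := c) (fun h => h.1 rfl)
      ⟨hdf, hdc, hdc', fun η hη =>
        ⟨(hχ.eq_of_mem_shadow hWh (hZx d hdc' hdf) hη hd).trans h3',
          (hα.eq_of_mem_shadow hWh (hZy d hdc hdf) hη hd).trans h4⟩⟩ (fun h => h.2.1 rfl) hcf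
    obtain ⟨hη1, hη2⟩ := hd₁.2.2.2 η hη
    have hη'χ : χ η' = C := (hline hl').symm.trans hη1
    by_cases hd₂c : d₂ = c
    · exact absurd (by rw [← hη'χ, hχc η' (hd₂c ▸ hη')]) hCne
    have hη'α : α η' = C := by
      rw [← hα.line hl' (hZy _ hd₁.2.1 hd₁.1 _ hη) (hZy _ hd₂c hd₂f _ hη'), hη2]
    by_cases hd₂c' : d₂ = c'
    · rw [← hαc' η' (hd₂c' ▸ hη'), hη'α]
    · exact absurd ⟨hd₂f, hd₂c, hd₂c', fun ζ hζ =>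
        ⟨(hχ.eq_of_mem_shadow hWh (hZx _ hd₂c' hd₂f) hζ hη').trans hη'χ,
          (hα.eq_of_mem_shadow hWh (hZy _ hd₂c hd₂f) hζ hη').trans hη'α⟩⟩ hd₂
  -- the translates `t⁻¹ ξ₀` and `t ξ₀` are on different sides of `[ξ₀, ξ₁]`
  have hξ₀u : ξ₀ ∉ shadow u f := fun h => hc'f (eq_of_mem_shadow hξ₀c h)
  have hξ₀u' : ξ₀ ∈ shadow (y (-R - 1 : ℤ)) (s (-R - 1 : ℤ)) := by
    by_contra h
    exact hcc' (eq_of_mem_shadow (Hy.mem_shadow_back.2 h) hξ₀c)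
  have hback : t⁻¹ • ξ₀ ∈ shadow u c := by
    rw [hu_def, hc_def, Hy.mem_shadow_back, hmem']
    exact fun h => hξ₀u (Hy.antitone (by omega) h)
  have hforw : t • ξ₀ ∈ shadow u f := (hmem _).2 (Hy.antitone (by omega) hξ₀u')
  have hforw' : t • ξ₀ ∉ shadow (y τ) (s τ) := fun h => hξ₀S (by
    rw [hmem, sub_self] at h; exact h)
  have hχback : χ (t⁻¹ • ξ₀) = !C := by rw [hχc _ hback, hC]
  have hχforw : χ (t • ξ₀) = C := by rw [← hA R le_rfl _ hforw hforw', hαt, hαξ₀]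
  have hξ₁u : ξ₁ ∈ shadow u f := Hy.antitone (by omega) hξ₁S
  have hx₀' : ∀ η, δ W η = x₀ ↔ η = ξ₀ := fun η => by
    have : η ∈ δ W ⁻¹' {x₀} ↔ η ∈ ({ξ₀} : Set (Boundary ι)) := by rw [hx₀]
    exact this
  have hx₁' : ∀ η, δ W η = x₁ ↔ η = ξ₁ := fun η => by
    have : η ∈ δ W ⁻¹' {x₁} ↔ η ∈ ({ξ₁} : Set (Boundary ι)) := by rw [hx₁]
    exact this
  have hδ₀ : δ W ξ₀ = x₀ := (hx₀' _).2 rfl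
  have hδ₁ : δ W ξ₁ = x₁ := (hx₁' _).2 rfl
  have hpair : ∀ η, δ W η ∉ ({δ W (t⁻¹ • ξ₀), δ W (t • ξ₀)} : Set (DecompositionSpace W)) ↔
      t • η ≠ ξ₀ ∧ t⁻¹ • η ≠ ξ₀ := by
    intro η
    rw [Set.mem_insert_iff, Set.mem_singleton_iff, not_or, ← smul_δ, ← smul_δ, hδ₀,
      eq_inv_smul_iff, ← inv_smul_eq_iff, smul_δ, smul_δ, hx₀', hx₀']
  -- `μ` marks the points outside the shadow of `f` translated by `t` that have the colour of `t⁻¹ ξ₀`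
  -- after translation by `t⁻¹`, and that of `ξ₀` after translation by `t`; in the latter condition
  -- the colouring is `α` on the shadow of `f`, continued by `χ`
  classical
  let μ : Boundary ι → Bool := fun η => decide (t⁻¹ • η ∉ shadow u f ∧ χ (t⁻¹ • η) = !C ∧
    (if t • η ∈ shadow u f then α η else χ (t • η)) = C)
  have hSS : ∀ {η}, t⁻¹ • η ∈ shadow u f → t • η ∈ shadow u f := fun h =>
    (hmem _).2 (Hy.antitone (by omega) ((hmem' _).1 h))
  have hends : ∀ {η}, t • η ∈ shadow u f → t⁻¹ • η ∉ shadow u f →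
      η ∉ ({ζ₀, ζ₁} : Set (Boundary ι)) := by
    rintro η h1 h2 (h3 | h3)
    · exact (Hy.edge _).2 (h3 ▸ (hmem _).1 h1)
    · exact h2 ((hmem' _).2 (Set.mem_singleton_iff.1 h3 ▸ (Hy.edge _).1))
  -- a line that crosses the edge `f` translated by `t` does not have its end outside coloured
  have hμaux : ∀ {η η'}, s(η, η') ∈ lines W → t⁻¹ • η ∈ shadow u f → t⁻¹ • η' ∉ shadow u f →
      μ η' = false := by
    intro η η' hl h1 h2
    refine decide_eq_false ?_
    rintro ⟨-, h3, h4⟩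
    have hη'1 : η' ≠ ζ₁ := fun e => h2 ((hmem' _).2 (e ▸ (Hy.edge _).1))
    by_cases h5 : η = ζ₁
    · have h6 := hax₁ hl h5 hη'1
      have h7 : t • η' = ζ₀ := by rw [h6, ht.smul_left]
      rw [h7, if_neg (Hy.edge _).2, hC] at h4
      simp at h4
    · have hη0 : η ≠ ζ₀ := fun e => (Hy.edge _).2 (e ▸ (hmem' _).1 h1)
      have h6 := hX (smul_mem_lines hl t⁻¹) h1 h2 (fun e => h5 (by
        rw [inv_smul_eq_iff, ht.smul_right] at e; exact e))
      have h7 : α (t⁻¹ • η) = α η := by rw [← hαt (t⁻¹ • η), smul_inv_smul]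
      rw [h7, h3] at h6
      by_cases h8 : t • η' ∈ shadow u f
      · rw [if_pos h8, ← hα.line hl (by simp [h5, hη0]) (hends h8 h2), h6] at h4
        simp at h4
      · rw [if_neg h8, ← hX (smul_mem_lines hl t) (hSS h1) h8 (fun e => h5 (by
          rw [smul_eq_iff_eq_inv_smul, ht.reverse.smul_left] at e; exact e)), hαt, h6] at h4
        simp at h4
  have hμ : IsColoring W (δ W ⁻¹' {δ W (t⁻¹ • ξ₀), δ W (t • ξ₀)}) μ := by
    refine ⟨fun {η η'} hl h1 h2 => ?_, fun {η} h1 => ?_⟩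
    · by_cases h3 : t⁻¹ • η ∈ shadow u f <;> by_cases h4 : t⁻¹ • η' ∈ shadow u f
      · simp [μ, h3, h4]
      · rw [hμaux hl h3 h4]
        simp [μ, h3]
      · rw [hμaux (Sym2.eq_swap ▸ hl) h4 h3]
        simp [μ, h4]
      · have e1 : χ (t⁻¹ • η) = χ (t⁻¹ • η') := hline (smul_mem_lines hl _)
        have e2 : (if t • η ∈ shadow u f then α η else χ (t • η)) =
            if t • η' ∈ shadow u f then α η' else χ (t • η') := by
          by_cases h5 : t • η ∈ shadow u f <;> by_cases h6 : t • η' ∈ shadow u f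
          · rw [if_pos h5, if_pos h6]
            exact hα.line hl (hends h5 h3) (hends h6 h4)
          · rw [if_pos h5, if_neg h6, ← hαt]
            refine hX (smul_mem_lines hl t) h5 h6 fun e => hends h5 h3 (Or.inr ?_)
            rw [smul_eq_iff_eq_inv_smul, ht.reverse.smul_left] at e
            exact e
          · rw [if_neg h5, if_pos h6, ← hαt η']
            refine (hX (smul_mem_lines (Sym2.eq_swap ▸ hl) t) h6 h5 fun e =>
              hends h6 h4 (Or.inr ?_)).symm
            rw [smul_eq_iff_eq_inv_smul, ht.reverse.smul_left] at e
            exact e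
          · rw [if_neg h5, if_neg h6]
            exact hline (smul_mem_lines hl _)
        simp only [μ, h3, h4, e1, e2]
    · refine ((finite_preimage_pair _ _).isClosed.isOpen_compl.eventually_mem h1).and ?_
      have h1' := (hpair η).1 h1
      by_cases h3 : t⁻¹ • η ∈ shadow u f
      · filter_upwards [((isOpen_shadow u f).preimage (continuous_const_smul t⁻¹)).eventually_mem
          h3] with η' h3'
        have h3' : t⁻¹ • η' ∈ shadow u f := h3'
        simp [μ, h3, h3']
      · have hη : η ∉ (t⁻¹ • ·) ⁻¹' ({ξ₀, ξ₁} : Set (Boundary ι)) := by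
          rintro (e | e)
          · exact h1'.2 e
          · exact h3 (by rw [show t⁻¹ • η = ξ₁ from e]; exact hξ₁u)
        have hev : ∀ᶠ η' in 𝓝 η, (if t • η' ∈ shadow u f then α η' else χ (t • η')) =
            if t • η ∈ shadow u f then α η else χ (t • η) := by
          by_cases h5 : t • η ∈ shadow u f
          · filter_upwards [((isOpen_shadow u f).preimage (continuous_const_smul t)).eventually_mem
              h5, hα.eventually_eq (hends h5 h3)] with η' h5' e
            have h5' : t • η' ∈ shadow u f := h5'
            rw [if_pos h5, if_pos h5', e.2]
          · have hη' : η ∉ (t • ·) ⁻¹' ({ξ₀, ξ₁} : Set (Boundary ι)) := by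
              rintro (e | e)
              · exact h1'.1 e
              · exact h5 (by rw [show t • η = ξ₁ from e]; exact hξ₁u)
            filter_upwards [((isClosed_shadow u f).isOpen_compl.preimage
              (continuous_const_smul t)).eventually_mem h5, (hχ.smul t).eventually_eq hη']
              with η' h5' e
            have h5' : t • η' ∉ shadow u f := h5'
            rw [if_neg h5, if_neg h5', e.2]
        filter_upwards [((isClosed_shadow u f).isOpen_compl.preimage
          (continuous_const_smul t⁻¹)).eventually_mem h3, (hχ.smul t⁻¹).eventually_eq hη, hev]
          with η' h3' e1 e2
        have h3' : t⁻¹ • η' ∉ shadow u f := h3'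
        simp only [μ, h3, h3', e1.2, e2]
  have hnotpair : ∀ η, η ≠ ξ₀ → η ≠ ξ₁ →
      δ W η ∉ ({x₀, x₁} : Set (DecompositionSpace W)) := by
    rintro η h1 h2 (h | h)
    · exact h1 ((hx₀' η).1 h)
    · exact h2 ((hx₁' η).1 h)
  have htξ₀ : t • ξ₀ ≠ ξ₀ := fun e => hξ₀u (e ▸ hforw)
  have htξ₀' : t⁻¹ • ξ₀ ≠ ξ₀ := fun e => hcc' (eq_of_mem_shadow hback (e.symm ▸ hξ₀c))
  rw [← hpre] at hχ
  refine hu.false_of_isColoring hχ (η₀ := t⁻¹ • ξ₀) (η₁ := t • ξ₀) ?_ ?_ ?_ hμ (θ := ξ₀) (θ' := ξ₁)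
    ?_ ?_ ?_ ?_ ?_
  · exact hnotpair _ htξ₀' fun e => hcf (eq_of_mem_shadow hback (e ▸ hξ₁u))
  · exact hnotpair _ htξ₀ fun e => hforw' (e ▸ hξ₁S)
  · rw [hχback, hχforw]; simp
  · exact (hpair _).2 ⟨htξ₀, htξ₀'⟩
  · refine (hpair _).2 ⟨fun e => ?_, fun e => ?_⟩
    · rw [← e] at hξ₀u
      exact hξ₀u ((hmem _).2 (Hy.antitone (by omega) hξ₁S))
    · rw [← e] at hξ₀u
      exact hξ₀u ((hmem' _).2 (Hy.antitone (by omega) hξ₁S))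
  · have h1 : μ ξ₀ = true := decide_eq_true
      ⟨fun h => hcf (eq_of_mem_shadow hback h), hχback, by rw [if_pos hforw, hαξ₀]⟩
    have h2 : μ ξ₁ = false := decide_eq_false fun h =>
      h.1 ((hmem' _).2 (Hy.antitone (by omega) hξ₁S))
    rw [h1, h2]
    simp
  · rw [← smul_δ, isCutPoint_smul, hδ₀]
    exact hu.1.2.2.1
  · rw [← smul_δ, isCutPoint_smul, hδ₀]
    exact hu.1.2.2.1

end

/-! ### Components of Whitehead graphs over geodesics -/

section

variable {ι : Type*}

theorem geodesic_comm (ξ₀ ξ₁ : Boundary ι) : geodesic ξ₀ ξ₁ = geodesic ξ₁ ξ₀ :=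
  Set.ext fun _ => ne_comm

theorem IsWhVertex.notMem_pair {ξ₀ ξ₁ : Boundary ι} {p : FreeGroup ι × Letter ι}
    (h : IsWhVertex (geodesic ξ₀ ξ₁) p) : ∀ η ∈ shadow p.1 p.2, η ∉ ({ξ₀, ξ₁} : Set _) := by
  have key : ∀ ξ₀ ξ₁ : Boundary ι, IsWhVertex (geodesic ξ₀ ξ₁) p → ξ₁ ∉ shadow p.1 p.2 := by
    intro ξ₀ ξ₁ h h1
    have he : EdgeOn ξ₀ ξ₁ p.1 p.2 := ⟨h1, fun h0 => h.1 (h0.trans h1.symm)⟩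
    exact h.2 fun e => he.next.2 e
  rintro η hη (rfl | hη1)
  · exact key ξ₁ η (geodesic_comm η ξ₁ ▸ h) hη
  · exact key ξ₀ ξ₁ h (Set.mem_singleton_iff.1 hη1 ▸ hη)

end

section

variable {ι : Type*} [DecidableEq ι] {W : Finset (FreeGroup ι)}

/-- The boundary points that a vertex or an edge of a Whitehead graph stands for: the shadow of the
vertex, or the ends of the line. -/
def whPoints : (FreeGroup ι × Letter ι) ⊕ Sym2 (Boundary ι) → Set (Boundary ι) :=
  Sum.elim (fun p => shadow p.1 p.2) fun l => {η | η ∈ l}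

theorem IsWhEdge.notMem_pair {ξ₀ ξ₁ : Boundary ι} {l : Sym2 (Boundary ι)}
    (h : IsWhEdge W (geodesic ξ₀ ξ₁) l) : ∀ η ∈ l, η ∉ ({ξ₀, ξ₁} : Set _) := by
  obtain ⟨-, ξ, η, p, q, rfl, hp, hq, -, hξ, hη⟩ := h
  intro ζ hζ
  rcases Sym2.mem_iff.1 hζ with rfl | rfl
  · exact hp.notMem_pair _ hξ
  · exact hq.notMem_pair _ hη

theorem inl_mem_whElements {X Y : Set (FreeGroup ι)} {p : FreeGroup ι × Letter ι} :
    .inl p ∈ whElements W X Y ↔ IsWhVertex X p ∧ p.1 * letter p.2 ∉ Y := by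
  constructor
  · rintro (⟨q, hq, h⟩ | ⟨l, hl, -⟩)
    · obtain rfl := Sum.inl.inj hq
      exact h
    · exact (Sum.inl_ne_inr hl).elim
  · exact fun h => Or.inl ⟨p, rfl, h⟩

theorem inr_mem_whElements {X Y : Set (FreeGroup ι)} {l : Sym2 (Boundary ι)} :
    .inr l ∈ whElements W X Y ↔ IsWhEdge W X l := by
  simp [whElements]

/-- A colouring of the complement of `{ξ₀, ξ₁}` is constant on the components of the Whitehead graph
over the geodesic `[ξ₀, ξ₁]`. -/
theorem IsColoring.eq_of_sameWhComponent {K : Type*} {ξ₀ ξ₁ : Boundary ι} {χ : Boundary ι → K}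
    (hχ : IsColoring W {ξ₀, ξ₁} χ) (hWh : WhConnectedWithoutCutVertices W)
    {e e' : (FreeGroup ι × Letter ι) ⊕ Sym2 (Boundary ι)}
    (h : SameWhComponent W (geodesic ξ₀ ξ₁) ∅ e e') {η η' : Boundary ι} (hη : η ∈ whPoints e)
    (hη' : η' ∈ whPoints e') : χ η = χ η' := by
  have hconst : ∀ e ∈ whElements W (geodesic ξ₀ ξ₁) ∅, ∀ η ∈ whPoints e, ∀ η' ∈ whPoints e,
      χ η = χ η' := by
    rintro (p | l) he η hη η' hη'
    · exact hχ.eq_of_mem_shadow hWh (inl_mem_whElements.1 he).1.notMem_pair hη hη'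
    · have hl := inr_mem_whElements.1 he
      by_cases hne : η = η'
      · rw [hne]
      · exact hχ.line ((Sym2.mem_and_mem_iff hne).1 ⟨hη, hη'⟩ ▸ hl.1) (hl.notMem_pair _ hη)
          (hl.notMem_pair _ hη')
  obtain ⟨he, -, ⟨w⟩⟩ := h
  induction w generalizing η with
  | nil => exact hconst _ he _ hη _ hη'
  | cons hadj _ ih =>
    rcases hadj with ⟨-, ⟨h1, h2, p, l, rfl, rfl, ξ, hξ, hξp⟩ | ⟨h2, h1, p, l, rfl, rfl, ξ, hξ, hξp⟩⟩
    · exact (hconst _ he _ hη _ hξp).trans (ih hξ hη' h2)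
    · exact (hconst _ he _ hη _ hξ).trans (ih hξp hη' h2)

/-- If an axis approximates the geodesic of an uncrossed cut pair, then it is this geodesic. -/
theorem Approximates.isLineEnds [Fintype ι] (hι : 1 < Fintype.card ι)
    (hWh : WhConnectedWithoutCutVertices W) {x₀ x₁ : DecompositionSpace W}
    (hu : IsUncrossedCutPair x₀ x₁) {ξ₀ ξ₁ : Boundary ι}
    (hx₀ : δ W ⁻¹' {x₀} = {ξ₀}) (hx₁ : δ W ⁻¹' {x₁} = {ξ₁}) {g h : FreeGroup ι} {a : Letter ι}
    (happ : Approximates W ξ₀ ξ₁ g h a) : IsLineEnds h g ξ₀ ξ₁ := by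
  obtain ⟨ζ₀, ζ₁, hends, ⟨he1, he2, he3, he4⟩, -, hcomp⟩ := happ
  have ht := isLineEnds_iff_conj.1 hends
  set t := h * g * h⁻¹ with ht_def
  have hth : t * h = h * g := by rw [ht_def, inv_mul_cancel_right]
  have hstar : ∀ χ : Boundary ι → Bool, IsColoring W {ξ₀, ξ₁} χ → ∀ {η η'}, s(η, η') ∈ lines W →
      η ∈ shadow h a → η' ∉ shadow h a → χ (t • η) = χ η := by
    intro χ hχ η η' hl h1 h2
    exact (hχ.eq_of_sameWhComponent hWh (hcomp _ hl ⟨η', η, Sym2.eq_swap, h1, h2⟩)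
      (Sym2.mem_mk_left η η') (Sym2.mem_map.2 ⟨η, Sym2.mem_mk_left η η', rfl⟩)).symm
  have h0 : ζ₀ = ξ₀ := hu.left_eq hι hWh hx₀ hx₁ ht he1 he3 (by rw [hth]; exact he2.1) hstar
  have h1 : ζ₁ = ξ₁ := by
    refine hu.symm.left_eq hι hWh hx₁ hx₀ (h := h * g * letter a) (a := a.bar) ht.reverse
      he2.reverse he4.reverse ?_ ?_
    · rw [← hth, mul_assoc, inv_mul_cancel_left]
      exact he1.reverse.1
    · intro χ hχ η η' hl h1 h2
      rw [Set.pair_comm] at hχ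
      rw [mem_shadow_bar, ← hth, mem_shadow_mul] at h1 h2
      rw [not_not] at h2
      have hline : ∀ {η η'}, s(η, η') ∈ lines W → χ η = χ η' := fun hl =>
        hχ.line_of_preimage hx₀ hx₁ hl
      have := hstar χ hχ (smul_mem_lines (Sym2.eq_swap ▸ hl) t⁻¹) h2 h1
      rw [smul_inv_smul, ← hline hl, ← hline (smul_mem_lines hl t⁻¹)] at this
      exact this.symm
  rwa [h0, h1] at hends

/-! ### The stabilizer of a pair of ends -/

theorem IsGeodesicParam.exists_generator {ξ₀ ξ₁ : Boundary ι} {y : ℤ → FreeGroup ι}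
    {s : ℤ → Letter ι} (H : IsGeodesicParam ξ₀ ξ₁ y s) {t : FreeGroup ι}
    (ht : IsLineEnds 1 t ξ₀ ξ₁) :
    ∃ k : FreeGroup ι, k ≠ 1 ∧ IsLineEnds 1 k ξ₀ ξ₁ ∧
      ∀ f : FreeGroup ι, f • ξ₀ = ξ₀ → f • ξ₁ = ξ₁ → f ∈ Subgroup.zpowers k := by
  have hex : ∃ n : ℕ, 0 < n ∧ ∃ f : FreeGroup ι, f • ξ₀ = ξ₀ ∧ f • ξ₁ = ξ₁ ∧ f * y 0 = y n := by
    obtain ⟨τ, hτ, h⟩ := H.exists_pos_shift ht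
    lift τ to ℕ using hτ.le
    exact ⟨τ, by omega, t, ht.smul_left, ht.smul_right, by simpa using (h 0).1⟩
  classical
  obtain ⟨hd, k, hk0, hk1, hk⟩ := Nat.find_spec hex
  have hmin := fun m hm => Nat.find_min (m := m) hex hm
  set d := Nat.find hex
  have hshift : ∀ {f : FreeGroup ι} {n : ℤ}, f • ξ₀ = ξ₀ → f • ξ₁ = ξ₁ → f * y 0 = y n →
      ∀ m, f * y m = y (m + n) ∧ s m = s (m + n) := by
    intro f n h0 h1 hf
    obtain ⟨τ, hτ⟩ := H.exists_shift h0 h1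
    have : τ = n := H.injective (by rw [← hf, (hτ 0).1, zero_add])
    rwa [← this]
  have hks := hshift hk0 hk1 hk
  have hkz0 : ∀ q : ℤ, k ^ q • ξ₀ = ξ₀ := fun q =>
    (MulAction.stabilizer (FreeGroup ι) ξ₀).zpow_mem hk0 q
  have hkz1 : ∀ q : ℤ, k ^ q • ξ₁ = ξ₁ := fun q =>
    (MulAction.stabilizer (FreeGroup ι) ξ₁).zpow_mem hk1 q
  refine ⟨k, ?_, H.isLineEnds (by omega : (0 : ℤ) < d) fun n => (hks n).1, fun f hf0 hf1 => ?_⟩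
  · rintro rfl
    have := H.injective (hk.symm.trans (one_mul (y 0)))
    omega
  · obtain ⟨σ, hσ⟩ := H.exists_shift hf0 hf1
    -- dividing with remainder, a power of `k` brings the shift below the minimal one
    have h1 := Int.emod_add_mul_ediv σ d
    have h2 := Int.emod_nonneg σ (by omega : (d : ℤ) ≠ 0)
    have h3 := Int.emod_lt_of_pos σ (by omega : (0 : ℤ) < d)
    have h4 : (k ^ (-(σ / d)) * f) * y 0 = y (σ % d) := by
      rw [mul_assoc, (hσ 0).1, (H.zpow_shift hks _ _).1]
      congr 1
      linarith
    have h5 : σ % d = 0 := by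
      by_contra hne
      refine hmin (σ % d).toNat (by omega) ⟨by omega, k ^ (-(σ / d)) * f, ?_, ?_, ?_⟩
      · rw [mul_smul, hf0, hkz0]
      · rw [mul_smul, hf1, hkz1]
      · rw [h4]
        congr 1
        omega
    rw [h5, mul_eq_right, zpow_neg, inv_mul_eq_one] at h4
    exact ⟨σ / d, h4⟩

/-- No element of the free group exchanges the ends of a geodesic. -/
theorem IsGeodesicParam.not_swap {ξ₀ ξ₁ : Boundary ι} {y : ℤ → FreeGroup ι}
    {s : ℤ → Letter ι} (H : IsGeodesicParam ξ₀ ξ₁ y s) {f : FreeGroup ι} (h0 : f • ξ₀ = ξ₁)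
    (h1 : f • ξ₁ = ξ₀) : False := by
  have H' := (H.smul f).reverse
  rw [h0, h1] at H'
  obtain ⟨c, hc, -⟩ := H.exists_eq_of_edgeOn (H'.edge 0)
  have h2 : ∀ n, f * y (-n) = y (n + c) := fun n =>
    (H'.unique (H.shift c) (by simpa using hc) n).1
  have h3 : f * (f * y 0) = y 0 := by
    have e1 := h2 0
    have e2 := h2 (-c)
    simp only [neg_zero, zero_add, neg_neg, neg_add_cancel] at e1 e2
    rw [e1, e2]
  have h4 : f ^ 2 = 1 := by
    rw [← mul_assoc, mul_eq_right] at h3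
    rw [pow_two, h3]
  have h5 : f = 1 := (pow_eq_one_iff_left two_ne_zero).1 h4
  rw [h5, one_smul] at h0
  exact (H.edge 0).2 (h0 ▸ (H.edge 0).1)

theorem exists_stabilizer_eq_zpowers {x₀ x₁ : DecompositionSpace W} (hne : x₀ ≠ x₁)
    {ξ₀ ξ₁ : Boundary ι} (hx₀ : δ W ⁻¹' {x₀} = {ξ₀}) (hx₁ : δ W ⁻¹' {x₁} = {ξ₁})
    {t : FreeGroup ι} (ht : IsLineEnds 1 t ξ₀ ξ₁) :
    ∃ k : FreeGroup ι, k ≠ 1 ∧ IsLineEnds 1 k ξ₀ ξ₁ ∧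
      MulAction.stabilizer (FreeGroup ι) ({x₀, x₁} : Set (DecompositionSpace W)) =
        Subgroup.zpowers k := by
  have hx₀' : ∀ η, δ W η = x₀ ↔ η = ξ₀ := fun η => by
    have : η ∈ δ W ⁻¹' {x₀} ↔ η ∈ ({ξ₀} : Set (Boundary ι)) := by rw [hx₀]
    exact this
  have hx₁' : ∀ η, δ W η = x₁ ↔ η = ξ₁ := fun η => by
    have : η ∈ δ W ⁻¹' {x₁} ↔ η ∈ ({ξ₁} : Set (Boundary ι)) := by rw [hx₁]
    exact this
  have hδ₀ : δ W ξ₀ = x₀ := (hx₀' _).2 rfl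
  have hδ₁ : δ W ξ₁ = x₁ := (hx₁' _).2 rfl
  have hξ : ξ₀ ≠ ξ₁ := by
    rintro rfl
    exact hne (hδ₀.symm.trans hδ₁)
  obtain ⟨y, s, H⟩ := exists_param hξ
  obtain ⟨k, hk, hkl, hgen⟩ := H.exists_generator ht
  refine ⟨k, hk, hkl, le_antisymm (fun f hf => ?_) ?_⟩
  · rw [MulAction.mem_stabilizer_iff] at hf
    have hf' : ({f • x₀, f • x₁} : Set (DecompositionSpace W)) = {x₀, x₁} := by
      rw [← hf]
      exact (Set.image_pair (f • ·) x₀ x₁).symm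
    rcases Set.pair_eq_pair_iff.1 hf' with ⟨h0, h1⟩ | ⟨h0, h1⟩
    · rw [← hδ₀, smul_δ, hδ₀, hx₀'] at h0
      rw [← hδ₁, smul_δ, hδ₁, hx₁'] at h1
      exact hgen f h0 h1
    · rw [← hδ₀, smul_δ, hx₁'] at h0
      rw [← hδ₁, smul_δ, hx₀'] at h1
      exact (H.not_swap h0 h1).elim
  · rw [Subgroup.zpowers_le, MulAction.mem_stabilizer_iff]
    have e0 : k • x₀ = x₀ := by rw [← hδ₀, smul_δ, hkl.smul_left]
    have e1 : k • x₁ = x₁ := by rw [← hδ₁, smul_δ, hkl.smul_right]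
    have := Set.image_pair (k • ·) x₀ x₁
    rw [e0, e1] at this
    exact this

/-! ### The components of the Whitehead graph as a colouring -/

omit [DecidableEq ι] in
theorem isWhVertex_geodesic {ξ₀ ξ₁ : Boundary ι} {p : FreeGroup ι × Letter ι}
    (h : p.1 ∈ geodesic ξ₀ ξ₁) (h₀ : ξ₀ ∉ shadow p.1 p.2) (h₁ : ξ₁ ∉ shadow p.1 p.2) :
    IsWhVertex (geodesic ξ₀ ξ₁) p :=
  ⟨h, fun h' => h' ((mem_shadow.1 (mem_shadow_bar.2 h₀)).trans
    (mem_shadow.1 (mem_shadow_bar.2 h₁)).symm)⟩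

namespace IsGeodesicParam

variable {ξ₀ ξ₁ : Boundary ι} {x : ℤ → FreeGroup ι} {r : ℤ → Letter ι}

theorem isWhVertex_iff (H : IsGeodesicParam ξ₀ ξ₁ x r) {p : FreeGroup ι × Letter ι} :
    IsWhVertex (geodesic ξ₀ ξ₁) p ↔
      ∃ n, p.1 = x n ∧ p.2 ≠ (r (n - 1)).bar ∧ p.2 ≠ r n := by
  constructor
  · intro h
    obtain ⟨n, hn⟩ := H.mem_geodesic_iff.1 h.1
    refine ⟨n, hn, fun e => ?_, fun e => ?_⟩
    · obtain ⟨ζ, hζ⟩ := shadow_nonempty p.1 p.2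
      refine h.notMem_pair ξ₀ ?_ (Or.inl rfl)
      rw [e, hn]
      exact H.left_mem n
    · refine h.notMem_pair ξ₁ ?_ (Or.inr rfl)
      rw [e, hn]
      exact (H.edge n).1
  · rintro ⟨n, hn, h1, h2⟩
    refine isWhVertex_geodesic (hn ▸ H.mem_geodesic n) ?_ ?_
    · rw [hn]
      exact fun h => h1 (eq_of_mem_shadow h (H.left_mem n))
    · rw [hn]
      exact fun h => h2 (eq_of_mem_shadow h (H.edge n).1)

theorem isWhVertex_unique (H : IsGeodesicParam ξ₀ ξ₁ x r) {p q : FreeGroup ι × Letter ι}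
    (hp : IsWhVertex (geodesic ξ₀ ξ₁) p) (hq : IsWhVertex (geodesic ξ₀ ξ₁) q) {η : Boundary ι}
    (hηp : η ∈ shadow p.1 p.2) (hηq : η ∈ shadow q.1 q.2) : p = q := by
  obtain ⟨n, hn, hn1, hn2⟩ := H.isWhVertex_iff.1 hp
  obtain ⟨m, hm, hm1, hm2⟩ := H.isWhVertex_iff.1 hq
  have e : n = m := H.exit_unique (H.exit_iff.2 ⟨_, hn1, hn2, hn ▸ hηp⟩)
    (H.exit_iff.2 ⟨_, hm1, hm2, hm ▸ hηq⟩)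
  have e1 : p.1 = q.1 := by rw [hn, hm, e]
  exact Prod.ext e1 (eq_of_mem_shadow hηp (e1 ▸ hηq))

theorem exists_isWhVertex (H : IsGeodesicParam ξ₀ ξ₁ x r) {η : Boundary ι}
    (h : η ∉ ({ξ₀, ξ₁} : Set (Boundary ι))) :
    ∃ p, IsWhVertex (geodesic ξ₀ ξ₁) p ∧ η ∈ shadow p.1 p.2 := by
  rw [Set.mem_insert_iff, Set.mem_singleton_iff, not_or] at h
  obtain ⟨n, hn⟩ := H.exists_exit h.1 h.2
  obtain ⟨d, h1, h2, hd⟩ := H.exit_iff.1 hn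
  exact ⟨(x n, d), H.isWhVertex_iff.2 ⟨n, rfl, h1, h2⟩, hd⟩

/-- A line of the pattern is an edge of the Whitehead graph over the geodesic if its ends leave the
geodesic along different edges. -/
theorem isWhEdge (H : IsGeodesicParam ξ₀ ξ₁ x r) {η η' : Boundary ι} (hl : s(η, η') ∈ lines W)
    (h : η ∉ ({ξ₀, ξ₁} : Set (Boundary ι))) (h' : η' ∉ ({ξ₀, ξ₁} : Set (Boundary ι)))
    (hne : ∀ p, IsWhVertex (geodesic ξ₀ ξ₁) p → η ∈ shadow p.1 p.2 → η' ∉ shadow p.1 p.2) :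
    IsWhEdge W (geodesic ξ₀ ξ₁) s(η, η') := by
  obtain ⟨p, hp, hηp⟩ := H.exists_isWhVertex h
  obtain ⟨q, hq, hηq⟩ := H.exists_isWhVertex h'
  refine ⟨hl, η, η', p, q, rfl, hp, hq, ?_, hηp, hηq⟩
  rintro rfl
  exact hne p hp hηp hηq

theorem isWhEdge_of_crossing (H : IsGeodesicParam ξ₀ ξ₁ x r) {η η' : Boundary ι}
    (hl : s(η, η') ∈ lines W)
    (h : η ∉ ({ξ₀, ξ₁} : Set (Boundary ι))) (h' : η' ∉ ({ξ₀, ξ₁} : Set (Boundary ι))) {n : ℤ}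
    (hn : η ∈ shadow (x n) (r n)) (hn' : η' ∉ shadow (x n) (r n)) :
    IsWhEdge W (geodesic ξ₀ ξ₁) s(η, η') := by
  refine H.isWhEdge hl h h' fun p hp h1 h2 => ?_
  obtain ⟨m, hm, hm1, hm2⟩ := H.isWhVertex_iff.1 hp
  have e1 := H.exit_iff.2 ⟨_, hm1, hm2, hm ▸ h1⟩
  have e2 := H.exit_iff.2 ⟨_, hm1, hm2, hm ▸ h2⟩
  by_cases hmn : m ≤ n
  · exact e1.2 (H.antitone hmn hn)
  · exact hn' (H.antitone (by omega : n ≤ m - 1) e2.1)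

/-- Colouring a boundary point by the component of the Whitehead graph over the geodesic in which it
lies. -/
theorem exists_component_coloring (H : IsGeodesicParam ξ₀ ξ₁ x r) :
    ∃ κ : Boundary ι → (whIncidence W (geodesic ξ₀ ξ₁) ∅).ConnectedComponent,
      IsColoring W {ξ₀, ξ₁} κ ∧ ∀ e ∈ whElements W (geodesic ξ₀ ξ₁) ∅, ∀ η ∈ whPoints e,
        κ η = (whIncidence W (geodesic ξ₀ ξ₁) ∅).connectedComponentMk e := by
  classical
  set G := whIncidence W (geodesic ξ₀ ξ₁) ∅ with hG
  let κ : Boundary ι → G.ConnectedComponent := fun η =>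
    if h : ∃ p, IsWhVertex (geodesic ξ₀ ξ₁) p ∧ η ∈ shadow p.1 p.2 then
      G.connectedComponentMk (.inl h.choose) else G.connectedComponentMk (.inr s(η, η))
  have hκ : ∀ {p η}, IsWhVertex (geodesic ξ₀ ξ₁) p → η ∈ shadow p.1 p.2 →
      κ η = G.connectedComponentMk (.inl p) := by
    intro p η hp hη
    have hex : ∃ p, IsWhVertex (geodesic ξ₀ ξ₁) p ∧ η ∈ shadow p.1 p.2 := ⟨p, hp, hη⟩
    simp only [κ, dif_pos hex]
    rw [H.isWhVertex_unique hex.choose_spec.1 hp hex.choose_spec.2 hη]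
  have hmem : ∀ e ∈ whElements W (geodesic ξ₀ ξ₁) ∅, ∀ η ∈ whPoints e,
      κ η = G.connectedComponentMk e := by
    rintro (p | l) he η hη
    · exact hκ (inl_mem_whElements.1 he).1 hη
    · have hl := inr_mem_whElements.1 he
      obtain ⟨p, hp, hηp⟩ := H.exists_isWhVertex (hl.notMem_pair η hη)
      rw [hκ hp hηp]
      refine SimpleGraph.ConnectedComponent.connectedComponentMk_eq_of_adj ?_
      refine (SimpleGraph.fromRel_adj _ _ _).2 ⟨by simp, Or.inl ⟨?_, he, p, l, rfl, rfl, η, hη, hηp⟩⟩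
      exact inl_mem_whElements.2 ⟨hp, Set.notMem_empty _⟩
  refine ⟨κ, ⟨fun {η η'} hl h h' => ?_, fun {η} h => ?_⟩, hmem⟩
  · by_cases hw : IsWhEdge W (geodesic ξ₀ ξ₁) s(η, η')
    · rw [hmem _ (inr_mem_whElements.2 hw) η (Sym2.mem_mk_left _ _),
        hmem _ (inr_mem_whElements.2 hw) η' (Sym2.mem_mk_right _ _)]
    · have : ∃ p, IsWhVertex (geodesic ξ₀ ξ₁) p ∧ η ∈ shadow p.1 p.2 ∧ η' ∈ shadow p.1 p.2 := by
        by_contra! hc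
        exact hw (H.isWhEdge hl h h' hc)
      obtain ⟨p, hp, h1, h2⟩ := this
      rw [hκ hp h1, hκ hp h2]
  · obtain ⟨p, hp, hη⟩ := H.exists_isWhVertex h
    filter_upwards [(isOpen_shadow _ _).eventually_mem hη] with η' hη'
    exact ⟨hp.notMem_pair η' hη', by rw [hκ hp hη, hκ hp hη']⟩

end IsGeodesicParam

/-! ### Repetitions along a geodesic -/

/-- The number of pairs consisting of a letter and a self-map of the finite set of the lines through
the vertex `1`. -/
noncomputable def repetitionBound (W : Finset (FreeGroup ι)) : ℕ :=
  Nat.card (Letter ι × ({l // l ∈ lines W ∧ ∃ a, LineCrosses l 1 a} →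
    {l // l ∈ lines W ∧ ∃ a, LineCrosses l 1 a}))

namespace IsGeodesicParam

variable {ξ₀ ξ₁ : Boundary ι} {x : ℤ → FreeGroup ι} {r : ℤ → Letter ι}

/-- By the pigeonhole principle there are two edges of the geodesic, close to each other, with the
same label, such that the translation from one to the other preserves the colours of the lines
crossing them: every colour is represented by a line crossing the edge with number `0`, so there are
boundedly many ways to colour the lines crossing an edge. -/
theorem exists_repetition [Finite ι] (H : IsGeodesicParam ξ₀ ξ₁ x r)
    (hWh : WhConnectedWithoutCutVertices W) {K : Type*} {κ : Boundary ι → K}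
    (hκ : IsColoring W {ξ₀, ξ₁} κ) (hline : ∀ {η η'}, s(η, η') ∈ lines W → κ η = κ η')
    (hends : ∀ {η η'}, s(η, η') ∈ lines W → η ≠ η' → η ∉ ({ξ₀, ξ₁} : Set (Boundary ι))) :
    ∃ i j : ℕ, i < j ∧ j ≤ repetitionBound W ∧ r i = r j ∧
      ∀ {η η'}, s(η, η') ∈ lines W → η ∈ shadow (x i) (r i) → η' ∉ shadow (x i) (r i) →
        κ ((x j * (x i)⁻¹) • η) = κ η := by
  classical
  let Λ := {l // l ∈ lines W ∧ ∃ a, LineCrosses l 1 a}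
  have : Finite Λ := (finite_lines_through_one W).to_subtype
  -- the lines `l'` crossing the edge with number `0` that have the same colour as `x i • l`
  let P : ℕ → Λ → Λ → Prop := fun i l l' => ∀ η ∈ l.1, ∀ η' ∈ l'.1, κ (x i • η) = κ (x 0 • η')
  let φ : ℕ → Λ → Λ := fun i l => if h : ∃ l', P i l l' then h.choose else l
  have hφ : ∀ i l, (∃ l', P i l l') → P i l (φ i l) := by
    intro i l h
    simp only [φ, dif_pos h]
    exact h.choose_spec
  have hconst : ∀ l ∈ lines W, ∀ g : FreeGroup ι, ∀ η ∈ l, ∀ η' ∈ l, κ (g • η) = κ (g • η') := by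
    intro l hl g η hη η' hη'
    by_cases hne : η = η'
    · rw [hne]
    · exact hline (smul_mem_lines ((Sym2.mem_and_mem_iff hne).1 ⟨hη, hη'⟩ ▸ hl) g)
  have hex : ∀ i l, ∃ l', P i l l' := by
    rintro i ⟨l, hl, a, η, η', rfl, hη, hη'⟩
    have hne : η ≠ η' := fun e => hη' (e ▸ hη)
    obtain ⟨ζ, ζ', hζl, hζ, hζ', hc⟩ := hκ.exists_line_crossing hline hWh H
      (hends (smul_mem_lines hl (x i)) fun e => hne (MulAction.injective _ e)) 0
    refine ⟨⟨s((x 0)⁻¹ • ζ, (x 0)⁻¹ • ζ'), smul_mem_lines hζl _, r 0, _, _, Sym2.eq_swap,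
      ?_, ?_⟩, ?_⟩
    · rw [← mem_shadow_mul, mul_one]; exact hζ
    · rw [← mem_shadow_mul, mul_one]; exact hζ'
    · intro θ hθ θ' hθ'
      rw [hconst _ hl (x i) θ hθ η (Sym2.mem_mk_left _ _), ← hc,
        hconst _ (smul_mem_lines hζl (x 0)⁻¹) (x 0) θ' hθ' _ (Sym2.mem_mk_left _ _), smul_inv_smul]
  have hinj : ¬ Function.Injective fun i : Fin (repetitionBound W + 1) => (r (i : ℕ), φ i) := by
    intro hinj
    have := Nat.card_le_card_of_injective _ hinj
    rw [Nat.card_fin] at this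
    exact Nat.not_succ_le_self _ this
  have : ∃ i j : ℕ, i < j ∧ j ≤ repetitionBound W ∧ r i = r j ∧ φ i = φ j := by
    rw [Function.Injective] at hinj
    push Not at hinj
    obtain ⟨i, j, he, hne⟩ := hinj
    rw [Prod.mk.injEq] at he
    rcases lt_or_gt_of_ne (Fin.val_ne_of_ne hne) with h | h
    · exact ⟨i, j, h, by omega, he.1, he.2⟩
    · exact ⟨j, i, h, by omega, he.1.symm, he.2.symm⟩
  obtain ⟨i, j, hij, hj, hr, hφij⟩ := this
  refine ⟨i, j, hij, hj, hr, fun {η η'} hl h1 h2 => ?_⟩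
  let l : Λ := ⟨s((x i)⁻¹ • η, (x i)⁻¹ • η'), smul_mem_lines hl _, r i, _, _, Sym2.eq_swap,
    by rw [← mem_shadow_mul, mul_one]; exact h1, by rw [← mem_shadow_mul, mul_one]; exact h2⟩
  have e1 := hφ i l (hex i l)
  have e2 := hφ j l (hex j l)
  rw [← hφij] at e2
  obtain ⟨θ, hθ⟩ : ∃ θ, θ ∈ (φ i l).1 := ⟨_, Sym2.out_fst_mem _⟩
  have e3 := e1 _ (Sym2.mem_mk_left _ _) θ hθ
  have e4 := e2 _ (Sym2.mem_mk_left _ _) θ hθ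
  rw [mul_smul, e4, ← e3, smul_inv_smul]

/-! ### Periodic words -/

omit [DecidableEq ι] in
theorem mk_map_range_add (w : ℕ → Letter ι) (m n : ℕ) :
    FreeGroup.mk ((List.range (m + n)).map w) =
      FreeGroup.mk ((List.range m).map w) * FreeGroup.mk ((List.range n).map fun k => w (m + k)) := by
  rw [FreeGroup.mul_mk, List.range_add, List.map_append, List.map_map]
  rfl

/-- The powers of a cyclically reduced word converge to a periodic infinite word. -/
theorem exists_convergesTo_pow {w : ℕ → Letter ι} {p : ℕ} (hp : 0 < p)
    (hw : ∀ n, n + 1 < p → w (n + 1) ≠ (w n).bar) (hw' : w 0 ≠ (w (p - 1)).bar) :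
    ∃ ρ : Boundary ι, ρ.1 0 = w 0 ∧
      ConvergesTo (fun m => FreeGroup.mk ((List.range p).map w) ^ m) ρ := by
  let ρ : Boundary ι := ⟨fun n => w (n % p), fun n => by
    change w ((n + 1) % p) ≠ (w (n % p)).bar
    have h1 := Nat.mod_lt n hp
    by_cases h : n % p + 1 < p
    · have : (n + 1) % p = n % p + 1 := by
        rw [Nat.add_mod, Nat.mod_eq_of_lt (by omega : 1 < p), Nat.mod_eq_of_lt h]
      rw [this]
      exact hw _ h
    · have h2 : n % p = p - 1 := by omega
      have : (n + 1) % p = 0 := by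
        rw [← Nat.mod_add_mod, h2, Nat.sub_add_cancel hp, Nat.mod_self]
      rw [this, h2]
      exact hw'⟩
  refine ⟨ρ, congrArg w (Nat.zero_mod p), ?_⟩
  have hpow : ∀ m, FreeGroup.mk ((List.range p).map w) ^ m = rayVertex 1 ρ (m * p) := by
    intro m
    have e : ∀ n, rayVertex 1 ρ n = FreeGroup.mk ((List.range n).map ρ.1) := fun n => by
      rw [rayVertex_eq, one_mul, inv_one, one_smul]
    have hp' : (List.range p).map w = (List.range p).map ρ.1 := by
      refine List.map_congr_left fun k hk => ?_
      exact (congrArg w (Nat.mod_eq_of_lt (List.mem_range.1 hk))).symm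
    induction m with
    | zero => simp [rayVertex]
    | succ m ih =>
      rw [pow_succ', ih, e, e, Nat.succ_mul, add_comm (m * p), mk_map_range_add, hp']
      congr 3
      funext k
      exact congrArg w (Nat.add_mod_left p k).symm
  simp only [hpow]
  exact (convergesTo_rayVertex 1 ρ).comp (tendsto_id.atTop_mul_const' hp)

theorem exists_convergesTo_pow_inv_mul (H : IsGeodesicParam ξ₀ ξ₁ x r) (i : ℤ) {q : ℕ} (hq : 0 < q)
    (hne : r i ≠ (r (i + q - 1)).bar) :
    ∃ ρ : Boundary ι, ρ.1 0 = r i ∧ ConvergesTo (fun m => ((x i)⁻¹ * x (i + q)) ^ m) ρ := by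
  obtain ⟨ρ, h, hc⟩ := exists_convergesTo_pow (w := fun n : ℕ => r (i + n)) hq
    (fun n _ => by
      have h := H.ne_bar (i + (n + 1 : ℕ))
      rwa [show i + ((n + 1 : ℕ) : ℤ) - 1 = i + n by push_cast; ring] at h)
    (by
      rwa [Nat.cast_zero, add_zero, Nat.cast_sub hq, Nat.cast_one, ← add_sub_assoc])
  have e : FreeGroup.mk ((List.range q).map fun n : ℕ => r (i + n)) = (x i)⁻¹ * x (i + q) := by
    rw [H.eq_mk, inv_mul_cancel_left]
    congr 2
    funext n
    exact (H.eq_rayVertex i n).2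
  rw [e] at hc
  exact ⟨ρ, by simpa using h, hc⟩

/-- Two edges of a geodesic with the same label lie on a common axis, whose translation moves the
first one to the second one. -/
theorem exists_axis (H : IsGeodesicParam ξ₀ ξ₁ x r) {i j : ℤ} (hij : i < j) (hr : r i = r j) :
    ∃ ζ₀ ζ₁, IsLineEnds (x i) ((x i)⁻¹ * x j) ζ₀ ζ₁ ∧ EdgeOn ζ₀ ζ₁ (x i) (r i) ∧
      EdgeOn ζ₀ ζ₁ (x j) (r i) := by
  obtain ⟨q, rfl⟩ := Int.le.dest hij.le
  have hq : 0 < q := by omega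
  have hne : r i ≠ (r (i + q - 1)).bar := hr ▸ H.ne_bar (i + q)
  obtain ⟨ρ₁, h₁, hc₁⟩ := H.exists_convergesTo_pow_inv_mul i hq hne
  obtain ⟨ρ₀, h₀, hc₀⟩ := H.reverse.exists_convergesTo_pow_inv_mul (-(i + q)) hq (by
    rw [neg_neg, show -(-(i + q) + q - 1) - 1 = i by ring, bar_bar]
    exact hne.symm)
  simp only [neg_neg, show -(-(i + q) + q) = i by ring] at h₀ hc₀
  rw [show (x (i + q))⁻¹ * x i = ((x i)⁻¹ * x (i + q))⁻¹ by group] at hc₀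
  have hl : IsLineEnds (x i) ((x i)⁻¹ * x (i + q)) (x i • ρ₀) (x i • ρ₁) :=
    ⟨hc₀.smul _, hc₁.smul _⟩
  have he : EdgeOn (x i • ρ₀) (x i • ρ₁) (x i) (r i) := by
    rw [EdgeOn, mem_shadow, mem_shadow, inv_smul_smul, inv_smul_smul, h₁, h₀]
    exact ⟨rfl, hne.symm⟩
  refine ⟨_, _, hl, he, ?_⟩
  have hl' := isLineEnds_iff_conj.1 hl
  have := he.smul (x i * ((x i)⁻¹ * x (i + q)) * (x i)⁻¹)
  rw [hl'.smul_left, hl'.smul_right, inv_mul_cancel_right, mul_inv_cancel_left] at this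
  exact this

theorem mem_segment_iff (H : IsGeodesicParam ξ₀ ξ₁ x r) {m n : ℤ} (hmn : m ≤ n)
    {v : FreeGroup ι} : v ∈ segment (x m) (x n) ↔ ∃ k, m ≤ k ∧ k ≤ n ∧ v = x k := by
  constructor
  · intro h
    obtain ⟨q, rfl⟩ := Int.le.dest hmn
    have hword := H.toWord_inv_mul m q
    have hAB : (x m)⁻¹ * x (m + q) = ((x m)⁻¹ * v) * (v⁻¹ * x (m + q)) := by group
    have happ : ((x m)⁻¹ * x (m + q)).toWord =
        ((x m)⁻¹ * v).toWord ++ (v⁻¹ * x (m + q)).toWord := by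
      rw [hAB]
      refine (FreeGroup.toWord_mul_sublist _ _).eq_of_length ?_
      rw [← hAB, List.length_append]
      exact Eq.symm h
    rw [hword] at happ
    have hlen := congrArg List.length happ
    rw [List.length_append, List.length_map, List.length_range] at hlen
    set k := ((x m)⁻¹ * v).toWord.length with hk
    have htake : ((x m)⁻¹ * v).toWord = (List.range k).map ((x m)⁻¹ • ξ₁).1 := by
      have := congrArg (List.take k) happ
      rw [List.take_left', ← List.map_take, List.take_range, min_eq_left (by omega)] at this
      · exact this.symm
      · rfl
    refine ⟨m + k, by omega, by omega, ?_⟩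
    rw [H.eq_mk, ← htake, FreeGroup.mk_toWord, mul_inv_cancel_left]
  · rintro ⟨k, h1, h2, rfl⟩
    have e1 := H.norm_inv_mul h1
    have e2 := H.norm_inv_mul h2
    have e3 := H.norm_inv_mul hmn
    change _ + _ = _
    omega

end IsGeodesicParam

/-! ### Whitehead graphs over segments -/

namespace IsGeodesicParam

variable {ξ₀ ξ₁ : Boundary ι} {x : ℤ → FreeGroup ι} {r : ℤ → Letter ι}

theorem isWhVertex_segment (H : IsGeodesicParam ξ₀ ξ₁ x r) {i j : ℤ} (hij : i < j)
    {p : FreeGroup ι × Letter ι} (hp : IsWhVertex (segment (x (i + 1)) (x j)) p) :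
    p = (x (i + 1), (r i).bar) ∨ p = (x j, r j) ∨
      (IsWhVertex (geodesic ξ₀ ξ₁) p ∧ ∃ k, i < k ∧ k ≤ j ∧ p.1 = x k) := by
  obtain ⟨k, h1, h2, hk⟩ := (H.mem_segment_iff (by omega)).1 hp.1
  by_cases e1 : p.2 = (r (k - 1)).bar
  · left
    obtain rfl : k = i + 1 := by
      by_contra hne
      refine hp.2 ((H.mem_segment_iff (by omega)).2 ⟨k - 1, by omega, by omega, ?_⟩)
      rw [hk, e1, H.step_pred k, letter_bar, mul_inv_cancel_right]
    rw [add_sub_cancel_right] at e1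
    exact Prod.ext hk e1
  · by_cases e2 : p.2 = r k
    · right; left
      obtain rfl : k = j := by
        by_contra hne
        refine hp.2 ((H.mem_segment_iff (by omega)).2 ⟨k + 1, by omega, by omega, ?_⟩)
        rw [hk, e2, H.step]
      exact Prod.ext hk e2
    · exact Or.inr (Or.inr ⟨H.isWhVertex_iff.2 ⟨k, hk, e1, e2⟩, k, by omega, h2, hk⟩)

theorem exit_of_isWhVertex (H : IsGeodesicParam ξ₀ ξ₁ x r) {p : FreeGroup ι × Letter ι}
    (hp : IsWhVertex (geodesic ξ₀ ξ₁) p) {k : ℤ} (hk : p.1 = x k) {η : Boundary ι}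
    (hη : η ∈ shadow p.1 p.2) :
    η ∈ shadow (x (k - 1)) (r (k - 1)) ∧ η ∉ shadow (x k) (r k) := by
  obtain ⟨n, hn, h1, h2⟩ := H.isWhVertex_iff.1 hp
  obtain rfl : n = k := H.injective (hn.symm.trans hk)
  exact H.exit_iff.2 ⟨_, h1, h2, hn ▸ hη⟩

theorem mem_or_eq_of_isWhVertex_segment (H : IsGeodesicParam ξ₀ ξ₁ x r) {i j : ℤ} (hij : i < j)
    {p : FreeGroup ι × Letter ι} (hp : IsWhVertex (segment (x (i + 1)) (x j)) p) {η : Boundary ι}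
    (hη : η ∈ shadow p.1 p.2) :
    (η ∈ shadow (x i) (r i) ∨ p = (x (i + 1), (r i).bar)) ∧
      (η ∉ shadow (x j) (r j) ∨ p = (x j, r j)) := by
  rcases H.isWhVertex_segment hij hp with rfl | rfl | ⟨h, k, h1, h2, hk⟩
  · have h : η ∉ shadow (x i) (r i) := by
      rw [← Set.mem_compl_iff, H.compl_shadow]
      exact hη
    exact ⟨Or.inr rfl, Or.inl fun h' => h (H.antitone hij.le h')⟩
  · exact ⟨Or.inl (H.antitone hij.le hη), Or.inr rfl⟩
  · have := H.exit_of_isWhVertex h hk hη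
    exact ⟨Or.inl (H.antitone (by omega : i ≤ k - 1) this.1),
      Or.inl fun h' => this.2 (H.antitone h2 h')⟩

/-- The vertices of the Whitehead graph over a segment of a geodesic, other than the two that
correspond to the ends of the geodesic, are vertices of the Whitehead graph over the geodesic. -/
theorem mem_whElements_of_inl (H : IsGeodesicParam ξ₀ ξ₁ x r) {i j : ℤ} (hij : i < j)
    {p : FreeGroup ι × Letter ι}
    (hp : .inl p ∈ whElements W (segment (x (i + 1)) (x j)) {x i, x (j + 1)}) :
    .inl p ∈ whElements W (geodesic ξ₀ ξ₁) ∅ ∧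
      ∃ η ∈ shadow p.1 p.2, η ∈ shadow (x i) (r i) ∧ η ∉ shadow (x j) (r j) := by
  obtain ⟨hp, hY⟩ := inl_mem_whElements.1 hp
  obtain ⟨η, hη⟩ := shadow_nonempty p.1 p.2
  obtain ⟨h1, h2⟩ := H.mem_or_eq_of_isWhVertex_segment hij hp hη
  have e1 : p ≠ (x (i + 1), (r i).bar) := by
    rintro rfl
    refine hY (Or.inl ?_)
    rw [H.step, letter_bar, mul_inv_cancel_right]
  have e2 : p ≠ (x j, r j) := by
    rintro rfl
    exact hY (Or.inr (H.step j).symm)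
  refine ⟨inl_mem_whElements.2 ⟨?_, Set.notMem_empty _⟩, η, hη, h1.resolve_right e1,
    h2.resolve_right e2⟩
  rcases H.isWhVertex_segment hij hp with h | h | h
  exacts [(e1 h).elim, (e2 h).elim, h.1]

/-- The edges of the Whitehead graph over a segment of a geodesic are edges of the Whitehead graph
over the geodesic, provided that their ends are not ends of the geodesic. -/
theorem mem_whElements_of_inr (H : IsGeodesicParam ξ₀ ξ₁ x r) {i j : ℤ} (hij : i < j)
    {l : Sym2 (Boundary ι)} (hl : IsWhEdge W (segment (x (i + 1)) (x j)) l)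
    (hends : ∀ η ∈ l, η ∉ ({ξ₀, ξ₁} : Set (Boundary ι))) :
    IsWhEdge W (geodesic ξ₀ ξ₁) l ∧
      ∃ η η', l = s(η, η') ∧ η ∈ shadow (x i) (r i) ∧ η' ∉ shadow (x j) (r j) := by
  obtain ⟨hlW, η, η', p, q, rfl, hp, hq, hpq, hη, hη'⟩ := hl
  obtain ⟨h1, h2⟩ := H.mem_or_eq_of_isWhVertex_segment hij hp hη
  obtain ⟨h1', h2'⟩ := H.mem_or_eq_of_isWhVertex_segment hij hq hη'
  have hi : η ∈ shadow (x i) (r i) ∨ η' ∈ shadow (x i) (r i) := by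
    by_contra! hc
    exact hpq ((h1.resolve_left hc.1).trans (h1'.resolve_left hc.2).symm)
  have hj : η ∉ shadow (x j) (r j) ∨ η' ∉ shadow (x j) (r j) := by
    by_contra! hc
    exact hpq ((h2.resolve_left (not_not.2 hc.1)).trans (h2'.resolve_left (not_not.2 hc.2)).symm)
  have hle : ∀ {ζ : Boundary ι}, ζ ∈ shadow (x j) (r j) → ζ ∈ shadow (x i) (r i) := fun h =>
    H.antitone hij.le h
  refine ⟨H.isWhEdge hlW (hends _ (Sym2.mem_mk_left _ _)) (hends _ (Sym2.mem_mk_right _ _)) ?_, ?_⟩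
  · intro v hv hηv hηv'
    obtain ⟨k, hk, -⟩ := H.isWhVertex_iff.1 hv
    obtain ⟨a1, a2⟩ := H.exit_of_isWhVertex hv hk hηv
    obtain ⟨b1, b2⟩ := H.exit_of_isWhVertex hv hk hηv'
    have hik : i < k := by
      by_contra hc
      rcases hi with h | h
      exacts [a2 (H.antitone (by omega : k ≤ i) h), b2 (H.antitone (by omega : k ≤ i) h)]
    have hkj : k ≤ j := by
      by_contra hc
      rcases hj with h | h
      exacts [h (H.antitone (by omega : j ≤ k - 1) a1), h (H.antitone (by omega : j ≤ k - 1) b1)]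
    have key : ∀ {u : FreeGroup ι × Letter ι} {ζ : Boundary ι},
        IsWhVertex (segment (x (i + 1)) (x j)) u → ζ ∈ shadow u.1 u.2 → ζ ∈ shadow v.1 v.2 →
        ζ ∈ shadow (x (k - 1)) (r (k - 1)) → ζ ∉ shadow (x k) (r k) → u = v := by
      intro u ζ hu hζu hζv c1 c2
      rcases H.isWhVertex_segment hij hu with rfl | rfl | h
      · rw [← H.compl_shadow] at hζu
        exact (hζu (H.antitone (by omega : i ≤ k - 1) c1)).elim
      · exact (c2 (H.antitone hkj hζu)).elim
      · exact H.isWhVertex_unique h.1 hv hζu hζv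
    exact hpq ((key hp hη hηv a1 a2).trans (key hq hη' hηv' b1 b2).symm)
  · by_cases h : η ∈ shadow (x i) (r i) ∧ η' ∉ shadow (x j) (r j)
    · exact ⟨η, η', rfl, h⟩
    · rw [not_and_or, not_not] at h
      rcases h with h | h
      · exact ⟨η', η, Sym2.eq_swap, hi.resolve_left h, fun h' => h (hle h')⟩
      · exact ⟨η', η, Sym2.eq_swap, hle h, hj.resolve_right (not_not.2 h)⟩

end IsGeodesicParam

/-! ### Existence of approximations -/

/-- The geodesic joining the preimages of two points is approximated by an axis of bounded translation
length: the axis through a repetition along the geodesic.  Its Whitehead graph does not connect more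
than that of the geodesic does, since the colouring by components is periodic along the repetition
and yields a colouring for the axis. -/
theorem exists_approximates [Finite ι] (hWh : WhConnectedWithoutCutVertices W)
    {x₀ x₁ : DecompositionSpace W} (hne : x₀ ≠ x₁) {ξ₀ ξ₁ : Boundary ι}
    (hx₀ : δ W ⁻¹' {x₀} = {ξ₀}) (hx₁ : δ W ⁻¹' {x₁} = {ξ₁}) :
    ∃ (g h : FreeGroup ι) (a : Letter ι), Approximates W ξ₀ ξ₁ g h a ∧
      g.norm ≤ repetitionBound W := by
  have hξ : ξ₀ ≠ ξ₁ := by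
    rintro rfl
    have h0 : ξ₀ ∈ δ W ⁻¹' {x₀} := by rw [hx₀]; rfl
    have h1 : ξ₀ ∈ δ W ⁻¹' {x₁} := by rw [hx₁]; rfl
    exact hne (h0.symm.trans h1)
  obtain ⟨x, r, H⟩ := exists_param hξ
  obtain ⟨κ, hκ, hκe⟩ := H.exists_component_coloring (W := W)
  have hline : ∀ {η η'}, s(η, η') ∈ lines W → κ η = κ η' := fun hl => hκ.line_of_preimage hx₀ hx₁ hl
  have hends : ∀ {η η'}, s(η, η') ∈ lines W → η ≠ η' → η ∉ ({ξ₀, ξ₁} : Set (Boundary ι)) := by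
    rintro η η' hl hne (rfl | h)
    · exact hne (eq_of_mem_lines_of_preimage hx₀ hl).symm
    · obtain rfl := Set.mem_singleton_iff.1 h
      exact hne (eq_of_mem_lines_of_preimage hx₁ hl).symm
  have hsame : ∀ {e f}, e ∈ whElements W (geodesic ξ₀ ξ₁) ∅ → f ∈ whElements W (geodesic ξ₀ ξ₁) ∅ →
      ∀ η ∈ whPoints e, ∀ η' ∈ whPoints f, κ η = κ η' →
      SameWhComponent W (geodesic ξ₀ ξ₁) ∅ e f := by
    intro e f he hf η hη η' hη' hc
    rw [hκe e he η hη, hκe f hf η' hη'] at hc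
    exact ⟨he, hf, SimpleGraph.ConnectedComponent.exact hc⟩
  obtain ⟨i, j, hij, hj, hr, hstar⟩ := H.exists_repetition hWh hκ hline hends
  have hij' : (i : ℤ) < j := by exact_mod_cast hij
  obtain ⟨ζ₀, ζ₁, hζ, hζi, hζj⟩ := H.exists_axis hij' hr
  have hg : x i * ((x i)⁻¹ * x j) = x j := mul_inv_cancel_left _ _
  refine ⟨(x i)⁻¹ * x j, x i, r i, ⟨ζ₀, ζ₁, hζ, ⟨H.edge i, ?_, hζi, ?_⟩, ?_, ?_⟩, ?_⟩
  · rw [hg, hr]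
    exact H.edge j
  · rwa [hg]
  · have ht := isLineEnds_iff_conj.1 hζ
    rw [hg] at ht ⊢
    rw [← H.step i, hr, ← H.step j]
    obtain ⟨y, s, Hζ, hy, hs⟩ := hζi.exists_param
    obtain ⟨τ, hτ, hshift⟩ := Hζ.exists_pos_shift ht
    have hyτ : y τ = x j := by
      rw [← zero_add τ, ← (hshift 0).1, hy, inv_mul_cancel_right]
    have hsτ : s τ = r j := by
      rw [← zero_add τ, ← (hshift 0).2, hs, hr]
    obtain ⟨α, hα, -, hα1, hα2⟩ := hκ.exists_periodic hline Hζ hτ hshift ht.smul_left ht.smul_right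
      (by rw [hy, hs]; exact (H.edge i).2) (by rw [hyτ, hsτ]; exact (H.edge j).1)
      (by rw [hy, hs]; exact hstar)
    rw [hy, hs, hyτ, hsτ] at hα1
    rw [hy, hs, hyτ, hsτ] at hα2
    -- a vertex or edge over the segment that survives over both geodesics has the same colour
    have key : ∀ e ∈ whElements W (segment (x (i + 1)) (x j)) {x i, x (j + 1)},
        e ∈ whElements W (geodesic ζ₀ ζ₁) ∅ →
        e ∈ whElements W (geodesic ξ₀ ξ₁) ∅ ∧ ∃ η ∈ whPoints e, α η = κ η := by
      rintro (p | l) he heζ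
      · obtain ⟨h, η, hη, h1, h2⟩ := H.mem_whElements_of_inl hij' he
        exact ⟨h, η, hη, hα1 η h1 h2⟩
      · have hl := inr_mem_whElements.1 he
        have hlζ := (inr_mem_whElements.1 heζ).notMem_pair
        obtain ⟨h, η, η', rfl, h1, h2⟩ := H.mem_whElements_of_inr hij' hl fun η hη => by
          obtain ⟨-, θ, θ', p, q, rfl, hp, hq, hpq, hθ, hθ'⟩ := inr_mem_whElements.1 heζ
          have hne : θ ≠ θ' := by
            rintro rfl
            exact hpq (Hζ.isWhVertex_unique hp hq hθ hθ')
          rcases Sym2.mem_iff.1 hη with rfl | rfl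
          · exact hends hl.1 hne
          · exact hends (Sym2.eq_swap ▸ hl.1) hne.symm
        refine ⟨inr_mem_whElements.2 h, η, Sym2.mem_mk_left _ _, hα2 h.1 ?_ ?_ h1 h2⟩
        · rintro rfl
          exact hlζ _ (Sym2.mem_mk_left _ _) (Or.inr rfl)
        · rintro rfl
          exact hlζ _ (Sym2.mem_mk_right _ _) (Or.inl rfl)
    intro e he f hf hnot hc
    obtain ⟨he', η, hη, hηα⟩ := key e he hc.1
    obtain ⟨hf', η', hη', hηα'⟩ := key f hf hc.2.1
    refine hnot (hsame he' hf' η hη η' hη' ?_)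
    rw [← hηα, ← hηα', hα.eq_of_sameWhComponent hWh hc hη hη']
  · rintro l hl ⟨η', η, rfl, h1, h2⟩
    rw [hg]
    have hne : η' ≠ η := fun e => h2 (e ▸ h1)
    have hl' := smul_mem_lines hl (x j * (x i)⁻¹)
    have hne' : (x j * (x i)⁻¹) • η' ≠ (x j * (x i)⁻¹) • η := fun e => hne (MulAction.injective _ e)
    have hsh : ∀ ζ : Boundary ι,
        (x j * (x i)⁻¹) • ζ ∈ shadow (x j) (r j) ↔ ζ ∈ shadow (x i) (r i) := fun ζ => by
      rw [mem_shadow, mem_shadow, hr, ← mul_smul, inv_mul_cancel_left]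
    have he := H.isWhEdge_of_crossing (Sym2.eq_swap ▸ hl) (hends (Sym2.eq_swap ▸ hl) hne.symm)
      (hends hl hne) h1 h2
    have he' := H.isWhEdge_of_crossing (Sym2.eq_swap ▸ hl') (hends (Sym2.eq_swap ▸ hl') hne'.symm)
      (hends hl' hne') ((hsh η).2 h1) (mt (hsh η').1 h2)
    rw [Sym2.map_mk, Sym2.eq_swap, @Sym2.eq_swap _ (_ • _)]
    exact hsame (inr_mem_whElements.2 he) (inr_mem_whElements.2 he') η (Sym2.mem_mk_left _ _) _
      (Sym2.mem_mk_left _ _) (hstar (Sym2.eq_swap ▸ hl) h1 h2).symm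
  · have := H.norm_inv_mul hij'.le
    omega

end

end LinePattern

open LinePattern in
theorem mainTheorem5 {ι : Type*} [Fintype ι] [DecidableEq ι] (hι : 1 < Fintype.card ι)
    (W : Finset (FreeGroup ι)) (hW : ∀ w ∈ W, w ≠ 1)
    (hconn : ConnectedSpace (DecompositionSpace W))
    (hWh : WhConnectedWithoutCutVertices W) :
    ∃ N : ℕ, ∀ x₀ x₁ : DecompositionSpace W, IsUncrossedCutPair x₀ x₁ →
      ∃ ξ₀ ξ₁ : Boundary ι,
        δ W ⁻¹' {x₀} = {ξ₀} ∧ δ W ⁻¹' {x₁} = {ξ₁} ∧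
        (∃ (g h : FreeGroup ι) (a : Letter ι), Approximates W ξ₀ ξ₁ g h a ∧
          ∃ c : FreeGroup ι, (c * g * c⁻¹).norm ≤ N) ∧
        (∀ (g h : FreeGroup ι) (a : Letter ι), Approximates W ξ₀ ξ₁ g h a →
          (∃ ζ₀ ζ₁ : Boundary ι, IsLineEnds h g ζ₀ ζ₁ ∧ δ W ζ₀ = x₀ ∧ δ W ζ₁ = x₁ ∧
            δ W ⁻¹' {x₀, x₁} = {ζ₀, ζ₁}) ∧
          (h * g * h⁻¹) • x₀ = x₀ ∧ (h * g * h⁻¹) • x₁ = x₁) ∧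
        (∃ k : FreeGroup ι, k ≠ 1 ∧ IsLineEnds 1 k ξ₀ ξ₁ ∧
          MulAction.stabilizer (FreeGroup ι) ({x₀, x₁} : Set (DecompositionSpace W)) =
            Subgroup.zpowers k) := by
  refine ⟨repetitionBound W, fun x₀ x₁ hu => ?_⟩
  obtain ⟨ξ₀, hx₀⟩ := hu.exists_preimage_eq hι hWh
  obtain ⟨ξ₁, hx₁⟩ := hu.symm.exists_preimage_eq hι hWh
  have hδ₀ : δ W ξ₀ = x₀ := by
    have : ξ₀ ∈ δ W ⁻¹' {x₀} := by rw [hx₀]; rfl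
    exact this
  have hδ₁ : δ W ξ₁ = x₁ := by
    have : ξ₁ ∈ δ W ⁻¹' {x₁} := by rw [hx₁]; rfl
    exact this
  obtain ⟨g, h, a, happ, hg⟩ := exists_approximates hWh hu.1.1 hx₀ hx₁
  refine ⟨ξ₀, ξ₁, hx₀, hx₁, ⟨g, h, a, happ, 1, by simpa using hg⟩, fun g h a happ => ?_,
    exists_stabilizer_eq_zpowers hu.1.1 hx₀ hx₁
      (isLineEnds_iff_conj.1 (happ.isLineEnds hι hWh hu hx₀ hx₁))⟩
  have hends := happ.isLineEnds hι hWh hu hx₀ hx₁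
  have ht := isLineEnds_iff_conj.1 hends
  refine ⟨⟨ξ₀, ξ₁, hends, hδ₀, hδ₁, preimage_pair hx₀ hx₁⟩, ?_, ?_⟩
  · rw [← hδ₀, smul_δ, ht.smul_left]
  · rw [← hδ₁, smul_δ, ht.smul_right]
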